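/- **Setting.** An agent chooses in each period $t$ one of $J\ge 1$ alternatives. The state $x_t$ takes values in a measurable space, the period utility of $j$ is $u_j(x_t,\beta_0)+\epsilon_{jt}$ with $u_j$ measurable in the state, and $\delta$ is the discount parameter. The vectors $\epsilon_t=(\epsilon_{1t},\dots,\epsilon_{Jt})$ are i.i.d. over time and independent of $x_t$, with a known integrable law of full support $\mathbb R^J$. Given the past and present states and choices, $x_{t+1}$ is drawn from a law $Q_j(x_t,\cdot)$ that depends only on $x_t$ and the current choice $j$; alternative $1$ is a renewal, i.e. $Q_1(x,\cdot)$ does not depend on $x$. The expected value function $\bar v$ is measurable, integrable under every $Q_j(x,\cdot)$, and satisfies $\bar v(x)=E[\max_j\{\bar v_j(x)+\epsilon_j\}]$ with $\bar v_j(x)=u_j(x,\beta_0)+\delta\int \bar v\,dQ_j(x,\cdot)$; each period the agent chooses a maximizer of $\bar v_j(x_t)+\epsilon_{jt}$. Let $y_t\in\{0,1\}^J$ be the vector of choice indicators, $z=(y,x,w)=(y_t,x_t,x_{t+1})$, and $F_0$ its law (for any fixed $t$). For $v=(v_2,\dots,v_J)\in\mathbb R^{J-1}$ and $v_1=0$ let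 $P_j(v)=\Pr(v_j+\epsilon_j\ge v_k+\epsilon_k\ \forall k)$, $P=(P_1,\dots,P_J)'$, $P_{\tilde v j}=\partial P/\partial v_j$, and $H(p)=E[\max_j\{\mathcal P^{-1}(p)_j+\epsilon_j\}]$, where $\mathcal P^{-1}$ is the inverse of $v\mapsto P(v)$ (with $\mathcal P^{-1}(p)_1=0$). $H$ is a function on the simplex, so $[\partial H(p)/\partial P]'d$ is its derivative in a direction $d$ whose coordinates sum to zero. **First steps and moments.** For a law $F$ of $z$ let $\gamma(F)$ consist of $\gamma_1(x)=E_F[y\mid x]$, $\gamma_j(x,\beta,\gamma_1)=E_F[u_1(w,\beta)+H(\gamma_1(w))\mid x,\,y_j=1]$ for $j=2,\dots,J$, and $\gamma_{J+1}(\beta,\gamma_1)=E_F[u_1(w,\beta)+H(\gamma_1(w))\mid y_1=1]$. Put $$\tilde v_j(x,\beta,\gamma)=u_j(x,\beta)-u_1(x,\beta)+\delta[\gamma_j(x,\beta,\gamma_1)-\gamma_{J+1}(\beta,\gamma_1)]\quad(j=2,\dots,J),\qquad m(z,\beta,\gamma)=A(x)[y-P(\tilde v(x,\beta,\gamma))],$$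 where $A(x)$ is a measurable $r\times J$ matrix. Let $\lambda(F)$ consist of $\pi_1=\Pr_F(y_1=1)$, $\lambda_1(x)=E_F[y_1\mid w=x]$, and, with $\tilde v=\tilde v(x,\beta,\gamma(F))$ inside the expectations, $\lambda_j(x)=E_F[A(x)P_{\tilde vj}(\tilde v)\,y_j/P_j(\tilde v)\mid w=x]$ and $a_j=E_F[A(x)P_{\tilde vj}(\tilde v)]$, $j=2,\dots,J$. Define $$\phi_1=-\delta\sum_{j=2}^J\{\lambda_j(x)-a_j\pi_1^{-1}\lambda_1(x)\}\,[\partial H(\gamma_1(x))/\partial P]'\{y-\gamma_1(x)\},$$ $$\phi_j=-\delta A(x)P_{\tilde vj}(\tilde v(x,\beta,\gamma))\frac{y_j}{P_j(\tilde v(x,\beta,\gamma))}\{u_1(w,\beta)+H(\gamma_1(w))-\gamma_j(x,\beta,\gamma_1)\}\quad(2\le j\le J),$$ $$\phi_{J+1}=\delta\Big(\sum_{j=2}^J a_j\Big)\pi_1^{-1}y_1\{u_1(w,\beta)+H(\gamma_1(w))-\gamma_{J+1}(\beta,\gamma_1)\},$$ and $\phi=\sum_{j=1}^{J+1}\phi_j$,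 $\psi=m+\phi$. Let $\mathcal G$ be the set of probability laws $G$ of $z$ with bounded density with respect to $F_0$, and $F_\tau=(1-\tau)F_0+\tau G$. **Regularity.** Let $\mu$ be the law of $x_t$, $\tilde v_0(x)=(\bar v_j(x)-\bar v_1(x))_{j\ge2}$ and $p_0(x)=P(\tilde v_0(x))$. $P$ is $C^1$ and $H$ is $C^1$ on the open simplex; $A$ and $\bar v$ are $\mu$-integrable; and for some constants $C$ and $0<\eta<1$ and some $\mu$-integrable $b$, for $\mu$-almost all $x$: (i) $\int|\bar v-\int\bar v\,dQ_j(x,\cdot)|\,dQ_j(x,\cdot)\le C$ for all $j$; (ii) $|[\partial H(q)/\partial P]'d|\le C$ whenever $\sum_jq_j=1$, $|q_j-p_{0j}(x)|\le\eta\,p_{0j}(x)$, $\sum_jd_j=0$ and $|d_j|\le p_{0j}(x)$ for all $j$; (iii) every entry of $A(x)P_{\tilde vj}(v)/P_j(v)$, $2\le j\le J$, is at most $b(x)$ in absolute value whenever $|v_k-\tilde v_{0k}(x)|\le\eta$ for all $k$. **Theorem 2.** If the marginal distribution of $x_t$ does not vary with $t$, then $\psi$ is a vector of locally robust moment functions with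 adjustment term $\phi$ at $\beta_0$. That is, with $\gamma_0=\gamma(F_0)$, $\lambda_0=\lambda(F_0)$, $E$ the expectation under $F_0$, and derivatives from the right at $\tau=0$: 1. $E[\psi(z,\beta_0,\gamma_0,\lambda_0)]=0$, and for every $G\in\mathcal G$ the expectations defining $\gamma(F_\tau),\lambda(F_\tau)$ and $E[\psi(z,\beta_0,\gamma(F_\tau),\lambda(F_\tau))]$ exist for all small $\tau\ge0$ and $$\frac{d}{d\tau}E[\psi(z,\beta_0,\gamma(F_\tau),\lambda(F_\tau))]=0.$$ 2. $E[\phi(z,\beta_0,\gamma_0,\lambda_0)]=0$, and $\frac{d}{d\tau}E[m(z,\beta_0,\gamma(F_\tau))]=\int\phi(z,\beta_0,\gamma_0,\lambda_0)\,G(dz)$ for every $G\in\mathcal G$. 3. For each $j=1,\dots,J+1$, $E[\phi_j(z,\beta_0,\gamma_0,\lambda_0)]=0$, and $\frac{d}{d\tau}E[m(z,\beta_0,\gamma^{(j)}_\tau)]=\int\phi_j(z,\beta_0,\gamma_0,\lambda_0)\,G(dz)$ for every $G\in\mathcal G$, where $\gamma^{(j)}_\tau$ is $\gamma_0$ with its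 $j$-th component replaced by that of $\gamma(F_\tau)$. -/

import Mathlib

open MeasureTheory ProbabilityTheory Filter Topology Set
open scoped NNReal ENNReal

noncomputable section

namespace DDC

/-! ### Static choice: choice probabilities, their inverse, and expected surplus

There are `K + 1` alternatives; alternative `0` is the normalized (later: renewal) one. -/

section Static

variable {K : ℕ}

/-- The full vector `(0, v₁, …, v_K)` of normalized values. -/
def fullValue (v : Fin K → ℝ) : Fin (K + 1) → ℝ := Fin.cons 0 v

/-- Choice probabilities when the disturbances have law `Q`, as a function of the value
differences with respect to alternative `0`. -/
def choiceProb (Q : Measure (Fin (K + 1) → ℝ)) (v : Fin K → ℝ) : Fin (K + 1) → ℝ :=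
  fun j => Q.real {e | ∀ k, fullValue v k + e k ≤ fullValue v j + e j}

/-- The vector of partial derivatives of the choice probabilities with respect to the value
difference of the `j`-th non-normalized alternative. -/
def choiceProbDeriv (Q : Measure (Fin (K + 1) → ℝ)) (j : Fin K) (v : Fin K → ℝ) :
    Fin (K + 1) → ℝ :=
  fderiv ℝ (choiceProb Q) v (Pi.single j 1)

/-- The inverse map from choice probabilities to value differences. -/
def invChoiceProb (Q : Measure (Fin (K + 1) → ℝ)) : (Fin (K + 1) → ℝ) → (Fin K → ℝ) :=
  Function.invFun (choiceProb Q)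

/-- `H(P) = E[max_j (v_j + ε_j)]`, with `v` the value differences that rationalize `P`. -/
def surplus (Q : Measure (Fin (K + 1) → ℝ)) (p : Fin (K + 1) → ℝ) : ℝ :=
  ∫ e, (⨆ j, (fullValue (invChoiceProb Q p) j + e j)) ∂Q

/-- `H` in the free coordinates of the simplex: the probability of alternative `0` is one minus
the sum of the others. -/
def surplusRed (Q : Measure (Fin (K + 1) → ℝ)) (q : Fin K → ℝ) : ℝ :=
  surplus Q (Fin.cons (1 - ∑ j, q j) q)

/-- The product `[∂H(p)/∂P]' d`, for `p` in the simplex and `d` a direction whose coordinates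
sum to zero (the only directions in which `H` is defined). -/
def surplusDeriv (Q : Measure (Fin (K + 1) → ℝ)) (p d : Fin (K + 1) → ℝ) : ℝ :=
  fderiv ℝ (surplusRed Q) (Fin.tail p) (Fin.tail d)

end Static

/-! ### The dynamic model -/

/-- Primitives: period utilities, discount parameter, law of the disturbances (integrable, with
full support) and state transitions, alternative `0` being a renewal. -/
structure Model (K : ℕ) (X Θ : Type*) [MeasurableSpace X] where
  /-- period utility of each alternative -/
  u : Fin (K + 1) → X → Θ → ℝ
  /-- discount parameter -/
  δ : ℝ
  /-- joint law of the disturbances of one period -/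
  errorLaw : Measure (Fin (K + 1) → ℝ)
  /-- law of next period's state given the choice and the state -/
  trans : Fin (K + 1) → Kernel X X
  measurable_u : ∀ j β, Measurable fun x => u j x β
  isProbabilityMeasure_errorLaw : IsProbabilityMeasure errorLaw
  fullSupport_errorLaw : errorLaw.IsOpenPosMeasure
  integrable_errorLaw : ∀ j, Integrable (fun e : Fin (K + 1) → ℝ => e j) errorLaw
  isMarkovKernel_trans : ∀ j, IsMarkovKernel (trans j)
  renewal : ∀ x x', trans 0 x = trans 0 x'

section Dynamic

variable {K : ℕ} {X Θ : Type*} [MeasurableSpace X]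

/-- The expected value function conditional on a choice, `u_j + δ E[v(x') | x, j]`. -/
def Model.condValue (M : Model K X Θ) (β : Θ) (v : X → ℝ) (j : Fin (K + 1)) (x : X) : ℝ :=
  M.u j x β + M.δ * ∫ x', v x' ∂(M.trans j x)

/-- `v` is an expected value function: it solves the Bellman equation. -/
structure Model.IsValueFunction (M : Model K X Θ) (β : Θ) (v : X → ℝ) : Prop where
  measurable : Measurable v
  integrable : ∀ j x, Integrable v (M.trans j x)
  bellman : ∀ x, v x = ∫ e, (⨆ j, (M.condValue β v j x + e j)) ∂M.errorLaw

/-- True value differences with respect to the renewal choice. -/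
def Model.valueDiff (M : Model K X Θ) (β : Θ) (v : X → ℝ) (x : X) : Fin K → ℝ :=
  fun j => M.condValue β v j.succ x - M.condValue β v 0 x

/-- True choice probabilities in a state. -/
def Model.trueProb (M : Model K X Θ) (β : Θ) (v : X → ℝ) (x : X) : Fin (K + 1) → ℝ :=
  choiceProb M.errorLaw (M.valueDiff β v x)

/-- The states `x`, disturbances `ε` and choices `y` follow the model with parameter `β` and
expected value function `v`. -/
structure Model.Generates (M : Model K X Θ) (β : Θ) (v : X → ℝ) {Ω : Type*} [MeasurableSpace Ω]
    (Pr : Measure Ω) (x : ℕ → Ω → X) (ε : ℕ → Ω → Fin (K + 1) → ℝ) (y : ℕ → Ω → Fin (K + 1)) :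
    Prop where
  measurable_state : ∀ t, Measurable (x t)
  measurable_error : ∀ t, Measurable (ε t)
  measurable_choice : ∀ t, Measurable (y t)
  /-- the disturbances have the known law … -/
  error_law : ∀ t, Pr.map (ε t) = M.errorLaw
  /-- … are independent over time … -/
  error_indep : iIndepFun ε Pr
  /-- … and independent of the current state -/
  error_indep_state : ∀ t, IndepFun (ε t) (x t) Pr
  /-- the choice maximizes the expected present discounted value of utility -/
  optimal : ∀ t, ∀ᵐ ω ∂Pr, ∀ k,
    M.condValue β v k (x t ω) + ε t ω k ≤ M.condValue β v (y t ω) (x t ω) + ε t ω (y t ω)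
  /-- given past and present states and choices, the next state is drawn from the transition
  kernel of the present choice at the present state -/
  markov : ∀ t, ∀ B : Set X, MeasurableSet B →
    Pr[(x (t + 1) ⁻¹' B).indicator (fun _ => (1 : ℝ)) |
        ⨆ s ∈ Set.Iic t, (MeasurableSpace.comap (x s) inferInstance ⊔
          MeasurableSpace.comap (y s) inferInstance)]
      =ᵐ[Pr] fun ω => (M.trans (y t ω) (x t ω)).real B

/-! ### First steps -/

/-- A data observation `z = (y, x, w)`: choice, state, next state. -/
abbrev Obs (K : ℕ) (X : Type*) : Type _ := Fin (K + 1) × X × X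

/-- The vector of choice indicators. -/
def ind (z : Obs K X) : Fin (K + 1) → ℝ := Pi.single z.1 1

/-- The conditional expectation `a ↦ E_F[f | h = a]`, as a function on the range space of `h`. -/
def condMean {Z S : Type*} [MeasurableSpace Z] [MeasurableSpace S] (F : Measure Z)
    [IsFiniteMeasure F] (f : Z → ℝ) (h : Z → S) (a : S) : ℝ :=
  ∫ s, s ∂(condDistrib f h F a)

/-- A possible value `γ` of the first steps: the choice probabilities `γ₁(x)`, for each
non-renewal choice `j` the function `γ_j(x, β, γ₁)`, and `γ_{J+1}(β, γ₁)`. -/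
structure FirstStep (K : ℕ) (X Θ : Type*) where
  ccp : X → Fin (K + 1) → ℝ
  cont : Fin K → Θ → (X → Fin (K + 1) → ℝ) → X → ℝ
  renew : Θ → (X → Fin (K + 1) → ℝ) → ℝ

/-- A possible value `λ` of the additional unknowns of the adjustment term: `λ₁(x)`, `λ_j(x)`
for the non-renewal choices, `π₁`, and the means `E[A P_{ṽj}]`. -/
structure Nuisance (K r : ℕ) (X : Type*) where
  revRenew : X → ℝ
  rev : Fin K → X → Fin r → ℝ
  probRenew : ℝ
  mean : Fin K → Fin r → ℝ

/-- The term `u₁(w, β) + H(γ₁(w))`, at the next state `w` of the observation. -/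
def Model.nextTerm (M : Model K X Θ) (β : Θ) (γ₁ : X → Fin (K + 1) → ℝ) (z : Obs K X) : ℝ :=
  M.u 0 z.2.2 β + surplus M.errorLaw (γ₁ z.2.2)

/-- `γ(F)`: the conditional expectations that define the first steps, under the law `F`. -/
def Model.firstStep (M : Model K X Θ) (F : Measure (Obs K X)) [IsFiniteMeasure F] :
    FirstStep K X Θ where
  ccp x j := condMean F (fun z => ind z j) (fun z => z.2.1) x
  cont j β γ₁ x := condMean (cond F {z | z.1 = j.succ}) (M.nextTerm β γ₁) (fun z => z.2.1) x
  renew β γ₁ := ∫ z, M.nextTerm β γ₁ z ∂(cond F {z | z.1 = 0})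

/-- The value differences `ṽ(x, β, γ)`. -/
def Model.vTilde (M : Model K X Θ) (β : Θ) (γ : FirstStep K X Θ) (x : X) : Fin K → ℝ :=
  fun j => M.u j.succ x β - M.u 0 x β + M.δ * (γ.cont j β γ.ccp x - γ.renew β γ.ccp)

variable {r : ℕ}

/-- `A(x) P_{ṽj}(ṽ)`. -/
def Model.instDeriv (M : Model K X Θ) (A : X → Matrix (Fin r) (Fin (K + 1)) ℝ) (j : Fin K)
    (x : X) (v : Fin K → ℝ) : Fin r → ℝ :=
  (A x).mulVec (choiceProbDeriv M.errorLaw j v)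

/-- The weight `A(x) P_{ṽj}(ṽ) y_j / P_j(ṽ)` at `ṽ = ṽ(x, β, γ)`. -/
def Model.weight (M : Model K X Θ) (A : X → Matrix (Fin r) (Fin (K + 1)) ℝ) (β : Θ)
    (γ : FirstStep K X Θ) (j : Fin K) (z : Obs K X) : Fin r → ℝ :=
  (ind z j.succ / choiceProb M.errorLaw (M.vTilde β γ z.2.1) j.succ) •
    M.instDeriv A j z.2.1 (M.vTilde β γ z.2.1)

/-- `λ(F)`: reverse conditional expectations given the next state, `Pr_F(y₁ = 1)`, and
`E_F[A P_{ṽj}]`, all under the law `F` and at the first steps `γ(F)`. -/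
def Model.nuisance (M : Model K X Θ) (A : X → Matrix (Fin r) (Fin (K + 1)) ℝ) (β : Θ)
    (F : Measure (Obs K X)) [IsFiniteMeasure F] : Nuisance K r X where
  revRenew x := condMean F (fun z => ind z 0) (fun z => z.2.2) x
  rev j x i := condMean F (fun z => M.weight A β (M.firstStep F) j z i) (fun z => z.2.2) x
  probRenew := F.real {z | z.1 = 0}
  mean j := ∫ z, M.instDeriv A j z.2.1 (M.vTilde β (M.firstStep F) z.2.1) ∂F

/-! ### Moment functions -/

/-- The identifying moment functions `m(z, β, γ) = A(x) [y - P(ṽ(x, β, γ))]`. -/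
def Model.moment (M : Model K X Θ) (A : X → Matrix (Fin r) (Fin (K + 1)) ℝ) (β : Θ)
    (γ : FirstStep K X Θ) (z : Obs K X) : Fin r → ℝ :=
  (A z.2.1).mulVec (ind z - choiceProb M.errorLaw (M.vTilde β γ z.2.1))

/-- The adjustment term `φ₁` for the choice probabilities. -/
def Model.adjCcp (M : Model K X Θ) (_β : Θ) (γ : FirstStep K X Θ) (l : Nuisance K r X)
    (z : Obs K X) : Fin r → ℝ :=
  -(M.δ * surplusDeriv M.errorLaw (γ.ccp z.2.1) (ind z - γ.ccp z.2.1)) •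
    ∑ j, (l.rev j z.2.1 - (l.probRenew⁻¹ * l.revRenew z.2.1) • l.mean j)

/-- The adjustment term for the conditional expectation given the non-renewal choice `j`. -/
def Model.adjCont (M : Model K X Θ) (A : X → Matrix (Fin r) (Fin (K + 1)) ℝ) (β : Θ)
    (γ : FirstStep K X Θ) (j : Fin K) (z : Obs K X) : Fin r → ℝ :=
  -(M.δ * (M.nextTerm β γ.ccp z - γ.cont j β γ.ccp z.2.1)) • M.weight A β γ j z

/-- The adjustment term `φ_{J+1}` for the expectation given the renewal choice. -/
def Model.adjRenew (M : Model K X Θ) (β : Θ) (γ : FirstStep K X Θ) (l : Nuisance K r X)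
    (z : Obs K X) : Fin r → ℝ :=
  (M.δ * (l.probRenew⁻¹ * ind z 0) * (M.nextTerm β γ.ccp z - γ.renew β γ.ccp)) •
    ∑ j, l.mean j

/-- The total adjustment term `φ`. -/
def Model.adj (M : Model K X Θ) (A : X → Matrix (Fin r) (Fin (K + 1)) ℝ) (β : Θ)
    (γ : FirstStep K X Θ) (l : Nuisance K r X) (z : Obs K X) : Fin r → ℝ :=
  M.adjCcp β γ l z + ∑ j, M.adjCont A β γ j z + M.adjRenew β γ l z

/-- The adjusted moment functions `ψ = m + φ`. -/
def Model.adjustedMoment (M : Model K X Θ) (A : X → Matrix (Fin r) (Fin (K + 1)) ℝ) (β : Θ)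
    (γ : FirstStep K X Θ) (l : Nuisance K r X) (z : Obs K X) : Fin r → ℝ :=
  M.moment A β γ z + M.adj A β γ l z

/-! ### Paths of distributions, influence adjustments, local robustness -/

/-- The contaminated law `F_τ = (1 - τ) F + τ G`, for `0 ≤ τ ≤ 1`. -/
def mix {Z : Type*} [MeasurableSpace Z] (F G : Measure Z) (τ : ℝ) : Measure Z :=
  (1 - τ).toNNReal • F + τ.toNNReal • G

instance {Z : Type*} [MeasurableSpace Z] (F G : Measure Z) [IsFiniteMeasure F]
    [IsFiniteMeasure G] (τ : ℝ) : IsFiniteMeasure (mix F G τ) := by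
  unfold mix; infer_instance

/-- The directions `G`: laws with a bounded density with respect to `F`. -/
def BoundedDirection {Z : Type*} [MeasurableSpace Z] (F G : Measure Z) : Prop :=
  ∃ C : ℝ≥0, G ≤ C • F

/-- Every expectation that enters `γ(F)` and `λ(F)` exists. -/
structure Model.FirstStepsExist (M : Model K X Θ) (A : X → Matrix (Fin r) (Fin (K + 1)) ℝ)
    (β : Θ) (F : Measure (Obs K X)) [IsFiniteMeasure F] : Prop where
  prob_pos : ∀ j, 0 < F.real {z | z.1 = j}
  integrable_next : Integrable (M.nextTerm β (M.firstStep F).ccp) F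
  integrable_weight : ∀ j, Integrable (M.weight A β (M.firstStep F) j) F
  integrable_deriv : ∀ j,
    Integrable (fun z => M.instDeriv A j z.2.1 (M.vTilde β (M.firstStep F) z.2.1)) F

/-- `φ` is the influence adjustment of `F ↦ E[m(z, β, sub γ(F))]` at `F₀`: it has mean zero, and
the derivative from the right along `F_τ` is the mean of `φ` under `G`, for every direction `G`.
The map `sub` selects the components of `γ` that vary with `F`. -/
def Model.IsAdjustment (M : Model K X Θ) (A : X → Matrix (Fin r) (Fin (K + 1)) ℝ) (β : Θ)
    (F₀ : Measure (Obs K X)) [IsFiniteMeasure F₀]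
    (sub : FirstStep K X Θ → FirstStep K X Θ) (φ : Obs K X → Fin r → ℝ) : Prop :=
  Integrable φ F₀ ∧ ∫ z, φ z ∂F₀ = 0 ∧
  ∀ (G : Measure (Obs K X)) [IsProbabilityMeasure G], BoundedDirection F₀ G →
    Integrable φ G ∧
    (∀ᶠ τ in 𝓝[≥] (0 : ℝ), Integrable (M.moment A β (sub (M.firstStep (mix F₀ G τ)))) F₀) ∧
    HasDerivWithinAt (fun τ => ∫ z, M.moment A β (sub (M.firstStep (mix F₀ G τ))) z ∂F₀)
      (∫ z, φ z ∂G) (Set.Ici 0) 0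

/-- Local robustness of `ψ` at `(β, F₀)`: the moment condition holds, and the derivative from the
right at `τ = 0` of `E[ψ(z, β, γ(F_τ), λ(F_τ))]` exists and vanishes for every direction `G`. -/
def Model.IsLocallyRobust (M : Model K X Θ) (A : X → Matrix (Fin r) (Fin (K + 1)) ℝ) (β : Θ)
    (F₀ : Measure (Obs K X)) [IsFiniteMeasure F₀]
    (ψ : FirstStep K X Θ → Nuisance K r X → Obs K X → Fin r → ℝ) : Prop :=
  Integrable (ψ (M.firstStep F₀) (M.nuisance A β F₀)) F₀ ∧
  ∫ z, ψ (M.firstStep F₀) (M.nuisance A β F₀) z ∂F₀ = 0 ∧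
  ∀ (G : Measure (Obs K X)) [IsProbabilityMeasure G], BoundedDirection F₀ G →
    (∀ᶠ τ in 𝓝[≥] (0 : ℝ), M.FirstStepsExist A β (mix F₀ G τ) ∧
      Integrable (ψ (M.firstStep (mix F₀ G τ)) (M.nuisance A β (mix F₀ G τ))) F₀) ∧
    HasDerivWithinAt
      (fun τ => ∫ z, ψ (M.firstStep (mix F₀ G τ)) (M.nuisance A β (mix F₀ G τ)) z ∂F₀)
      0 (Set.Ici 0) 0

/-! ### Regularity -/

/-- Smoothness of `P` and `H`, existence of moments, and local domination near the true values;
`μ` is the law of the state. -/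
structure Model.Regular (M : Model K X Θ) (A : X → Matrix (Fin r) (Fin (K + 1)) ℝ) (β : Θ)
    (v : X → ℝ) (μ : Measure X) : Prop where
  /-- choice probabilities are continuously differentiable in the value differences -/
  smooth_prob : ContDiff ℝ 1 (choiceProb M.errorLaw)
  /-- `H` is continuously differentiable on the open simplex -/
  smooth_surplus : ContDiffOn ℝ 1 (surplusRed M.errorLaw)
    {q : Fin K → ℝ | (∀ j, 0 < q j) ∧ ∑ j, q j < 1}
  measurable_inst : ∀ i k, Measurable fun x => A x i k
  integrable_inst : ∀ i k, Integrable (fun x => A x i k) μ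
  integrable_value : Integrable v μ
  /-- the mean absolute deviation of next period's value, given state and choice, is bounded -/
  deviation : ∃ C : ℝ, ∀ᵐ x ∂μ, ∀ j,
    ∫ x', |v x' - ∫ x'', v x'' ∂(M.trans j x)| ∂(M.trans j x) ≤ C
  /-- relative changes of the choice probabilities, near the truth, have a bounded first-order
  effect on `H` -/
  dominated_surplus : ∃ η C : ℝ, 0 < η ∧ η < 1 ∧ ∀ᵐ x ∂μ, ∀ q d : Fin (K + 1) → ℝ,
    ∑ j, q j = 1 → (∀ j, |q j - M.trueProb β v x j| ≤ η * M.trueProb β v x j) →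
    ∑ j, d j = 0 → (∀ j, |d j| ≤ M.trueProb β v x j) →
    |surplusDeriv M.errorLaw q d| ≤ C
  /-- `A P_{ṽj} / P_j` has an integrable envelope near the true value differences -/
  dominated_deriv : ∃ η : ℝ, 0 < η ∧ ∃ b : X → ℝ, Integrable b μ ∧ ∀ᵐ x ∂μ,
    ∀ w : Fin K → ℝ, (∀ k, |w k - M.valueDiff β v x k| ≤ η) →
    ∀ j i, |M.instDeriv A j x w i| ≤ b x * choiceProb M.errorLaw w j.succ

end Dynamic

end DDC

end

/-! Let `g` be the bounded density of `G`. Then `F_τ` has density `1 + τ (g - 1)` with respect to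
`F₀`, which stays in `[1/2, 1 + C]` for `0 ≤ τ ≤ 1/2`. Everything under `F_τ` can therefore be
written as an explicit integral under `F₀`.

At the truth the model inverts. The Bellman equation gives `H(p₀(x)) = v(x) - v₀(x)`, where `v₀` is
the value of the renewal choice (`surplus_trueProb`). By the renewal property `u₀ + H(p₀)` is `v`
minus a constant (`pathNext_zero`). The constant cancels in the difference of the two continuation
terms, so `ṽ` at `γ(F₀)` is the true value difference (`vTilde_pathFirst_zero`), and `E[m] = 0`
because `E[y | x] = p₀(x)`.

Along `F_τ` the first steps equal, up to null sets, ratios of integrals over the transition kernels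
(`firstStep_ccp_ae`, `firstStep_cont_ae`, `firstStep_renew_eq`). Switches `σ` multiply `τ`
separately in each component, so that the full derivative and the derivatives in single components
are one computation. The regularity conditions make all these paths Lipschitz at `τ = 0` uniformly
in the state. Differentiation under the integral then gives the derivative of `E[m]`, and it is
linear in `σ` (`hasDerivWithinAt_moment`, `integral_valueDir`).

The adjustment terms need no derivatives of the nuisance functions. Each `φ_j`, evaluated at
`γ(F_τ)` and `λ(F_τ)`, has mean zero under `F_τ` itself: it is a residual times a function of the
conditioning variable. So `0 = ∫ φ_τ dF₀ + τ ∫ (g - 1) φ_τ dF₀`, and mere convergence of the last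
integral shows that the derivative of `∫ φ_τ dF₀` at zero is `-∫ φ₀ dG`
(`IsNeutral.hasDerivWithinAt`). A direct computation identifies `∫ φ₀ dG` with the derivative of
`E[m]` for the same component, which is the influence property. Adding the two derivatives gives
local robustness.

The delicate term is `φ₁`. Choice probabilities act on `m` through `H(γ₁(w))` at the next state, so
the derivative of `E[m]` has the form `∫ D(w) T(z) dF₀`, with `D` the derivative of `H(γ₁)` and `T`
a weight. Conditioning on `w` replaces `T` by `λ(w)`. Since `x` and `w` have the same law, `D λ` may
be evaluated at `x`, where it is the mean under `G` of a score for the choice times `λ(x)`. The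
functions `λ` under `F_τ` are never shown to converge pointwise; it is enough that their integrals
against bounded convergent functions do (`tendsto_integral_reverseMean`). -/

set_option linter.unusedSectionVars false

namespace DDC

/-! ### Choice probabilities: positivity, summation to one, injectivity. -/

section Static

variable {K : ℕ}

@[simp] lemma fullValue_zero (v : Fin K → ℝ) : fullValue v 0 = 0 := rfl

@[simp] lemma fullValue_succ (v : Fin K → ℝ) (j : Fin K) : fullValue v j.succ = v j := rfl

/-- The disturbances for which alternative `j` is a best choice at values `f`. -/
def bestSet (f : Fin (K + 1) → ℝ) (j : Fin (K + 1)) : Set (Fin (K + 1) → ℝ) :=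
  {e | ∀ k, f k + e k ≤ f j + e j}

lemma measurableSet_bestSet (f : Fin (K + 1) → ℝ) (j : Fin (K + 1)) :
    MeasurableSet (bestSet f j) := by
  have : bestSet f j = ⋂ k, {e : Fin (K + 1) → ℝ | f k + e k ≤ f j + e j} := by
    ext e; simp [bestSet]
  rw [this]
  exact MeasurableSet.iInter fun k => measurableSet_le (by fun_prop) (by fun_prop)

/-- The strict version of the best set is open, which is what full support can act on. -/
lemma subset_bestSet (f : Fin (K + 1) → ℝ) (j : Fin (K + 1)) :
    (⋂ k : {k // k ≠ j}, {e : Fin (K + 1) → ℝ | f k + e k < f j + e j}) ⊆ bestSet f j := by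
  intro e he k
  by_cases hk : k = j
  · rw [hk]
  · exact (mem_iInter.1 he ⟨k, hk⟩).le

lemma choiceProb_eq (Q : Measure (Fin (K + 1) → ℝ)) (v : Fin K → ℝ) (j : Fin (K + 1)) :
    choiceProb Q v j = Q.real (bestSet (fullValue v) j) := rfl

lemma iUnion_bestSet (f : Fin (K + 1) → ℝ) : ⋃ j, bestSet f j = univ := by
  refine eq_univ_of_forall fun e => ?_
  obtain ⟨j, -, hj⟩ := Finset.exists_max_image Finset.univ (fun k => f k + e k)
    Finset.univ_nonempty
  exact mem_iUnion.2 ⟨j, fun k => hj k (Finset.mem_univ k)⟩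

variable (Q : Measure (Fin (K + 1) → ℝ)) [IsProbabilityMeasure Q]

/-- The set where `j` is strictly best is open and nonempty, hence charged by a law of full support.
-/
lemma choiceProb_pos [Q.IsOpenPosMeasure] (v : Fin K → ℝ) (j : Fin (K + 1)) :
    0 < choiceProb Q v j := by
  rw [choiceProb_eq]
  set f := fullValue v
  have hopen : IsOpen (⋂ k : {k // k ≠ j}, {e : Fin (K + 1) → ℝ | f k + e k < f j + e j}) :=
    isOpen_iInter_of_finite fun k => isOpen_lt (by fun_prop) (by fun_prop)
  have hne : (⋂ k : {k // k ≠ j}, {e : Fin (K + 1) → ℝ | f k + e k < f j + e j}).Nonempty := by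
    -- These disturbances cancel all values and then put `j` ahead by one.
    refine ⟨fun k => -f k + (Pi.single j 1 : Fin (K + 1) → ℝ) k, mem_iInter.2 fun k => ?_⟩
    simp [k.2]
  have h := hopen.measure_pos Q hne
  refine ENNReal.toReal_pos (h.trans_le (measure_mono (subset_bestSet f j))).ne'
    (measure_ne_top _ _)

/-- The best sets cover the space and overlap only in ties, so without ties they are an almost
everywhere partition. -/
lemma sum_choiceProb_of_no_ties (v : Fin K → ℝ)
    (h : ∀ j k, j ≠ k → Q {e | fullValue v j + e j = fullValue v k + e k} = 0) :
    ∑ j, choiceProb Q v j = 1 := by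
  have hd : Pairwise (Function.onFun (AEDisjoint Q) (bestSet (fullValue v))) := by
    intro j k hjk
    refine measure_mono_null (fun e he => ?_) (h j k hjk)
    exact le_antisymm (he.2 j) (he.1 k)
  have hu := measure_iUnion₀ hd fun j => (measurableSet_bestSet (fullValue v) j).nullMeasurableSet
  rw [iUnion_bestSet, measure_univ, tsum_fintype] at hu
  have := congrArg ENNReal.toReal hu
  rw [ENNReal.toReal_sum fun _ _ => measure_ne_top _ _, ENNReal.toReal_one] at this
  exact this.symm

/-- With continuous choice probabilities ties have probability zero. -/
lemma sum_choiceProb (hc : Continuous (choiceProb Q)) (v : Fin K → ℝ) :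
    ∑ j, choiceProb Q v j = 1 := by
  -- Alternative `j` is raised by `s * j`: distinct alternatives move at distinct speeds, and
  -- alternative `0` keeps its normalization.
  let path : ℝ → Fin K → ℝ := fun s k => v k + s * ((k : ℕ) + 1 : ℝ)
  have hfull : ∀ s (j : Fin (K + 1)), fullValue (path s) j = fullValue v j + s * ((j : ℕ) : ℝ) := by
    intro s j
    refine Fin.cases ?_ (fun k => ?_) j
    · simp
    · simp [path]
  -- For `j ≠ k` a tie at `s` means that a function of `e` not involving `s` takes the value `s`,
  -- and only countably many level sets have positive mass. For `j = k` the division by zero gives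
  -- the constant `0`, which adds only `s = 0`. The identity thus holds on a dense set of `s`, and
  -- continuity carries it to `s = 0`.
  let bad : Fin (K + 1) → Fin (K + 1) → Set ℝ := fun j k =>
    {s | 0 < Q {e | (fullValue v j + e j - (fullValue v k + e k)) / (((k : ℕ) : ℝ) - (j : ℕ)) = s}}
  have hcount : (⋃ j, ⋃ k, bad j k).Countable :=
    countable_iUnion fun j => countable_iUnion fun k =>
      Measure.countable_meas_level_set_pos (μ := Q) (by fun_prop)
  have hdense := hcount.dense_compl ℝ
  have hcont : Continuous fun s => ∑ j, choiceProb Q (path s) j := by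
    have hp : Continuous path := by fun_prop
    exact continuous_finsetSum _ fun j _ => (continuous_apply j).comp (hc.comp hp)
  have key := Continuous.ext_on hdense hcont continuous_const (fun s hs => by
    refine sum_choiceProb_of_no_ties Q (path s) fun j k hjk => ?_
    have hs' : ¬ 0 < Q {e | (fullValue v j + e j - (fullValue v k + e k)) /
        (((k : ℕ) : ℝ) - (j : ℕ)) = s} := fun h0 => hs (mem_iUnion₂.2 ⟨j, k, h0⟩)
    have h0 := le_antisymm (not_lt.1 hs') bot_le
    refine measure_mono_null (fun e he => ?_) h0
    have hne : ((k : ℕ) : ℝ) - (j : ℕ) ≠ 0 := by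
      rw [sub_ne_zero]
      exact fun h => hjk (Fin.ext (by exact_mod_cast h.symm))
    simp only [hfull, mem_ofPred_eq] at he ⊢
    rw [div_eq_iff hne]
    linarith)
  have := congrFun key 0
  simpa [path] using this

/-- If `v - v'` is maximal at `j` (among all alternatives) and not constant, then `j` is chosen
more often under `v`. -/
lemma choiceProb_lt [Q.IsOpenPosMeasure] {v v' : Fin K → ℝ} {j k₀ : Fin (K + 1)}
    (hmax : ∀ k, fullValue v k - fullValue v' k ≤ fullValue v j - fullValue v' j)
    (hlt : fullValue v k₀ - fullValue v' k₀ < fullValue v j - fullValue v' j) :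
    choiceProb Q v' j < choiceProb Q v j := by
  rw [choiceProb_eq, choiceProb_eq]
  set f := fullValue v
  set f' := fullValue v'
  have hsub : bestSet f' j ⊆ bestSet f j := fun e he k => by
    have := he k; have := hmax k; linarith
  have hk₀ : k₀ ≠ j := fun h => by rw [h] at hlt; exact lt_irrefl _ hlt
  have hopen : IsOpen ((⋂ k : {k // k ≠ j}, {e : Fin (K + 1) → ℝ | f k + e k < f j + e j}) ∩
      {e | f' j + e j < f' k₀ + e k₀}) :=
    (isOpen_iInter_of_finite fun k => isOpen_lt (by fun_prop) (by fun_prop)).inter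
      (isOpen_lt (by fun_prop) (by fun_prop))
  have hne : ((⋂ k : {k // k ≠ j}, {e : Fin (K + 1) → ℝ | f k + e k < f j + e j}) ∩
      {e | f' j + e j < f' k₀ + e k₀}).Nonempty := by
    -- The disturbance of `k₀` is the midpoint between the threshold above which `k₀` beats `j` at
    -- `f'` and the larger threshold below which `j` beats `k₀` at `f`. All other alternatives are
    -- put one below `j` at `f`.
    refine ⟨fun k => if k = j then 0 else if k = k₀ then
      ((f' j - f' k₀) + (f j - f k₀)) / 2 else f j - f k - 1, mem_iInter.2 fun k => ?_, ?_⟩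
    · obtain ⟨k, hk⟩ := k
      by_cases hkk : k = k₀
      · subst hkk; simp [hk]; linarith
      · simp [hk, hkk]; linarith
    · simp [hk₀]; linarith
  have hpos := hopen.measure_pos Q hne
  have hdisj : Disjoint (bestSet f' j) ((⋂ k : {k // k ≠ j},
      {e : Fin (K + 1) → ℝ | f k + e k < f j + e j}) ∩ {e | f' j + e j < f' k₀ + e k₀}) := by
    rw [Set.disjoint_left]
    intro e he he'
    exact absurd he'.2 (not_lt.2 (he k₀))
  have hle := measureReal_mono (μ := Q) (union_subset hsub
    ((inter_subset_left (t := {e | f' j + e j < f' k₀ + e k₀})).trans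
      (subset_bestSet f j))) (measure_ne_top Q (bestSet f j))
  rw [measureReal_union hdisj hopen.measurableSet] at hle
  have : 0 < Q.real ((⋂ k : {k // k ≠ j}, {e : Fin (K + 1) → ℝ | f k + e k < f j + e j}) ∩
      {e | f' j + e j < f' k₀ + e k₀}) := ENNReal.toReal_pos hpos.ne' (measure_ne_top _ _)
  linarith

/-- Look at the alternative where `v - v'` is largest. If the difference is not constant, that
alternative is chosen strictly more often under `v`. If it is constant, the normalization of
alternative `0` makes it zero. -/
lemma choiceProb_injective [Q.IsOpenPosMeasure] : Function.Injective (choiceProb Q) := by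
  intro v v' h
  by_contra hne
  obtain ⟨j, -, hj⟩ := Finset.exists_max_image Finset.univ
    (fun k => fullValue v k - fullValue v' k) Finset.univ_nonempty
  obtain ⟨i, hi⟩ := Function.ne_iff.1 hne
  by_cases hD : ∃ k₀, fullValue v k₀ - fullValue v' k₀ < fullValue v j - fullValue v' j
  · obtain ⟨k₀, hk₀⟩ := hD
    exact (choiceProb_lt Q (fun k => hj k (Finset.mem_univ k)) hk₀).ne (congrFun h j).symm
  · push Not at hD
    have h0 := hD 0
    have h1 := hj 0 (Finset.mem_univ 0)
    have h2 := hD i.succ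
    have h3 := hj i.succ (Finset.mem_univ _)
    simp only [fullValue_zero, fullValue_succ] at h0 h1 h2 h3
    exact hi (by linarith)

/-- By injectivity `invFun` really inverts `choiceProb` on its range, so no default value of
`invFun` enters `H` there. -/
lemma surplus_choiceProb [Q.IsOpenPosMeasure] (v : Fin K → ℝ) :
    surplus Q (choiceProb Q v) = ∫ e, (⨆ j, (fullValue v j + e j)) ∂Q := by
  unfold surplus invChoiceProb
  rw [Function.leftInverse_invFun (choiceProb_injective Q) v]

lemma integrable_iSup (hQ : ∀ j, Integrable (fun e : Fin (K + 1) → ℝ => e j) Q)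
    (f : Fin (K + 1) → ℝ) : Integrable (fun e => ⨆ j, (f j + e j)) Q := by
  have hm : Measurable fun e : Fin (K + 1) → ℝ => ⨆ j, (f j + e j) :=
    Measurable.iSup fun j => by fun_prop
  refine Integrable.mono' (g := fun e => ∑ j, (|f j| + |e j|))
    (integrable_finsetSum _ fun j _ => (integrable_const _).add (hQ j).abs)
    hm.aestronglyMeasurable (ae_of_all _ fun e => ?_)
  have hbd : ∀ j, |f j + e j| ≤ ∑ j, (|f j| + |e j|) := fun j =>
    (abs_add_le _ _).trans (Finset.single_le_sum (f := fun j => |f j| + |e j|)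
      (fun i _ => by positivity) (Finset.mem_univ j))
  rw [Real.norm_eq_abs, abs_le]
  constructor
  · exact ((abs_le.1 (hbd 0)).1).trans (le_ciSup (f := fun j => f j + e j)
      (finite_range _).bddAbove 0)
  · exact ciSup_le fun j => (abs_le.1 (hbd j)).2

lemma integral_iSup_sub (hQ : ∀ j, Integrable (fun e : Fin (K + 1) → ℝ => e j) Q)
    (f : Fin (K + 1) → ℝ) (c : ℝ) :
    ∫ e, (⨆ j, (f j - c + e j)) ∂Q = ∫ e, (⨆ j, (f j + e j)) ∂Q - c := by
  have : ∀ e : Fin (K + 1) → ℝ, (⨆ j, (f j - c + e j)) = (⨆ j, (f j + e j)) - c := by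
    intro e
    rw [sub_eq_add_neg, ciSup_add (finite_range _).bddAbove]
    congr 1; ext j; ring
  simp_rw [this]
  rw [integral_sub (integrable_iSup Q hQ f) (integrable_const _)]
  simp

end Static

/-! ### The Bellman equation expressed through choice probabilities. -/

section Truth

variable {K : ℕ} {X Θ : Type*} [MeasurableSpace X] (M : Model K X Θ)

instance : IsProbabilityMeasure M.errorLaw := M.isProbabilityMeasure_errorLaw
instance : M.errorLaw.IsOpenPosMeasure := M.fullSupport_errorLaw
instance (j : Fin (K + 1)) : IsMarkovKernel (M.trans j) := M.isMarkovKernel_trans j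

variable {M}

lemma fullValue_valueDiff (β : Θ) (v : X → ℝ) (x : X) (j : Fin (K + 1)) :
    fullValue (M.valueDiff β v x) j = M.condValue β v j x - M.condValue β v 0 x := by
  refine Fin.cases ?_ (fun k => ?_) j
  · simp
  · simp [Model.valueDiff]

lemma bestSet_valueDiff (β : Θ) (v : X → ℝ) (x : X) (j : Fin (K + 1)) :
    bestSet (fullValue (M.valueDiff β v x)) j = bestSet (fun k => M.condValue β v k x) j := by
  ext e
  simp only [bestSet, mem_ofPred_eq, fullValue_valueDiff]
  refine forall_congr' fun k => ⟨fun h => by linarith, fun h => by linarith⟩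

/-- Normalizing by the value of alternative `0` lowers every value, hence the expected maximum, by
the same amount; the unnormalized expected maximum is `v x` by the Bellman equation. -/
lemma Model.IsValueFunction.surplus_trueProb {β : Θ} {v : X → ℝ} (hv : M.IsValueFunction β v)
    (x : X) : surplus M.errorLaw (M.trueProb β v x) = v x - M.condValue β v 0 x := by
  unfold Model.trueProb
  rw [surplus_choiceProb]
  simp_rw [fullValue_valueDiff]
  rw [integral_iSup_sub _ M.integrable_errorLaw, ← hv.bellman x]

lemma Model.IsValueFunction.measurable_condValue {β : Θ} {v : X → ℝ}
    (hv : M.IsValueFunction β v) (j : Fin (K + 1)) : Measurable (M.condValue β v j) := by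
  unfold Model.condValue
  have : Measurable fun x => ∫ x', v x' ∂(M.trans j x) :=
    (hv.measurable.stronglyMeasurable.integral_kernel (κ := M.trans j)).measurable
  exact (M.measurable_u j β).add (this.const_mul _)

lemma Model.IsValueFunction.measurable_valueDiff {β : Θ} {v : X → ℝ}
    (hv : M.IsValueFunction β v) : Measurable (M.valueDiff β v) :=
  measurable_pi_lambda _ fun j => (hv.measurable_condValue j.succ).sub (hv.measurable_condValue 0)

end Truth

end DDC

namespace DDC

/-! ### The law of an observation as a mixture over choices. -/

section JointLaw

variable {K : ℕ} {X : Type*} [MeasurableSpace X]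

/-- The law of `(y, x, w)` when `x` has law `μ`, `y` is chosen with probabilities `p x`, and `w` is
drawn from `Q y x`. -/
noncomputable def jointLaw (μ : Measure X) (p : X → Fin (K + 1) → ℝ)
    (Q : Fin (K + 1) → Kernel X X) : Measure (Obs K X) :=
  ∑ j, ((μ.withDensity fun x => ((p x j).toNNReal : ℝ≥0∞)) ⊗ₘ Q j).map fun a => (j, a.1, a.2)

/-- `F₀` is the law of `(y, x, w)` built from positive choice probabilities `p` and transitions
`Q`, and `μ` is the law of both the state and the next state. -/
structure StationaryLaw (μ : Measure X) (p : X → Fin (K + 1) → ℝ)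
    (Q : Fin (K + 1) → Kernel X X) (F₀ : Measure (Obs K X)) : Prop where
  measurable_p : ∀ j, Measurable fun x => p x j
  pos : ∀ x j, 0 < p x j
  sum_one : ∀ x, ∑ j, p x j = 1
  law : F₀ = jointLaw μ p Q
  map_state : F₀.map (fun z => z.2.1) = μ
  map_next : F₀.map (fun z => z.2.2) = μ

lemma measurable_tag (j : Fin (K + 1)) : Measurable fun a : X × X => ((j, a.1, a.2) : Obs K X) := by
  fun_prop

lemma sum_measure_inter_choice (F : Measure (Obs K X)) (N : Set (Obs K X)) :
    F N = ∑ j, F (N ∩ {z | z.1 = j}) := by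
  have h := sum_measure_preimage_singleton (μ := F.restrict N) (Finset.univ : Finset (Fin (K + 1)))
    (f := fun z : Obs K X => z.1) (fun j _ => measurable_fst (measurableSet_singleton j))
  simp only [Finset.coe_univ, preimage_univ, Measure.restrict_apply_univ] at h
  rw [← h]
  refine Finset.sum_congr rfl fun j _ => ?_
  rw [Measure.restrict_apply (measurable_fst (measurableSet_singleton j)), inter_comm]
  rfl

/-- After splitting by the finitely many choices, each piece is a finite measure on `X × X`,
determined by its values on rectangles. -/
lemma eq_jointLaw {μ : Measure X} [IsFiniteMeasure μ] {p : X → Fin (K + 1) → ℝ}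
    {Q : Fin (K + 1) → Kernel X X} [∀ j, IsMarkovKernel (Q j)] {F : Measure (Obs K X)}
    [IsFiniteMeasure F]
    (h : ∀ j {B D : Set X}, MeasurableSet B → MeasurableSet D →
      F {z | z.1 = j ∧ z.2.1 ∈ B ∧ z.2.2 ∈ D} =
        ∫⁻ x in B, Q j x D ∂(μ.withDensity fun x => ((p x j).toNNReal : ℝ≥0∞))) :
    F = jointLaw μ p Q := by
  have key : ∀ j, (F.restrict {z | z.1 = j}).map (fun z => z.2) =
      (μ.withDensity fun x => ((p x j).toNNReal : ℝ≥0∞)) ⊗ₘ Q j := by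
    intro j
    refine Measure.ext_prod fun {B D} hB hD => ?_
    rw [Measure.map_apply (by fun_prop) (hB.prod hD),
      Measure.restrict_apply (measurable_snd (hB.prod hD)), Measure.compProd_apply_prod hB hD,
      ← h j hB hD]
    congr 1
    ext z
    simp [and_comm]
  ext N hN
  rw [sum_measure_inter_choice F N, jointLaw, Measure.finsetSum_apply]
  refine Finset.sum_congr rfl fun j _ => ?_
  rw [Measure.map_apply (measurable_tag j) hN, ← key j,
    Measure.map_apply (by fun_prop) (measurable_tag j hN),
    Measure.restrict_apply (measurable_snd (measurable_tag j hN))]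
  congr 1
  ext ⟨k, x, w⟩
  simp only [mem_inter_iff, mem_preimage, mem_ofPred_eq]
  constructor
  · rintro ⟨h1, rfl⟩; exact ⟨h1, rfl⟩
  · rintro ⟨h1, rfl⟩; exact ⟨h1, rfl⟩

/-- These events belong to the conditioning information in the Markov property, so the conditional
expectation may be integrated over them. -/
lemma measurableSet_history {Ω : Type*} (x : ℕ → Ω → X) (y : ℕ → Ω → Fin (K + 1)) (t : ℕ)
    (j : Fin (K + 1)) {B : Set X} (hB : MeasurableSet B) :
    MeasurableSet[⨆ s ∈ Set.Iic t, (MeasurableSpace.comap (x s) inferInstance ⊔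
      MeasurableSpace.comap (y s) inferInstance)] ({ω | y t ω = j} ∩ x t ⁻¹' B) := by
  have hge : MeasurableSpace.comap (x t) inferInstance ⊔
      MeasurableSpace.comap (y t) inferInstance ≤
      ⨆ s ∈ Set.Iic t, (MeasurableSpace.comap (x s) inferInstance ⊔
      MeasurableSpace.comap (y s) inferInstance : MeasurableSpace Ω) :=
    le_iSup₂_of_le (f := fun s (_ : s ∈ Set.Iic t) => (MeasurableSpace.comap (x s) inferInstance ⊔
      MeasurableSpace.comap (y s) inferInstance : MeasurableSpace Ω)) t (Set.mem_Iic.2 le_rfl) le_rfl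
  refine MeasurableSet.inter ?_ ?_
  · exact hge _ ((le_sup_right : MeasurableSpace.comap (y t) inferInstance ≤ _) _
        ⟨{j}, measurableSet_singleton j, rfl⟩)
  · exact hge _ ((le_sup_left : MeasurableSpace.comap (x t) inferInstance ≤ _) _ ⟨B, hB, rfl⟩)

end JointLaw

/-! ### From the behavioural model to the law of an observation. -/

section Generates

variable {K : ℕ} {X Θ Ω : Type*} [MeasurableSpace X] [MeasurableSpace Ω]
  {M : Model K X Θ} {β : Θ} {v : X → ℝ} {Pr : Measure Ω} [IsProbabilityMeasure Pr]
  {x : ℕ → Ω → X} {ε : ℕ → Ω → Fin (K + 1) → ℝ} {y : ℕ → Ω → Fin (K + 1)}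

lemma measurable_trueProb (hv : M.IsValueFunction β v)
    (hc : Continuous (choiceProb M.errorLaw)) (j : Fin (K + 1)) :
    Measurable fun a => M.trueProb β v a j :=
  (measurable_pi_apply j).comp (hc.measurable.comp hv.measurable_valueDiff)

/-- Optimality puts the disturbance in the best set of the chosen alternative, and independence from
the state turns the probability of that event into an integral. Only an inequality is immediate,
since a tie allows several best choices. -/
lemma Model.Generates.measure_choice_le (hgen : M.Generates β v Pr x ε y)
    (hv : M.IsValueFunction β v) (t : ℕ) (j : Fin (K + 1)) {B : Set X} (hB : MeasurableSet B) :
    Pr {ω | y t ω = j ∧ x t ω ∈ B} ≤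
      ∫⁻ a in B, ((M.trueProb β v a j).toNNReal : ℝ≥0∞) ∂(Pr.map (x t)) := by
  have hx := hgen.measurable_state t
  have hε := hgen.measurable_error t
  have hprob : IsProbabilityMeasure (Pr.map (x t)) := Measure.isProbabilityMeasure_map hx.aemeasurable
  let S : Set (X × (Fin (K + 1) → ℝ)) :=
    ⋂ k, {a | M.condValue β v k a.1 + a.2 k ≤ M.condValue β v j a.1 + a.2 j}
  have hS : MeasurableSet S := MeasurableSet.iInter fun k => measurableSet_le
    (((hv.measurable_condValue k).comp measurable_fst).add
      ((measurable_pi_apply k).comp measurable_snd))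
    (((hv.measurable_condValue j).comp measurable_fst).add
      ((measurable_pi_apply j).comp measurable_snd))
  have hB' : MeasurableSet ((Prod.fst : X × (Fin (K + 1) → ℝ) → X) ⁻¹' B) := measurable_fst hB
  calc Pr {ω | y t ω = j ∧ x t ω ∈ B}
      ≤ Pr ((fun ω => (x t ω, ε t ω)) ⁻¹' (Prod.fst ⁻¹' B ∩ S)) := by
        refine measure_mono_ae ?_
        filter_upwards [hgen.optimal t] with ω hω h
        obtain ⟨h1, h2⟩ := h
        refine ⟨h2, mem_iInter.2 fun k => ?_⟩
        have := hω k
        rw [h1] at this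
        exact this
    _ = ((Pr.map (x t)).prod M.errorLaw) (Prod.fst ⁻¹' B ∩ S) := by
        rw [← Measure.map_apply (hx.prodMk hε) (hB'.inter hS), ← hgen.error_law t,
          ← (indepFun_iff_map_prod_eq_prod_map_map hx.aemeasurable hε.aemeasurable).1
            (hgen.error_indep_state t).symm]
    _ = ∫⁻ a in B, ((M.trueProb β v a j).toNNReal : ℝ≥0∞) ∂(Pr.map (x t)) := by
        rw [Measure.prod_apply (hB'.inter hS), ← lintegral_indicator hB]
        refine lintegral_congr fun a => ?_
        by_cases ha : a ∈ B
        · rw [indicator_of_mem ha]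
          have : Prod.mk a ⁻¹' (Prod.fst ⁻¹' B ∩ S) =
              bestSet (fullValue (M.valueDiff β v a)) j := by
            rw [bestSet_valueDiff]
            ext e
            simp [S, ha, bestSet]
          rw [this, Model.trueProb, choiceProb_eq, ← ENNReal.ofReal.eq_1, ofReal_measureReal]
        · rw [indicator_of_notMem ha]
          have : Prod.mk a ⁻¹' (Prod.fst ⁻¹' B ∩ S) = ∅ := by
            ext e; simp [ha]
          rw [this, measure_empty]

/-- Both sides of the inequality of `measure_choice_le` sum over `j` to the probability of `x t ∈
B`, so there is equality for every `j`. -/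
lemma Model.Generates.measure_choice (hgen : M.Generates β v Pr x ε y)
    (hv : M.IsValueFunction β v) (hc : Continuous (choiceProb M.errorLaw))
    (t : ℕ) (j : Fin (K + 1)) {B : Set X} (hB : MeasurableSet B) :
    Pr {ω | y t ω = j ∧ x t ω ∈ B} =
      ∫⁻ a in B, ((M.trueProb β v a j).toNNReal : ℝ≥0∞) ∂(Pr.map (x t)) := by
  have hx := hgen.measurable_state t
  have hprob : IsProbabilityMeasure (Pr.map (x t)) := Measure.isProbabilityMeasure_map hx.aemeasurable
  have hle := fun j => hgen.measure_choice_le hv t j hB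
  have hsum1 : ∑ j, Pr {ω | y t ω = j ∧ x t ω ∈ B} = Pr (x t ⁻¹' B) := by
    have h := sum_measure_preimage_singleton (μ := Pr.restrict (x t ⁻¹' B))
      (Finset.univ : Finset (Fin (K + 1)))
      (f := y t) (fun j _ => hgen.measurable_choice t (measurableSet_singleton j))
    simp only [Finset.coe_univ, preimage_univ, Measure.restrict_apply_univ] at h
    rw [← h]
    refine Finset.sum_congr rfl fun j _ => ?_
    rw [Measure.restrict_apply (hgen.measurable_choice t (measurableSet_singleton j))]
    rfl
  have hsum2 : ∑ j, ∫⁻ a in B, ((M.trueProb β v a j).toNNReal : ℝ≥0∞) ∂(Pr.map (x t)) =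
      Pr (x t ⁻¹' B) := by
    rw [← lintegral_finsetSum _ fun j _ => ((measurable_trueProb hv hc j).real_toNNReal).coe_nnreal_ennreal]
    have : ∀ a, ∑ j, ((M.trueProb β v a j).toNNReal : ℝ≥0∞) = 1 := by
      intro a
      have h := sum_choiceProb M.errorLaw hc (M.valueDiff β v a)
      have h' : ∑ j, (M.trueProb β v a j).toNNReal = 1 := by
        unfold Model.trueProb
        rw [← Real.toNNReal_sum_of_nonneg fun j _ =>
          (choiceProb_pos M.errorLaw (M.valueDiff β v a) j).le]
        rw [h, Real.toNNReal_one]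
      exact_mod_cast congrArg (fun r : ℝ≥0 => (r : ℝ≥0∞)) h'
    simp_rw [this]
    rw [setLIntegral_one, Measure.map_apply hx hB]
  -- Strictness for one `j` would make the totals differ; the remaining summands are finite and can
  -- be cancelled.
  by_contra hne
  have hlt := lt_of_le_of_ne (hle j) hne
  have : ∑ j, Pr {ω | y t ω = j ∧ x t ω ∈ B} <
      ∑ j, ∫⁻ a in B, ((M.trueProb β v a j).toNNReal : ℝ≥0∞) ∂(Pr.map (x t)) := by
    rw [← Finset.add_sum_erase _ _ (Finset.mem_univ j), ← Finset.add_sum_erase Finset.univ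
      (fun j => ∫⁻ a in B, ((M.trueProb β v a j).toNNReal : ℝ≥0∞) ∂(Pr.map (x t)))
      (Finset.mem_univ j)]
    refine ENNReal.add_lt_add_of_lt_of_le ?_ hlt (Finset.sum_le_sum fun k _ => hle k)
    exact ENNReal.sum_ne_top.2 fun k _ => measure_ne_top _ _
  rw [hsum1, hsum2] at this
  exact lt_irrefl _ this

/-- On the event `y t = j` the Markov property replaces the next state by the kernel of `j`, and
`measure_choice` says that the law of the state on this event has density `p_j`. -/
lemma Model.Generates.measure_transition (hgen : M.Generates β v Pr x ε y)
    (hv : M.IsValueFunction β v) (hc : Continuous (choiceProb M.errorLaw))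
    (t : ℕ) (j : Fin (K + 1)) {B D : Set X} (hB : MeasurableSet B) (hD : MeasurableSet D) :
    Pr {ω | y t ω = j ∧ x t ω ∈ B ∧ x (t + 1) ω ∈ D} =
      ∫⁻ a in B, M.trans j a D
        ∂((Pr.map (x t)).withDensity fun a => ((M.trueProb β v a j).toNNReal : ℝ≥0∞)) := by
  have hx := hgen.measurable_state t
  have hy := hgen.measurable_choice t
  have hprob : IsProbabilityMeasure (Pr.map (x t)) := Measure.isProbabilityMeasure_map hx.aemeasurable
  have hS : MeasurableSet {ω | y t ω = j} := hy (measurableSet_singleton j)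
  have hmap : (Pr.restrict {ω | y t ω = j}).map (x t) =
      (Pr.map (x t)).withDensity fun a => ((M.trueProb β v a j).toNNReal : ℝ≥0∞) := by
    ext B hB
    rw [Measure.map_apply hx hB, Measure.restrict_apply (hx hB), withDensity_apply _ hB,
      ← hgen.measure_choice hv hc t j hB]
    congr 1; ext ω; simp [and_comm]
  have hSm : MeasurableSet ({ω | y t ω = j} ∩ x t ⁻¹' B) := hS.inter (hx hB)
  have hD' : MeasurableSet (x (t + 1) ⁻¹' D) := hgen.measurable_state (t + 1) hD
  have hint : Integrable ((x (t + 1) ⁻¹' D).indicator fun _ => (1 : ℝ)) Pr :=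
    (integrable_const _).indicator hD'
  -- Integrate the conditional probability of `x (t + 1) ∈ D` over an event of the history.
  have h1 := setIntegral_condExp (iSup₂_le fun s (_ : s ∈ Set.Iic t) => sup_le
    (hgen.measurable_state s).comap_le (hgen.measurable_choice s).comap_le) hint
    (measurableSet_history x y t j hB)
  have h2 : ∫ ω in {ω | y t ω = j} ∩ x t ⁻¹' B, (M.trans j (x t ω)).real D ∂Pr =
      Pr.real ({ω | y t ω = j} ∩ x t ⁻¹' B ∩ x (t + 1) ⁻¹' D) := by
    rw [setIntegral_indicator hD', setIntegral_const, smul_eq_mul, mul_one] at h1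
    rw [← h1]
    refine setIntegral_congr_ae hSm ?_
    filter_upwards [hgen.markov t D hD] with ω hω hmem
    rw [hω]
    have : y t ω = j := hmem.1
    rw [this]
  have hmeas : Measurable fun a => (M.trans j a).real D :=
    ((M.trans j).measurable_coe hD).ennreal_toReal
  have h3 : ENNReal.ofReal (∫ ω in {ω | y t ω = j} ∩ x t ⁻¹' B, (M.trans j (x t ω)).real D ∂Pr) =
      ∫⁻ ω in {ω | y t ω = j} ∩ x t ⁻¹' B, M.trans j (x t ω) D ∂Pr := by
    rw [ofReal_integral_eq_lintegral_ofReal]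
    · exact lintegral_congr fun ω => ofReal_measureReal
    · refine Integrable.mono' (integrable_const (1 : ℝ)) (hmeas.comp hx).aestronglyMeasurable
        (ae_of_all _ fun ω => ?_)
      rw [Real.norm_of_nonneg measureReal_nonneg]
      exact measureReal_le_one
    · exact ae_of_all _ fun ω => measureReal_nonneg
  have hset : {ω | y t ω = j ∧ x t ω ∈ B ∧ x (t + 1) ω ∈ D} =
      {ω | y t ω = j} ∩ x t ⁻¹' B ∩ x (t + 1) ⁻¹' D := by
    ext ω; exact and_assoc.symm
  rw [hset, ← ofReal_measureReal, ← h2, h3, ← hmap, setLIntegral_map hB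
    ((M.trans j).measurable_coe hD) hx, Measure.restrict_restrict (hx hB), inter_comm]

/-- Stationarity enters here: state and next state share the law `μ`. The later arguments use only
this description of `F₀`, not the process. -/
lemma Model.Generates.stationaryLaw (hgen : M.Generates β v Pr x ε y)
    (hv : M.IsValueFunction β v) (hc : Continuous (choiceProb M.errorLaw))
    (hstat : ∀ s t, Pr.map (x s) = Pr.map (x t)) (t : ℕ) :
    StationaryLaw (Pr.map (x 0)) (M.trueProb β v) M.trans
      (Pr.map fun ω => (y t ω, x t ω, x (t + 1) ω)) := by
  have hx := hgen.measurable_state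
  have hz : Measurable fun ω => (y t ω, x t ω, x (t + 1) ω) :=
    (hgen.measurable_choice t).prodMk ((hx t).prodMk (hx (t + 1)))
  have hprob : IsProbabilityMeasure (Pr.map fun ω => (y t ω, x t ω, x (t + 1) ω)) :=
    Measure.isProbabilityMeasure_map hz.aemeasurable
  have hprob' : IsProbabilityMeasure (Pr.map (x t)) :=
    Measure.isProbabilityMeasure_map (hx t).aemeasurable
  refine ⟨measurable_trueProb hv hc, fun a j => choiceProb_pos _ _ j,
    fun a => sum_choiceProb _ hc _, ?_, ?_, ?_⟩
  · rw [hstat 0 t]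
    refine eq_jointLaw fun j B D hB hD => ?_
    rw [Measure.map_apply hz, ← hgen.measure_transition hv hc t j hB hD]
    · rfl
    · have h1 : MeasurableSet {z : Obs K X | z.1 = j} := measurable_fst (measurableSet_singleton j)
      have h2 : MeasurableSet {z : Obs K X | z.2.1 ∈ B} := (by fun_prop : Measurable
        fun z : Obs K X => z.2.1) hB
      have h3 : MeasurableSet {z : Obs K X | z.2.2 ∈ D} := (by fun_prop : Measurable
        fun z : Obs K X => z.2.2) hD
      exact h1.inter (h2.inter h3)
  · rw [Measure.map_map (by fun_prop) hz, hstat 0 t]; rfl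
  · rw [Measure.map_map (by fun_prop) hz, hstat 0 (t + 1)]; rfl

end Generates

end DDC

namespace DDC

/-! ### Conditional means as functions of the conditioning variable. -/

section CondMean

variable {Z S : Type*} [MeasurableSpace Z] [MeasurableSpace S] {F : Measure Z} [IsFiniteMeasure F]
  {f f' : Z → ℝ} {h : Z → S}

lemma measurable_condMean (F : Measure Z) [IsFiniteMeasure F] (f : Z → ℝ) (h : Z → S) :
    Measurable (condMean F f h) :=
  (StronglyMeasurable.integral_condDistrib (f := fun a : S × ℝ => a.2)
    measurable_snd.stronglyMeasurable).measurable

lemma condExp_ae_eq_condMean (hh : Measurable h) (hf : Integrable f F) :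
    F[f | MeasurableSpace.comap h inferInstance] =ᵐ[F] fun z => condMean F f h (h z) :=
  condExp_ae_eq_integral_condDistrib' hh hf

lemma integrable_condMean (hh : Measurable h) (hf : Integrable f F) :
    Integrable (fun z => condMean F f h (h z)) F :=
  integrable_condExp.congr (condExp_ae_eq_condMean hh hf)

/-- `condDistrib` depends only on the almost everywhere class of `f`, so the two functions agree at
every point and not just almost everywhere. -/
lemma condMean_congr_fun (hf : f =ᵐ[F] f') (h : Z → S) : condMean F f h = condMean F f' h := by
  unfold condMean
  rw [condDistrib_congr_left hf]

/-- A function of `h` with the right integrals over the events `h ∈ B` is the conditional mean. -/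
lemma condMean_ae_eq (hh : Measurable h) (hf : Integrable f F) {e : S → ℝ} (he : Measurable e)
    (hint : Integrable (fun z => e (h z)) F)
    (hset : ∀ B, MeasurableSet B → ∫ z in h ⁻¹' B, e (h z) ∂F = ∫ z in h ⁻¹' B, f z ∂F) :
    (fun z => condMean F f h (h z)) =ᵐ[F] fun z => e (h z) := by
  refine ((ae_eq_condExp_of_forall_setIntegral_eq hh.comap_le hf (fun s _ _ => hint.integrableOn)
    ?_ ?_).trans (condExp_ae_eq_condMean hh hf)).symm
  · rintro s ⟨B, hB, rfl⟩ -
    exact hset B hB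
  · exact (he.comp (comap_measurable h)).aestronglyMeasurable

/-- Tower property: a bounded function of `h` is pulled into the conditional expectation. -/
lemma integral_mul_condMean (hh : Measurable h) (hf : Integrable f F) {l : S → ℝ}
    (hl : Measurable l) {c : ℝ} (hc : ∀ᵐ z ∂F, |l (h z)| ≤ c) :
    ∫ z, l (h z) * condMean F f h (h z) ∂F = ∫ z, l (h z) * f z ∂F := by
  have h1 := condExp_stronglyMeasurable_mul_of_bound hh.comap_le
    (hl.comp (comap_measurable h)).stronglyMeasurable hf c hc
  rw [← integral_condExp hh.comap_le (f := fun z => l (h z) * f z)]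
  refine integral_congr_ae ?_
  filter_upwards [h1, condExp_ae_eq_condMean hh hf] with z hz hz'
  rw [← hz']
  exact hz.symm

end CondMean

/-! ### Contaminated laws as bounded changes of density. -/

section WithDensity

variable {Z : Type*} [MeasurableSpace Z] {F₀ : Measure Z} {ρ : Z → ℝ}

lemma integral_withDensity_real (hρ : Measurable ρ) (h0 : ∀ z, 0 ≤ ρ z) (φ : Z → ℝ) :
    ∫ z, φ z ∂(F₀.withDensity fun z => ((ρ z).toNNReal : ℝ≥0∞)) = ∫ z, ρ z * φ z ∂F₀ := by
  rw [integral_withDensity_eq_integral_smul hρ.real_toNNReal]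
  refine integral_congr_ae (ae_of_all _ fun z => ?_)
  simp [NNReal.smul_def, Real.coe_toNNReal _ (h0 z)]

lemma integrable_withDensity_real (hρ : Measurable ρ) (h0 : ∀ z, 0 ≤ ρ z) {φ : Z → ℝ} :
    Integrable φ (F₀.withDensity fun z => ((ρ z).toNNReal : ℝ≥0∞)) ↔
      Integrable (fun z => ρ z * φ z) F₀ := by
  rw [integrable_withDensity_iff_integrable_smul hρ.real_toNNReal]
  refine integrable_congr (ae_of_all _ fun z => ?_)
  simp [NNReal.smul_def, Real.coe_toNNReal _ (h0 z)]

lemma setIntegral_withDensity_real (hρ : Measurable ρ) (h0 : ∀ z, 0 ≤ ρ z) (φ : Z → ℝ) {s : Set Z}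
    (hs : MeasurableSet s) :
    ∫ z in s, φ z ∂(F₀.withDensity fun z => ((ρ z).toNNReal : ℝ≥0∞)) =
      ∫ z in s, ρ z * φ z ∂F₀ := by
  rw [restrict_withDensity hs, integral_withDensity_real hρ h0]

end WithDensity

/-- `G` has the bounded density `g` with respect to `F₀`. -/
structure HasBoundedDensity {Z : Type*} [MeasurableSpace Z] (F₀ G : Measure Z) (g : Z → ℝ)
    (C : ℝ) : Prop where
  measurable : Measurable g
  nonneg : ∀ z, 0 ≤ g z
  le : ∀ z, g z ≤ C
  eq : G = F₀.withDensity fun z => ((g z).toNNReal : ℝ≥0∞)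

/-- Domination by `C • F₀` gives absolute continuity and bounds the Radon–Nikodym derivative by `C`
almost everywhere. -/
lemma BoundedDirection.exists_density {Z : Type*} [MeasurableSpace Z] {F₀ G : Measure Z}
    [IsFiniteMeasure F₀] [IsFiniteMeasure G] (h : BoundedDirection F₀ G) :
    ∃ (g : Z → ℝ) (C : ℝ), HasBoundedDensity F₀ G g C := by
  obtain ⟨C, hC⟩ := h
  have hac : G ≪ F₀ := by
    refine Measure.AbsolutelyContinuous.mk fun s _ hs => ?_
    have := hC s
    rw [Measure.smul_apply, hs, smul_zero] at this
    exact le_antisymm this bot_le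
  have hle : ∀ᵐ z ∂F₀, G.rnDeriv F₀ z ≤ C := by
    refine ae_le_of_forall_setLIntegral_le_of_sigmaFinite (Measure.measurable_rnDeriv _ _)
      fun s hs _ => ?_
    rw [← withDensity_apply _ hs, Measure.withDensity_rnDeriv_eq _ _ hac, setLIntegral_const]
    exact hC s
  -- Truncating at `C` changes the density on a null set only and makes the bounds hold at every
  -- point.
  refine ⟨fun z => min (G.rnDeriv F₀ z).toReal C, C,
    (Measure.measurable_rnDeriv _ _).ennreal_toReal.min measurable_const,
    fun z => le_min ENNReal.toReal_nonneg C.2, fun z => min_le_right _ _, ?_⟩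
  conv_lhs => rw [← Measure.withDensity_rnDeriv_eq _ _ hac]
  refine withDensity_congr_ae ?_
  filter_upwards [hle] with z hz
  have hne : G.rnDeriv F₀ z ≠ ∞ := (hz.trans_lt ENNReal.coe_lt_top).ne
  have h2 : (G.rnDeriv F₀ z).toReal ≤ C := by
    have := ENNReal.toReal_mono ENNReal.coe_ne_top hz
    simpa using this
  rw [min_eq_left h2]
  exact (ENNReal.ofReal_toReal hne).symm

/-- The density of `(1 - s) F₀ + s G` when `G` has density `g`. -/
def tilt {Z : Type*} (g : Z → ℝ) (s : ℝ) (z : Z) : ℝ := 1 + s * (g z - 1)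

section Tilt

variable {Z : Type*} [MeasurableSpace Z] {F₀ G : Measure Z} {g : Z → ℝ} {C s : ℝ}

lemma tilt_zero (g : Z → ℝ) (z : Z) : tilt g 0 z = 1 := by simp [tilt]

lemma HasBoundedDensity.measurable_tilt (h : HasBoundedDensity F₀ G g C) (s : ℝ) :
    Measurable (tilt g s) :=
  measurable_const.add ((h.measurable.sub_const 1).const_mul s)

lemma HasBoundedDensity.const_nonneg [Nonempty Z] (h : HasBoundedDensity F₀ G g C) : 0 ≤ C :=
  (h.nonneg (Classical.arbitrary Z)).trans (h.le _)

/-- The density is at least `1 - s`. This is why `s` is kept below `1/2`: the contaminated law and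
`F₀` then dominate each other with fixed constants. -/
lemma HasBoundedDensity.half_le_tilt (h : HasBoundedDensity F₀ G g C) (hs : s ∈ Icc (0 : ℝ) (1 / 2))
    (z : Z) : 1 / 2 ≤ tilt g s z := by
  have := h.nonneg z
  have := mul_nonneg hs.1 this
  unfold tilt
  nlinarith [hs.2]

lemma HasBoundedDensity.tilt_nonneg (h : HasBoundedDensity F₀ G g C) (hs : s ∈ Icc (0 : ℝ) (1 / 2))
    (z : Z) : 0 ≤ tilt g s z := by
  linarith [h.half_le_tilt hs z]

lemma HasBoundedDensity.tilt_le (h : HasBoundedDensity F₀ G g C) (hs : s ∈ Icc (0 : ℝ) (1 / 2))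
    (z : Z) : tilt g s z ≤ 1 + C := by
  have h1 := h.nonneg z
  have h2 := h.le z
  unfold tilt
  nlinarith [hs.1, hs.2, mul_nonneg hs.1 h1, mul_le_mul_of_nonneg_right hs.2 h1]

lemma HasBoundedDensity.abs_sub_one_le (h : HasBoundedDensity F₀ G g C) (z : Z) :
    |g z - 1| ≤ 1 + C := by
  rw [abs_le]
  constructor <;> linarith [h.nonneg z, h.le z]

lemma HasBoundedDensity.mix_eq (h : HasBoundedDensity F₀ G g C) (hs : s ∈ Icc (0 : ℝ) (1 / 2)) :
    mix F₀ G s = F₀.withDensity fun z => ((tilt g s z).toNNReal : ℝ≥0∞) := by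
  have h1 : (fun z => ((tilt g s z).toNNReal : ℝ≥0∞)) =
      (fun _ => ((1 - s).toNNReal : ℝ≥0∞)) +
        ((s.toNNReal : ℝ≥0∞) • fun z => ((g z).toNNReal : ℝ≥0∞)) := by
    funext z
    have : (tilt g s z).toNNReal = (1 - s).toNNReal + s.toNNReal * (g z).toNNReal := by
      rw [← Real.toNNReal_mul hs.1, ← Real.toNNReal_add (by linarith [hs.2])
        (mul_nonneg hs.1 (h.nonneg z))]
      congr 1; unfold tilt; ring
    simp [this]
  rw [h1, withDensity_add_left measurable_const, withDensity_const,
    withDensity_smul _ h.measurable.real_toNNReal.coe_nnreal_ennreal, ← h.eq]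
  rfl

lemma mix_zero (F G : Measure Z) : mix F G 0 = F := by simp [mix]

lemma integral_mix (h : HasBoundedDensity F₀ G g C) (hs : s ∈ Icc (0 : ℝ) (1 / 2)) (φ : Z → ℝ) :
    ∫ z, φ z ∂(mix F₀ G s) = ∫ z, tilt g s z * φ z ∂F₀ := by
  rw [h.mix_eq hs, integral_withDensity_real (h.measurable_tilt s) (h.tilt_nonneg hs)]

lemma integrable_tilt_mul (h : HasBoundedDensity F₀ G g C) (hs : s ∈ Icc (0 : ℝ) (1 / 2))
    {φ : Z → ℝ} (hφ : Integrable φ F₀) : Integrable (fun z => tilt g s z * φ z) F₀ :=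
  hφ.bdd_mul (c := 1 + C) (h.measurable_tilt s).aestronglyMeasurable
    (ae_of_all _ fun z => by
      rw [Real.norm_of_nonneg (h.tilt_nonneg hs z)]; exact h.tilt_le hs z)

lemma integrable_mix (h : HasBoundedDensity F₀ G g C) (hs : s ∈ Icc (0 : ℝ) (1 / 2))
    {φ : Z → ℝ} (hφ : Integrable φ F₀) : Integrable φ (mix F₀ G s) := by
  rw [h.mix_eq hs, integrable_withDensity_real (h.measurable_tilt s) (h.tilt_nonneg hs)]
  exact integrable_tilt_mul h hs hφ

/-- Undo the change of density by multiplying with its inverse, which is at most `2`. -/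
lemma integrable_of_mix (h : HasBoundedDensity F₀ G g C) (hs : s ∈ Icc (0 : ℝ) (1 / 2))
    {φ : Z → ℝ} (hφ : Integrable φ (mix F₀ G s)) : Integrable φ F₀ := by
  rw [h.mix_eq hs, integrable_withDensity_real (h.measurable_tilt s) (h.tilt_nonneg hs)] at hφ
  have h2 := hφ.bdd_mul (c := 2) (f := fun z => (tilt g s z)⁻¹)
    (h.measurable_tilt s).inv.aestronglyMeasurable
    (ae_of_all _ fun z => by
      have h3 := h.half_le_tilt hs z
      rw [norm_inv, Real.norm_of_nonneg (h.tilt_nonneg hs z)]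
      calc (tilt g s z)⁻¹ ≤ (1 / 2 : ℝ)⁻¹ := inv_anti₀ (by norm_num) h3
        _ = 2 := by norm_num)
  refine h2.congr (ae_of_all _ fun z => ?_)
  have h3 := h.half_le_tilt hs z
  simp only
  field_simp

lemma ae_mix_of_ae (h : HasBoundedDensity F₀ G g C) (hs : s ∈ Icc (0 : ℝ) (1 / 2)) {P : Z → Prop}
    (hP : ∀ᵐ z ∂F₀, P z) : ∀ᵐ z ∂(mix F₀ G s), P z := by
  rw [h.mix_eq hs]
  exact withDensity_absolutelyContinuous _ _ hP

lemma HasBoundedDensity.integrable_density [IsFiniteMeasure F₀] (h : HasBoundedDensity F₀ G g C) :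
    Integrable g F₀ :=
  Integrable.of_bound h.measurable.aestronglyMeasurable C (ae_of_all _ fun z => by
    rw [Real.norm_of_nonneg (h.nonneg z)]; exact h.le z)

lemma HasBoundedDensity.integrable_mul (h : HasBoundedDensity F₀ G g C) {φ : Z → ℝ}
    (hφ : Integrable φ F₀) : Integrable (fun z => g z * φ z) F₀ :=
  hφ.bdd_mul (c := C) h.measurable.aestronglyMeasurable
    (ae_of_all _ fun z => by rw [Real.norm_of_nonneg (h.nonneg z)]; exact h.le z)

lemma HasBoundedDensity.integral_eq (h : HasBoundedDensity F₀ G g C) (φ : Z → ℝ) :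
    ∫ z, φ z ∂G = ∫ z, g z * φ z ∂F₀ := by
  rw [h.eq, integral_withDensity_real h.measurable h.nonneg]

lemma HasBoundedDensity.integrable (h : HasBoundedDensity F₀ G g C) {φ : Z → ℝ}
    (hφ : Integrable φ F₀) : Integrable φ G := by
  rw [h.eq, integrable_withDensity_real h.measurable h.nonneg]
  exact h.integrable_mul hφ

end Tilt

/-! ### Integrals and conditional means by slices of state and choice. -/

section TwoStage

variable {K : ℕ} {X : Type*} [MeasurableSpace X] {μ : Measure X} [IsProbabilityMeasure μ]
  {p : X → Fin (K + 1) → ℝ} {Q : Fin (K + 1) → Kernel X X} [∀ j, IsMarkovKernel (Q j)]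
  {F₀ : Measure (Obs K X)} [IsProbabilityMeasure F₀]

lemma measurable_ind (j : Fin (K + 1)) : Measurable fun z : Obs K X => ind z j :=
  (measurable_of_finite fun k : Fin (K + 1) => (Pi.single k (1 : ℝ) : Fin (K + 1) → ℝ) j).comp
    measurable_fst

lemma ind_eq (z : Obs K X) (j : Fin (K + 1)) : ind z j = if z.1 = j then 1 else 0 := by
  unfold ind
  rw [Pi.single_apply]
  simp only [eq_comm]

lemma ind_nonneg (z : Obs K X) (j : Fin (K + 1)) : 0 ≤ ind z j := by
  rw [ind_eq]; split_ifs <;> norm_num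

lemma ind_le_one (z : Obs K X) (j : Fin (K + 1)) : ind z j ≤ 1 := by
  rw [ind_eq]; split_ifs <;> norm_num

lemma abs_ind_le_one (z : Obs K X) (j : Fin (K + 1)) : ‖ind z j‖ ≤ 1 := by
  rw [Real.norm_of_nonneg (ind_nonneg z j)]; exact ind_le_one z j

lemma measurable_slice {φ : Obs K X → ℝ} (hφ : Measurable φ) (j : Fin (K + 1)) :
    Measurable fun x => ∫ w, φ (j, x, w) ∂(Q j x) :=
  (StronglyMeasurable.integral_kernel_prod_right' (κ := Q j) (f := fun a : X × X => φ (j, a.1, a.2))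
    (hφ.comp (measurable_tag j)).stronglyMeasurable).measurable

namespace StationaryLaw

lemma p_le_one (h : StationaryLaw μ p Q F₀) (x : X) (j : Fin (K + 1)) : p x j ≤ 1 := by
  rw [← h.sum_one x]
  exact Finset.single_le_sum (f := p x) (fun k _ => (h.pos x k).le) (Finset.mem_univ j)

lemma component_le (h : StationaryLaw μ p Q F₀) (j : Fin (K + 1)) :
    ((μ.withDensity fun x => ((p x j).toNNReal : ℝ≥0∞)) ⊗ₘ Q j).map
      (fun a => ((j, a.1, a.2) : Obs K X)) ≤ F₀ := by
  rw [h.law, jointLaw]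
  intro s
  rw [Measure.finsetSum_apply]
  exact Finset.single_le_sum (f := fun j => ((μ.withDensity fun x => ((p x j).toNNReal : ℝ≥0∞)) ⊗ₘ
    Q j).map (fun a => ((j, a.1, a.2) : Obs K X)) s) (fun _ _ => bot_le) (Finset.mem_univ j)

/-- Every choice has positive probability in every state, so the weighted measure has no more null
sets than `μ`. -/
lemma ae_of_ae_component (h : StationaryLaw μ p Q F₀) (j : Fin (K + 1)) {P : X → Prop}
    (hP : ∀ᵐ x ∂(μ.withDensity fun x => ((p x j).toNNReal : ℝ≥0∞)), P x) : ∀ᵐ x ∂μ, P x := by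
  rw [ae_withDensity_iff (h.measurable_p j).real_toNNReal.coe_nnreal_ennreal] at hP
  filter_upwards [hP] with x hx
  refine hx ?_
  simpa using h.pos x j

lemma ae_slice (h : StationaryLaw μ p Q F₀) {P : Obs K X → Prop} (hP : ∀ᵐ z ∂F₀, P z) :
    ∀ᵐ x ∂μ, ∀ j, ∀ᵐ w ∂(Q j x), P (j, x, w) := by
  refine ae_all_iff.2 fun j => h.ae_of_ae_component j ?_
  have h1 := ae_of_ae_map (measurable_tag j).aemeasurable
    ((h.component_le j).absolutelyContinuous hP)
  exact Measure.ae_ae_of_ae_compProd h1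

lemma ae_state (h : StationaryLaw μ p Q F₀) {P : X → Prop} (hP : ∀ᵐ x ∂μ, P x) :
    ∀ᵐ z ∂F₀, P z.2.1 := by
  rw [← h.map_state] at hP
  exact ae_of_ae_map (by fun_prop) hP

lemma ae_next (h : StationaryLaw μ p Q F₀) {P : X → Prop} (hP : ∀ᵐ x ∂μ, P x) :
    ∀ᵐ z ∂F₀, P z.2.2 := by
  rw [← h.map_next] at hP
  exact ae_of_ae_map (by fun_prop) hP

/-- A `μ`-null set of next states is missed by the kernels from almost every state, because the next
state also has law `μ`. This lets conditions imposed `μ`-almost everywhere be used under the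
transition kernels. -/
lemma ae_next_slice (h : StationaryLaw μ p Q F₀) {P : X → Prop} (hP : ∀ᵐ x ∂μ, P x) :
    ∀ᵐ x ∂μ, ∀ j, ∀ᵐ w ∂(Q j x), P w :=
  h.ae_slice (h.ae_next hP)

lemma integrable_state (h : StationaryLaw μ p Q F₀) {f : X → ℝ} (hf : Integrable f μ) :
    Integrable (fun z => f z.2.1) F₀ := by
  rw [← h.map_state] at hf
  exact hf.comp_aemeasurable (by fun_prop)

lemma integrable_next (h : StationaryLaw μ p Q F₀) {f : X → ℝ} (hf : Integrable f μ) :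
    Integrable (fun z => f z.2.2) F₀ := by
  rw [← h.map_next] at hf
  exact hf.comp_aemeasurable (by fun_prop)

lemma integrable_of_next (h : StationaryLaw μ p Q F₀) {f : X → ℝ} (hf : Measurable f)
    (hi : Integrable (fun z : Obs K X => f z.2.2) F₀) : Integrable f μ := by
  rw [← h.map_next]
  exact (integrable_map_measure hf.aestronglyMeasurable (by fun_prop)).2 hi

lemma integral_state (h : StationaryLaw μ p Q F₀) {f : X → ℝ} (hf : AEStronglyMeasurable f μ) :
    ∫ z, f z.2.1 ∂F₀ = ∫ x, f x ∂μ := by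
  conv_rhs => rw [← h.map_state]
  rw [integral_map (by fun_prop) (by rwa [h.map_state])]

lemma integral_next (h : StationaryLaw μ p Q F₀) {f : X → ℝ} (hf : AEStronglyMeasurable f μ) :
    ∫ z, f z.2.2 ∂F₀ = ∫ x, f x ∂μ := by
  conv_rhs => rw [← h.map_next]
  rw [integral_map (by fun_prop) (by rwa [h.map_next])]

lemma integrable_component (h : StationaryLaw μ p Q F₀) {φ : Obs K X → ℝ} (hφ : Integrable φ F₀)
    (j : Fin (K + 1)) : Integrable (fun a : X × X => φ (j, a.1, a.2))
      ((μ.withDensity fun x => ((p x j).toNNReal : ℝ≥0∞)) ⊗ₘ Q j) :=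
  (hφ.mono_measure (h.component_le j)).comp_measurable (measurable_tag j)

lemma integrable_slice (h : StationaryLaw μ p Q F₀) {φ : Obs K X → ℝ} (hφ : Integrable φ F₀) :
    ∀ᵐ x ∂μ, ∀ j, Integrable (fun w => φ (j, x, w)) (Q j x) := by
  refine ae_all_iff.2 fun j => h.ae_of_ae_component j ?_
  have h1 := h.integrable_component hφ j
  exact ((Measure.integrable_compProd_iff h1.1).1 h1).1

lemma integrable_inner (h : StationaryLaw μ p Q F₀) {φ : Obs K X → ℝ} (hφ : Integrable φ F₀)
    (j : Fin (K + 1)) : Integrable (fun x => p x j * ∫ w, φ (j, x, w) ∂(Q j x)) μ := by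
  have h1 := (h.integrable_component hφ j)
  have h2 : Integrable (fun x => ∫ w, φ (j, x, w) ∂(Q j x))
      (μ.withDensity fun x => ((p x j).toNNReal : ℝ≥0∞)) := by
    rw [Measure.compProd] at h1
    simpa using h1.integral_compProd
  exact (integrable_withDensity_real (h.measurable_p j) fun x => (h.pos x j).le).1 h2

lemma integral_eq (h : StationaryLaw μ p Q F₀) {φ : Obs K X → ℝ} (hφ : Integrable φ F₀) :
    ∫ z, φ z ∂F₀ = ∫ x, ∑ j, p x j * ∫ w, φ (j, x, w) ∂(Q j x) ∂μ := by
  rw [integral_finsetSum _ fun j _ => h.integrable_inner hφ j]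
  have hle := fun j => hφ.mono_measure (h.component_le j)
  conv_lhs => rw [h.law, jointLaw]
  rw [integral_finsetSum_measure fun j _ => hle j]
  refine Finset.sum_congr rfl fun j _ => ?_
  rw [integral_map (measurable_tag j).aemeasurable (hle j).1,
    Measure.integral_compProd (h.integrable_component hφ j),
    integral_withDensity_real (h.measurable_p j) fun x => (h.pos x j).le]

lemma integral_ind_mul_of_integrable (h : StationaryLaw μ p Q F₀) {φ : Obs K X → ℝ}
    (j : Fin (K + 1)) (hφ : Integrable (fun z => ind z j * φ z) F₀) :
    ∫ z, ind z j * φ z ∂F₀ = ∫ x, p x j * ∫ w, φ (j, x, w) ∂(Q j x) ∂μ := by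
  rw [h.integral_eq hφ]
  refine integral_congr_ae (ae_of_all _ fun x => ?_)
  simp only
  rw [Finset.sum_eq_single j]
  · simp [ind_eq]
  · intro k _ hk
    simp [ind_eq, hk]
  · simp

lemma integral_ind_mul (h : StationaryLaw μ p Q F₀) {φ : Obs K X → ℝ} (hφ : Integrable φ F₀)
    (j : Fin (K + 1)) :
    ∫ z, ind z j * φ z ∂F₀ = ∫ x, p x j * ∫ w, φ (j, x, w) ∂(Q j x) ∂μ :=
  h.integral_ind_mul_of_integrable j (hφ.bdd_mul (c := 1) (measurable_ind j).aestronglyMeasurable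
    (ae_of_all _ fun z => abs_ind_le_one z j))

/-- The factor `p x j` stays in the bound because some integrands, such as the score of the choice
probabilities, are controlled only after multiplication by it. -/
lemma integrable_of_le (h : StationaryLaw μ p Q F₀) {φ : Obs K X → ℝ} (hφ : Measurable φ)
    {B : X → ℝ} (hB : Integrable B μ)
    (hbd : ∀ᵐ x ∂μ, ∀ j, Integrable (fun w => φ (j, x, w)) (Q j x) ∧
      p x j * ∫ w, |φ (j, x, w)| ∂(Q j x) ≤ B x) : Integrable φ F₀ := by
  rw [h.law, jointLaw, integrable_finsetSum_measure]
  intro j _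
  rw [integrable_map_measure hφ.aestronglyMeasurable (measurable_tag j).aemeasurable]
  have hm : Measurable fun a : X × X => φ (j, a.1, a.2) := hφ.comp (measurable_tag j)
  refine (Measure.integrable_compProd_iff hm.aestronglyMeasurable).2 ⟨?_, ?_⟩
  · refine withDensity_absolutelyContinuous _ _ ?_
    filter_upwards [hbd] with x hx using (hx j).1
  · rw [integrable_withDensity_real (h.measurable_p j) fun x => (h.pos x j).le]
    have hm2 : Measurable fun z : Obs K X => ‖φ z‖ := hφ.norm
    refine hB.mono' ((h.measurable_p j).mul (measurable_slice hm2 j)).aestronglyMeasurable ?_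
    filter_upwards [hbd] with x hx
    rw [Real.norm_of_nonneg (mul_nonneg (h.pos x j).le (integral_nonneg fun w => norm_nonneg _))]
    exact (hx j).2

/-- The conditional mean given the state, when the law has density `ρ`. -/
lemma condMean_state (h : StationaryLaw μ p Q F₀) {F : Measure (Obs K X)} [IsFiniteMeasure F]
    {ρ φ : Obs K X → ℝ} (hρ : Measurable ρ) (hρ0 : ∀ z, 0 ≤ ρ z) {c : ℝ} (hρc : ∀ z, ρ z ≤ c)
    (hF : F = F₀.withDensity fun z => ((ρ z).toNNReal : ℝ≥0∞))
    (hpos : ∀ x, 0 < ∑ j, p x j * ∫ w, ρ (j, x, w) ∂(Q j x))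
    (hφ : Measurable φ) (hφi : Integrable φ F₀) :
    condMean F φ (fun z => z.2.1) =ᵐ[μ] fun x =>
      (∑ j, p x j * ∫ w, ρ (j, x, w) * φ (j, x, w) ∂(Q j x)) /
        ∑ j, p x j * ∫ w, ρ (j, x, w) ∂(Q j x) := by
  have hbd : ∀ᵐ z ∂F₀, ‖ρ z‖ ≤ c := ae_of_all _ fun z => by
    rw [Real.norm_of_nonneg (hρ0 z)]; exact hρc z
  have hρi : Integrable ρ F₀ := Integrable.of_bound hρ.aestronglyMeasurable c hbd
  have hρφ : Integrable (fun z => ρ z * φ z) F₀ := hφi.bdd_mul hρ.aestronglyMeasurable hbd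
  set D : X → ℝ := fun x => ∑ j, p x j * ∫ w, ρ (j, x, w) ∂(Q j x) with hD
  set N : X → ℝ := fun x => ∑ j, p x j * ∫ w, ρ (j, x, w) * φ (j, x, w) ∂(Q j x) with hN
  have hDm : Measurable D := Finset.measurable_sum _ fun j _ =>
    (h.measurable_p j).mul (measurable_slice hρ j)
  have hNm : Measurable N := Finset.measurable_sum _ fun j _ =>
    (h.measurable_p j).mul (measurable_slice (φ := fun z => ρ z * φ z) (hρ.mul hφ) j)
  have hNi : Integrable N μ := integrable_finsetSum _ fun j _ => h.integrable_inner hρφ j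
  have hst : Measurable fun z : Obs K X => z.2.1 := by fun_prop
  have he : Measurable fun x => N x / D x := hNm.div hDm
  -- Integrating out `w` against `ρ` on one slice gives at most `D x`, which cancels the denominator
  -- and leaves the integrable function `|N|`.
  have hρe : Integrable (fun z => ρ z * (N z.2.1 / D z.2.1)) F₀ := by
    refine h.integrable_of_le (hρ.mul (he.comp hst)) hNi.abs ?_
    filter_upwards [h.integrable_slice hρi] with x hx j
    refine ⟨(hx j).mul_const _, ?_⟩
    have h1 : ∀ w, |ρ (j, x, w) * (N x / D x)| = ρ (j, x, w) * |N x / D x| := fun w => by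
      rw [abs_mul, abs_of_nonneg (hρ0 _)]
    simp only [h1]
    rw [integral_mul_const, ← mul_assoc, abs_div, abs_of_pos (hpos x)]
    have h2 : p x j * ∫ w, ρ (j, x, w) ∂(Q j x) ≤ D x :=
      Finset.single_le_sum (f := fun j => p x j * ∫ w, ρ (j, x, w) ∂(Q j x))
        (fun k _ => mul_nonneg (h.pos x k).le (integral_nonneg fun w => hρ0 _)) (Finset.mem_univ j)
    calc _ ≤ D x * (|N x| / D x) := mul_le_mul_of_nonneg_right h2
            (div_nonneg (abs_nonneg _) (hpos x).le)
      _ = |N x| := mul_div_cancel₀ _ (hpos x).ne'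
  have key : (fun z : Obs K X => condMean F φ (fun z => z.2.1) z.2.1) =ᵐ[F]
      fun z => N z.2.1 / D z.2.1 := by
    refine condMean_ae_eq hst ?_ he ?_ ?_
    · rw [hF, integrable_withDensity_real hρ hρ0]; exact hρφ
    · rw [hF, integrable_withDensity_real hρ hρ0]; exact hρe
    · intro B hB
      rw [hF, setIntegral_withDensity_real hρ hρ0 _ (hst hB),
        setIntegral_withDensity_real hρ hρ0 _ (hst hB), ← integral_indicator (hst hB),
        ← integral_indicator (hst hB), h.integral_eq (hρe.indicator (hst hB)),
        h.integral_eq (hρφ.indicator (hst hB))]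
      refine integral_congr_ae (ae_of_all _ fun x => ?_)
      by_cases hx : x ∈ B
      · have hi : ∀ (ψ : Obs K X → ℝ) j w,
            ((fun z : Obs K X => z.2.1) ⁻¹' B).indicator ψ (j, x, w) = ψ (j, x, w) :=
          fun ψ j w => indicator_of_mem (show (j, x, w) ∈ (fun z : Obs K X => z.2.1) ⁻¹' B from hx) ψ
        simp only [hi]
        have : ∀ j, p x j * ∫ w, ρ (j, x, w) * (N x / D x) ∂(Q j x) =
            (p x j * ∫ w, ρ (j, x, w) ∂(Q j x)) * (N x / D x) := fun j => by
          rw [integral_mul_const]; ring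
        simp only [this]
        rw [← Finset.sum_mul]
        exact mul_div_cancel₀ _ (hpos x).ne'
      · have hi : ∀ (ψ : Obs K X → ℝ) j w,
            ((fun z : Obs K X => z.2.1) ⁻¹' B).indicator ψ (j, x, w) = 0 :=
          fun ψ j w => indicator_of_notMem
            (show (j, x, w) ∉ (fun z : Obs K X => z.2.1) ⁻¹' B from hx) ψ
        simp only [hi]
  -- The almost everywhere identity under `F` says nothing where `ρ` vanishes. A state at which it
  -- failed would need `ρ = 0` almost everywhere on all of its slices, contrary to `hpos`; this
  -- upgrades the identity to `μ`-almost every state.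
  have key2 : ∀ᵐ x ∂μ, ∀ j, ∀ᵐ w ∂(Q j x), ρ (j, x, w) ≠ 0 →
      condMean F φ (fun z => z.2.1) x = N x / D x := by
    refine h.ae_slice (P := fun z => ρ z ≠ 0 →
      condMean F φ (fun z => z.2.1) z.2.1 = N z.2.1 / D z.2.1) ?_
    have hF' : ∀ {P : Obs K X → Prop}, (∀ᵐ z ∂F, P z) → ∀ᵐ z ∂F₀, ρ z ≠ 0 → P z := by
      intro P hP
      rw [hF, ae_withDensity_iff hρ.real_toNNReal.coe_nnreal_ennreal] at hP
      filter_upwards [hP] with z hz hne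
      exact hz (by simpa using lt_of_le_of_ne (hρ0 z) hne.symm)
    exact hF' key
  filter_upwards [key2] with x hx
  by_contra hne
  refine (hpos x).ne' (Finset.sum_eq_zero fun j _ => ?_)
  have : ∀ᵐ w ∂(Q j x), ρ (j, x, w) = 0 := by
    filter_upwards [hx j] with w hw
    by_contra h0
    exact hne (hw h0)
  rw [integral_congr_ae this]
  simp

end StationaryLaw

end TwoStage

end DDC

namespace DDC

/-! ### Differentiation from the right under the integral. -/

section DerivIntegral

variable {α : Type*} [MeasurableSpace α] {ν : Measure α}

lemma integrable_of_lipschitz_at_zero {f : ℝ → α → ℝ} {bound : α → ℝ} {τ₀ : ℝ}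
    (hmeas : ∀ τ ∈ Icc 0 τ₀, AEStronglyMeasurable (f τ) ν) (h0 : Integrable (f 0) ν)
    (hbound : Integrable bound ν)
    (hlip : ∀ᵐ a ∂ν, ∀ τ ∈ Icc 0 τ₀, |f τ a - f 0 a| ≤ τ * bound a) {τ : ℝ} (hτ : τ ∈ Icc 0 τ₀) :
    Integrable (f τ) ν := by
  refine (h0.abs.add (hbound.const_mul τ)).mono' (hmeas τ hτ) ?_
  filter_upwards [hlip] with a ha
  have h1 := ha τ hτ
  have h2 := abs_sub_abs_le_abs_sub (f τ a) (f 0 a)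
  rw [Real.norm_eq_abs, Pi.add_apply]
  linarith

/-- Differentiation from the right under the integral sign. -/
lemma hasDerivWithinAt_integral {f : ℝ → α → ℝ} {f' bound : α → ℝ} {τ₀ : ℝ} (hτ₀ : 0 < τ₀)
    (hmeas : ∀ τ ∈ Icc 0 τ₀, AEStronglyMeasurable (f τ) ν) (h0 : Integrable (f 0) ν)
    (hbound : Integrable bound ν)
    (hlip : ∀ᵐ a ∂ν, ∀ τ ∈ Icc 0 τ₀, |f τ a - f 0 a| ≤ τ * bound a)
    (hderiv : ∀ᵐ a ∂ν, HasDerivWithinAt (fun τ => f τ a) (f' a) (Ici 0) 0) :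
    HasDerivWithinAt (fun τ => ∫ a, f τ a ∂ν) (∫ a, f' a ∂ν) (Ici 0) 0 := by
  have hset : (Ici (0 : ℝ)) \ {0} = Ioi 0 := by
    ext τ; simp [lt_iff_le_and_ne, eq_comm]
  have hev : ∀ᶠ τ in 𝓝[>] (0 : ℝ), τ ∈ Ioc 0 τ₀ := Ioc_mem_nhdsGT hτ₀
  rw [hasDerivWithinAt_iff_tendsto_slope, hset]
  have hlim : Tendsto (fun τ => ∫ a, slope (fun τ => f τ a) 0 τ ∂ν) (𝓝[>] 0)
      (𝓝 (∫ a, f' a ∂ν)) := by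
    refine tendsto_integral_filter_of_dominated_convergence bound ?_ ?_ hbound ?_
    · filter_upwards [hev] with τ hτ
      simp only [slope_def_field, div_eq_inv_mul]
      exact ((hmeas τ ⟨hτ.1.le, hτ.2⟩).sub h0.1).const_mul _
    · filter_upwards [hev] with τ hτ
      filter_upwards [hlip] with a ha
      rw [slope_def_field, sub_zero, Real.norm_eq_abs, abs_div, abs_of_pos hτ.1,
        div_le_iff₀ hτ.1, mul_comm]
      exact ha τ ⟨hτ.1.le, hτ.2⟩
    · filter_upwards [hderiv] with a ha
      rwa [hasDerivWithinAt_iff_tendsto_slope, hset] at ha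
  refine hlim.congr' ?_
  filter_upwards [hev] with τ hτ
  have h1 := integrable_of_lipschitz_at_zero hmeas h0 hbound hlip (τ := τ) ⟨hτ.1.le, hτ.2⟩
  simp only [slope_def_field]
  rw [integral_div, integral_sub h1 h0]

end DerivIntegral

/-! ### The function `H` near the true choice probabilities. -/

section Surplus

variable {K : ℕ} (Q : Measure (Fin (K + 1) → ℝ))

/-- The open simplex, in the free coordinates. -/
def openSimplex (K : ℕ) : Set (Fin K → ℝ) := {q | (∀ j, 0 < q j) ∧ ∑ j, q j < 1}

lemma isOpen_openSimplex (K : ℕ) : IsOpen (openSimplex K) := by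
  have : openSimplex K = (⋂ j, {q : Fin K → ℝ | 0 < q j}) ∩ {q | ∑ j, q j < 1} := by
    ext q; simp [openSimplex]
  rw [this]
  exact (isOpen_iInter_of_finite fun j => isOpen_lt (by fun_prop) (by fun_prop)).inter
    (isOpen_lt (by fun_prop) (by fun_prop))

lemma tail_mem_openSimplex {p : Fin (K + 1) → ℝ} (hp : ∀ j, 0 < p j) (hs : ∑ j, p j = 1) :
    Fin.tail p ∈ openSimplex K := by
  refine ⟨fun j => hp j.succ, ?_⟩
  rw [Fin.sum_univ_succ] at hs
  have := hp 0
  change ∑ j : Fin K, p j.succ < 1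
  linarith

lemma surplusRed_tail {p : Fin (K + 1) → ℝ} (hs : ∑ j, p j = 1) :
    surplusRed Q (Fin.tail p) = surplus Q p := by
  unfold surplusRed
  congr 1
  rw [Fin.sum_univ_succ] at hs
  have : (1 - ∑ j : Fin K, Fin.tail p j) = p 0 := by
    change 1 - ∑ j : Fin K, p j.succ = p 0
    linarith
  rw [this, Fin.cons_self_tail]

variable {Q}

lemma hasFDerivAt_surplusRed (hQ : ContDiffOn ℝ 1 (surplusRed Q) (openSimplex K))
    {q : Fin K → ℝ} (hq : q ∈ openSimplex K) :
    HasFDerivAt (surplusRed Q) (fderiv ℝ (surplusRed Q) q) q :=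
  ((hQ.contDiffAt ((isOpen_openSimplex K).mem_nhds hq)).differentiableAt one_ne_zero).hasFDerivAt

lemma continuousAt_fderiv_surplusRed (hQ : ContDiffOn ℝ 1 (surplusRed Q) (openSimplex K))
    {q : Fin K → ℝ} (hq : q ∈ openSimplex K) :
    ContinuousAt (fderiv ℝ (surplusRed Q)) q :=
  (hQ.contDiffAt ((isOpen_openSimplex K).mem_nhds hq)).continuousAt_fderiv one_ne_zero

lemma surplusDeriv_smul (p d : Fin (K + 1) → ℝ) (c : ℝ) :
    surplusDeriv Q p (c • d) = c * surplusDeriv Q p d := by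
  unfold surplusDeriv
  have : Fin.tail (c • d) = c • Fin.tail d := rfl
  rw [this, map_smul, smul_eq_mul]

lemma surplusDeriv_sum {ι : Type*} (s : Finset ι) (p : Fin (K + 1) → ℝ)
    (d : ι → Fin (K + 1) → ℝ) :
    surplusDeriv Q p (∑ i ∈ s, d i) = ∑ i ∈ s, surplusDeriv Q p (d i) := by
  unfold surplusDeriv
  have : Fin.tail (∑ i ∈ s, d i) = ∑ i ∈ s, Fin.tail (d i) := by
    funext k; simp [Fin.tail]
  rw [this, map_sum]

lemma surplusDeriv_zero (p : Fin (K + 1) → ℝ) : surplusDeriv Q p 0 = 0 := by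
  simpa using surplusDeriv_smul (Q := Q) p 0 0

/-- First-order effects on `H` near `p₀` of relative changes at most one are bounded by `C`. -/
def SurplusDominated (Q : Measure (Fin (K + 1) → ℝ)) (η C : ℝ) (p₀ : Fin (K + 1) → ℝ) : Prop :=
  ∀ q d : Fin (K + 1) → ℝ, ∑ j, q j = 1 → (∀ j, |q j - p₀ j| ≤ η * p₀ j) →
    ∑ j, d j = 0 → (∀ j, |d j| ≤ p₀ j) → |surplusDeriv Q q d| ≤ C

/-- Homogeneity: rescale the direction by `c⁻¹`. For `c = 0` the direction itself is zero. -/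
lemma SurplusDominated.bound {η C : ℝ} {p₀ q d : Fin (K + 1) → ℝ} (h : SurplusDominated Q η C p₀)
    (hq : ∑ j, q j = 1) (hqp : ∀ j, |q j - p₀ j| ≤ η * p₀ j) (hd : ∑ j, d j = 0) {c : ℝ}
    (hc : 0 ≤ c) (hdp : ∀ j, |d j| ≤ c * p₀ j) : |surplusDeriv Q q d| ≤ c * C := by
  rcases hc.eq_or_lt with rfl | hc
  · have : d = 0 := by
      funext j
      have := hdp j
      rw [zero_mul] at this
      exact abs_eq_zero.1 (le_antisymm this (abs_nonneg _))
    rw [this, surplusDeriv_zero]; simp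
  · have h1 := h q (c⁻¹ • d) hq hqp (by simp [← Finset.mul_sum, hd]) (fun j => by
      rw [Pi.smul_apply, smul_eq_mul, abs_mul, abs_of_pos (inv_pos.2 hc), inv_mul_le_iff₀ hc]
      exact hdp j)
    rw [surplusDeriv_smul, abs_mul, abs_of_pos (inv_pos.2 hc), inv_mul_le_iff₀ hc] at h1
    exact h1

/-- Mean value inequality on the segment from `p₀` to `q`. Its points stay within relative distance
`c ≤ η < 1` of `p₀`, hence inside the open simplex and inside the region where domination applies.
-/
lemma SurplusDominated.abs_sub_le (hQ : ContDiffOn ℝ 1 (surplusRed Q) (openSimplex K))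
    {η C : ℝ} (hη : η < 1) {p₀ q : Fin (K + 1) → ℝ}
    (h : SurplusDominated Q η C p₀) (hp : ∀ j, 0 < p₀ j) (hps : ∑ j, p₀ j = 1)
    (hq : ∑ j, q j = 1) {c : ℝ} (hc : 0 ≤ c) (hcη : c ≤ η) (hqp : ∀ j, |q j - p₀ j| ≤ c * p₀ j) :
    |surplus Q q - surplus Q p₀| ≤ c * C := by
  let path : ℝ → Fin (K + 1) → ℝ := fun θ => p₀ + θ • (q - p₀)
  have hsum : ∀ θ, ∑ j, path θ j = 1 := fun θ => by
    simp only [path, Pi.add_apply, Pi.smul_apply, Pi.sub_apply, smul_eq_mul,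
      Finset.sum_add_distrib, ← Finset.mul_sum, Finset.sum_sub_distrib, hps, hq]
    ring
  have hclose : ∀ θ ∈ Icc (0 : ℝ) 1, ∀ j, |path θ j - p₀ j| ≤ c * p₀ j := fun θ hθ j => by
    have : path θ j - p₀ j = θ * (q j - p₀ j) := by simp [path]
    rw [this, abs_mul, abs_of_nonneg hθ.1]
    exact (mul_le_of_le_one_left (abs_nonneg _) hθ.2).trans (hqp j)
  have hpos : ∀ θ ∈ Icc (0 : ℝ) 1, ∀ j, 0 < path θ j := fun θ hθ j => by
    have h1 := (abs_le.1 (hclose θ hθ j)).1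
    have h2 : c * p₀ j < p₀ j := mul_lt_of_lt_one_left (hp j) (hcη.trans_lt hη)
    linarith
  have hd : ∑ j, (q - p₀) j = 0 := by simp [hps, hq]
  have hderiv : ∀ θ ∈ Icc (0 : ℝ) 1, HasDerivWithinAt (fun θ => surplusRed Q (Fin.tail (path θ)))
      (surplusDeriv Q (path θ) (q - p₀)) (Icc 0 1) θ := by
    intro θ hθ
    have h1 := hasFDerivAt_surplusRed hQ (tail_mem_openSimplex (hpos θ hθ) (hsum θ))
    have h2 : HasDerivAt (fun θ => Fin.tail (path θ)) (Fin.tail (q - p₀)) θ := by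
      refine hasDerivAt_pi.2 fun j => ?_
      have : HasDerivAt (fun θ : ℝ => p₀ j.succ + θ * (q - p₀) j.succ) ((q - p₀) j.succ) θ := by
        simpa using ((hasDerivAt_id θ).mul_const ((q - p₀) j.succ)).const_add (p₀ j.succ)
      exact this
    exact (h1.comp_hasDerivAt θ h2).hasDerivWithinAt
  have hmvt := norm_image_sub_le_of_norm_deriv_le_segment_01' hderiv (C := c * C)
    (fun θ hθ => h.bound (hsum θ)
      (fun j => (hclose θ ⟨hθ.1, hθ.2.le⟩ j).trans
        (mul_le_mul_of_nonneg_right hcη (hp j).le)) hd hc hqp)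
  have e1 : path 1 = q := by simp [path]
  have e0 : path 0 = p₀ := by simp [path]
  rw [surplusRed_tail Q (hsum 1), surplusRed_tail Q (hsum 0), e1, e0] at hmvt
  exact hmvt

/-- `H` is known to be continuous only on the open simplex, so it is replaced by zero elsewhere
before composing. -/
lemma measurable_surplus_comp {X : Type*} [MeasurableSpace X]
    (hQ : ContDiffOn ℝ 1 (surplusRed Q) (openSimplex K)) {p : X → Fin (K + 1) → ℝ}
    (hp : Measurable p) (hpos : ∀ x j, 0 < p x j) (hs : ∀ x, ∑ j, p x j = 1) :
    Measurable fun x => surplus Q (p x) := by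
  classical
  have h1 : Measurable ((openSimplex K).piecewise (surplusRed Q) fun _ => (0 : ℝ)) :=
    hQ.continuousOn.measurable_piecewise continuousOn_const (isOpen_openSimplex K).measurableSet
  have ht : Measurable fun x => Fin.tail (p x) :=
    measurable_pi_lambda _ fun j => (measurable_pi_apply j.succ).comp hp
  convert h1.comp ht using 2 with x
  rw [Function.comp_apply, piecewise_eq_of_mem _ _ _ (tail_mem_openSimplex (hpos x) (hs x)),
    surplusRed_tail Q (hs x)]

lemma measurable_surplusDeriv_comp {X : Type*} [MeasurableSpace X] {p d : X → Fin (K + 1) → ℝ}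
    (hp : Measurable p) (hd : Measurable d) : Measurable fun x => surplusDeriv Q (p x) (d x) := by
  have ht : Measurable fun x => Fin.tail (p x) :=
    measurable_pi_lambda _ fun j => (measurable_pi_apply j.succ).comp hp
  have hd' : Measurable fun x => Fin.tail (d x) :=
    measurable_pi_lambda _ fun j => (measurable_pi_apply j.succ).comp hd
  have h1 : Measurable fun x => fderiv ℝ (surplusRed Q) (Fin.tail (p x)) :=
    (measurable_fderiv ℝ (surplusRed Q)).comp ht
  unfold surplusDeriv
  have h2 : ∀ x, fderiv ℝ (surplusRed Q) (Fin.tail (p x)) (Fin.tail (d x)) =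
      ∑ k, Fin.tail (d x) k * fderiv ℝ (surplusRed Q) (Fin.tail (p x)) (Pi.single k 1) := by
    intro x
    conv_lhs => rw [pi_eq_sum_univ' (Fin.tail (d x))]
    rw [map_sum]
    refine Finset.sum_congr rfl fun k _ => ?_
    rw [map_smul, smul_eq_mul]
  simp_rw [h2]
  exact Finset.measurable_sum _ fun k _ => ((measurable_pi_apply k).comp hd').mul
    ((ContinuousLinearMap.measurable_apply _).comp h1)

end Surplus

end DDC

namespace DDC

/-! ### Choice probabilities and `H` along the contaminated laws. -/

section Path

variable {K r : ℕ} {X Θ : Type*} [MeasurableSpace X] (M : Model K X Θ) (β : Θ) (v : X → ℝ)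
  (g : Obs K X → ℝ)

/-- Mean of the density given the state and the choice. -/
noncomputable def densityMean (j : Fin (K + 1)) (x : X) : ℝ := ∫ w, g (j, x, w) ∂(M.trans j x)

/-- Mean of the density given the state. -/
noncomputable def densityTotal (x : X) : ℝ := ∑ j, M.trueProb β v x j * densityMean M g j x

/-- Mean of the density of the contaminated law given the state and the choice. -/
noncomputable def tiltMean (s : ℝ) (j : Fin (K + 1)) (x : X) : ℝ :=
  1 + s * (densityMean M g j x - 1)

/-- Mean of the density of the contaminated law given the state. -/
noncomputable def tiltTotal (s : ℝ) (x : X) : ℝ := 1 + s * (densityTotal M β v g x - 1)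

/-- The choice probabilities under the contaminated law. -/
noncomputable def pathProb (s : ℝ) (x : X) (j : Fin (K + 1)) : ℝ :=
  M.trueProb β v x j * tiltMean M g s j x / tiltTotal M β v g s x

/-- Next period's term at the choice probabilities under the contaminated law. -/
noncomputable def pathNext (s : ℝ) (w : X) : ℝ :=
  M.u 0 w β + surplus M.errorLaw (pathProb M β v g s w)

/-- The derivative of the choice probabilities along the path, at the true law. -/
noncomputable def probDir (x : X) (j : Fin (K + 1)) : ℝ :=
  M.trueProb β v x j * (densityMean M g j x - densityTotal M β v g x)

/-- The derivative of `H(γ₁)` along the path, at the true law. -/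
noncomputable def surplusDir (x : X) : ℝ :=
  surplusDeriv M.errorLaw (M.trueProb β v x) (probDir M β v g x)

end Path

/-- The setting: a regular model, the law `F₀` of an observation, and a law `G` with bounded
density `g` with respect to `F₀`. -/
structure Contamination {K r : ℕ} {X Θ : Type*} [MeasurableSpace X] (M : Model K X Θ)
    (A : X → Matrix (Fin r) (Fin (K + 1)) ℝ) (β : Θ) (v : X → ℝ) (μ : Measure X)
    (F₀ G : Measure (Obs K X)) (g : Obs K X → ℝ) (C : ℝ) : Prop where
  value : M.IsValueFunction β v
  regular : M.Regular A β v μ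
  law : StationaryLaw μ (M.trueProb β v) M.trans F₀
  density : HasBoundedDensity F₀ G g C

namespace Contamination

variable {K r : ℕ} {X Θ : Type*} [MeasurableSpace X] {M : Model K X Θ}
  {A : X → Matrix (Fin r) (Fin (K + 1)) ℝ} {β : Θ} {v : X → ℝ} {μ : Measure X}
  [IsProbabilityMeasure μ] {F₀ G : Measure (Obs K X)} [IsProbabilityMeasure F₀]
  {g : Obs K X → ℝ} {C : ℝ}

lemma nonneg (h : Contamination M A β v μ F₀ G g C) : 0 ≤ C := by
  have : Nonempty (Obs K X) := F₀.nonempty_of_neZero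
  exact h.density.const_nonneg

lemma measurable_densityMean (h : Contamination M A β v μ F₀ G g C) (j : Fin (K + 1)) :
    Measurable (densityMean M g j) :=
  measurable_slice h.density.measurable j

lemma measurable_densityTotal (h : Contamination M A β v μ F₀ G g C) :
    Measurable (densityTotal M β v g) :=
  Finset.measurable_sum _ fun j _ => (h.law.measurable_p j).mul (h.measurable_densityMean j)

lemma integrable_density_slice (h : Contamination M A β v μ F₀ G g C) (j : Fin (K + 1)) (x : X) :
    Integrable (fun w => g (j, x, w)) (M.trans j x) :=
  Integrable.of_bound (h.density.measurable.comp (by fun_prop)).aestronglyMeasurable C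
    (ae_of_all _ fun w => by
      rw [Real.norm_of_nonneg (h.density.nonneg _)]; exact h.density.le _)

lemma densityMean_nonneg (h : Contamination M A β v μ F₀ G g C) (j : Fin (K + 1)) (x : X) :
    0 ≤ densityMean M g j x := integral_nonneg fun _ => h.density.nonneg _

lemma densityMean_le (h : Contamination M A β v μ F₀ G g C) (j : Fin (K + 1)) (x : X) :
    densityMean M g j x ≤ C := by
  have := integral_mono (h.integrable_density_slice j x) (integrable_const C)
    fun w => h.density.le (j, x, w)
  simpa [densityMean] using this

lemma densityTotal_nonneg (h : Contamination M A β v μ F₀ G g C) (x : X) :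
    0 ≤ densityTotal M β v g x :=
  Finset.sum_nonneg fun j _ => mul_nonneg (h.law.pos x j).le (h.densityMean_nonneg j x)

lemma densityTotal_le (h : Contamination M A β v μ F₀ G g C) (x : X) :
    densityTotal M β v g x ≤ C := by
  calc densityTotal M β v g x ≤ ∑ j, M.trueProb β v x j * C :=
        Finset.sum_le_sum fun j _ => mul_le_mul_of_nonneg_left (h.densityMean_le j x)
          (h.law.pos x j).le
    _ = C := by rw [← Finset.sum_mul, h.law.sum_one, one_mul]

lemma abs_densityMean_sub_one_le (h : Contamination M A β v μ F₀ G g C) (j : Fin (K + 1)) (x : X) :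
    |densityMean M g j x - 1| ≤ 1 + C := by
  have := h.densityMean_nonneg j x
  have := h.densityMean_le j x
  rw [abs_le]; constructor <;> linarith [h.nonneg]

lemma abs_densityMean_sub_densityTotal_le (h : Contamination M A β v μ F₀ G g C)
    (j : Fin (K + 1)) (x : X) : |densityMean M g j x - densityTotal M β v g x| ≤ C := by
  have := h.densityMean_nonneg j x
  have := h.densityMean_le j x
  have := h.densityTotal_nonneg x
  have := h.densityTotal_le x
  rw [abs_le]; constructor <;> linarith [h.nonneg]

lemma integral_tilt_slice (h : Contamination M A β v μ F₀ G g C) (s : ℝ) (j : Fin (K + 1)) (x : X) :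
    ∫ w, tilt g s (j, x, w) ∂(M.trans j x) = tiltMean M g s j x := by
  have hi := h.integrable_density_slice j x
  have hi' : Integrable (fun w => s * (g (j, x, w) - 1)) (M.trans j x) :=
    (hi.sub (integrable_const 1)).const_mul s
  simp only [tilt]
  rw [integral_add (integrable_const _) hi',
    integral_const_mul, integral_sub hi (integrable_const _)]
  simp [tiltMean, densityMean]

lemma sum_mul_tiltMean (h : Contamination M A β v μ F₀ G g C) (s : ℝ) (x : X) :
    ∑ j, M.trueProb β v x j * tiltMean M g s j x = tiltTotal M β v g s x := by
  have : ∀ j, M.trueProb β v x j * tiltMean M g s j x =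
      M.trueProb β v x j + s * (M.trueProb β v x j * densityMean M g j x - M.trueProb β v x j) :=
    fun j => by unfold tiltMean; ring
  simp_rw [this]
  rw [Finset.sum_add_distrib, ← Finset.mul_sum, Finset.sum_sub_distrib, h.law.sum_one]
  rfl

section Bounds

variable {s : ℝ}

lemma half_le_tiltMean (h : Contamination M A β v μ F₀ G g C) (hs : s ∈ Icc (0 : ℝ) (1 / 2))
    (j : Fin (K + 1)) (x : X) : 1 / 2 ≤ tiltMean M g s j x := by
  have := mul_nonneg hs.1 (h.densityMean_nonneg j x)
  unfold tiltMean
  nlinarith [hs.2]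

lemma half_le_tiltTotal (h : Contamination M A β v μ F₀ G g C) (hs : s ∈ Icc (0 : ℝ) (1 / 2))
    (x : X) : 1 / 2 ≤ tiltTotal M β v g s x := by
  have := mul_nonneg hs.1 (h.densityTotal_nonneg x)
  unfold tiltTotal
  nlinarith [hs.2]

lemma pathProb_pos (h : Contamination M A β v μ F₀ G g C) (hs : s ∈ Icc (0 : ℝ) (1 / 2))
    (x : X) (j : Fin (K + 1)) : 0 < pathProb M β v g s x j :=
  div_pos (mul_pos (h.law.pos x j) (by linarith [h.half_le_tiltMean hs j x]))
    (by linarith [h.half_le_tiltTotal hs x])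

lemma sum_pathProb (h : Contamination M A β v μ F₀ G g C) (hs : s ∈ Icc (0 : ℝ) (1 / 2))
    (x : X) : ∑ j, pathProb M β v g s x j = 1 := by
  unfold pathProb
  rw [← Finset.sum_div, h.sum_mul_tiltMean]
  exact div_self (by linarith [h.half_le_tiltTotal hs x])

lemma pathProb_zero (x : X) : pathProb M β v g 0 x = M.trueProb β v x := by
  funext j; simp [pathProb, tiltMean, tiltTotal]

lemma measurable_pathProb (h : Contamination M A β v μ F₀ G g C) (s : ℝ) :
    Measurable (pathProb M β v g s) :=
  measurable_pi_lambda _ fun j => ((h.law.measurable_p j).mul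
    ((((h.measurable_densityMean j).sub_const 1).const_mul s).const_add 1)).div
    (((h.measurable_densityTotal.sub_const 1).const_mul s).const_add 1)

/-- The change is exactly `p s (densityMean - densityTotal) / tiltTotal`. The factor `2` comes from
`tiltTotal ≥ 1/2`. The bound is relative to `p`, as the domination hypothesis on `H` requires. -/
lemma abs_pathProb_sub_le (h : Contamination M A β v μ F₀ G g C) (hs : s ∈ Icc (0 : ℝ) (1 / 2))
    (x : X) (j : Fin (K + 1)) :
    |pathProb M β v g s x j - M.trueProb β v x j| ≤ s * (2 * C) * M.trueProb β v x j := by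
  have ht := h.half_le_tiltTotal hs x
  have hp := h.law.pos x j
  have h1 : pathProb M β v g s x j - M.trueProb β v x j = M.trueProb β v x j * s *
      (densityMean M g j x - densityTotal M β v g x) / tiltTotal M β v g s x := by
    have : tiltTotal M β v g s x ≠ 0 := by linarith
    unfold pathProb
    field_simp
    unfold tiltMean tiltTotal
    ring
  rw [h1, abs_div, abs_mul, abs_mul, abs_of_pos hp, abs_of_nonneg hs.1,
    abs_of_pos (show 0 < tiltTotal M β v g s x by linarith), div_le_iff₀ (by linarith)]
  have h2 := h.abs_densityMean_sub_densityTotal_le j x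
  have h3 : 0 ≤ M.trueProb β v x j * s := mul_nonneg hp.le hs.1
  calc _ ≤ M.trueProb β v x j * s * C := mul_le_mul_of_nonneg_left h2 h3
    _ ≤ s * (2 * C) * M.trueProb β v x j * tiltTotal M β v g s x := by
      have := mul_le_mul_of_nonneg_left ht (mul_nonneg h3 h.nonneg)
      nlinarith

lemma pathProb_le (h : Contamination M A β v μ F₀ G g C) (hs : s ∈ Icc (0 : ℝ) (1 / 2))
    (x : X) (j : Fin (K + 1)) : pathProb M β v g s x j ≤ (1 + C) * M.trueProb β v x j := by
  have h1 := (abs_le.1 (h.abs_pathProb_sub_le hs x j)).2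
  have hp := h.law.pos x j
  have h2 : s * (2 * C) * M.trueProb β v x j ≤ C * M.trueProb β v x j := by
    refine mul_le_mul_of_nonneg_right ?_ hp.le
    nlinarith [hs.2, h.nonneg]
  linarith

lemma hasDerivAt_pathProb (a : ℝ) (x : X) (j : Fin (K + 1)) :
    HasDerivAt (fun τ => pathProb M β v g (a * τ) x j) (a * probDir M β v g x j) 0 := by
  have h1 : ∀ y : ℝ, HasDerivAt (fun τ : ℝ => 1 + a * τ * (y - 1)) (a * (y - 1)) 0 := fun y => by
    simpa using (((hasDerivAt_id (0 : ℝ)).const_mul a).mul_const (y - 1)).const_add 1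
  have h2 := ((h1 (densityMean M g j x)).const_mul (M.trueProb β v x j)).div
    (h1 (densityTotal M β v g x)) (by simp)
  have h3 : HasDerivAt (fun τ => pathProb M β v g (a * τ) x j) _ 0 := h2
  refine h3.congr_deriv ?_
  simp only [mul_zero, zero_mul, add_zero, mul_one, one_pow, div_one, probDir]
  ring

lemma sum_probDir (h : Contamination M A β v μ F₀ G g C) (x : X) :
    ∑ j, probDir M β v g x j = 0 := by
  unfold probDir
  simp_rw [mul_sub]
  rw [Finset.sum_sub_distrib, ← Finset.sum_mul, h.law.sum_one]
  simp [densityTotal]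

lemma continuousAt_pathProb (a : ℝ) (x : X) :
    ContinuousAt (fun τ => pathProb M β v g (a * τ) x) 0 :=
  continuousAt_pi.2 fun j => (hasDerivAt_pathProb a x j).continuousAt

end Bounds

lemma measurable_probDir (h : Contamination M A β v μ F₀ G g C) :
    Measurable (probDir M β v g) :=
  measurable_pi_lambda _ fun j => (h.law.measurable_p j).mul
    ((h.measurable_densityMean j).sub h.measurable_densityTotal)

lemma measurable_surplusDir (h : Contamination M A β v μ F₀ G g C) :
    Measurable (surplusDir M β v g) :=
  measurable_surplusDeriv_comp (measurable_pi_lambda _ h.law.measurable_p) h.measurable_probDir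

/-- Uniform domination of the first-order effects on `H` along the path. -/
lemma exists_surplusDominated (h : Contamination M A β v μ F₀ G g C) :
    ∃ η C₁ τ₀ : ℝ, η < 1 ∧ 0 ≤ C₁ ∧ 0 < τ₀ ∧ τ₀ ≤ 1 / 2 ∧ τ₀ * (2 * C) ≤ η ∧
      ∀ᵐ x ∂μ, SurplusDominated M.errorLaw η C₁ (M.trueProb β v x) := by
  obtain ⟨η, C₁, hη, hη1, hdom⟩ := h.regular.dominated_surplus
  have hC := h.nonneg
  -- The second bound on `τ₀` makes the relative change `τ₀ * (2 * C)` at most `η`; the `+ 1` avoids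
  -- division by zero when `C = 0`.
  refine ⟨η, |C₁|, min (1 / 2) (η / (2 * C + 1)), hη1, abs_nonneg _, ?_, min_le_left _ _, ?_, ?_⟩
  · exact lt_min (by norm_num) (by positivity)
  · calc min (1 / 2) (η / (2 * C + 1)) * (2 * C) ≤ η / (2 * C + 1) * (2 * C + 1) :=
        mul_le_mul (min_le_right _ _) (by linarith) (by linarith) (by positivity)
      _ = η := by field_simp
  · filter_upwards [hdom] with x hx q d h1 h2 h3 h4
    exact (hx q d h1 h2 h3 h4).trans (le_abs_self _)

/-- By inversion `u₀ + H(p₀)` is `v` minus the discounted continuation value of the renewal choice,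
and that value is the same from every state, so any `x₀` serves. -/
lemma pathNext_zero (h : Contamination M A β v μ F₀ G g C) (x₀ w : X) :
    pathNext M β v g 0 w = v w - M.δ * ∫ w', v w' ∂(M.trans 0 x₀) := by
  unfold pathNext
  rw [pathProb_zero, h.value.surplus_trueProb, M.renewal x₀ w]
  unfold Model.condValue
  ring

lemma measurable_pathNext (h : Contamination M A β v μ F₀ G g C) {s : ℝ}
    (hs : s ∈ Icc (0 : ℝ) (1 / 2)) : Measurable (pathNext M β v g s) :=
  (M.measurable_u 0 β).add (measurable_surplus_comp h.regular.smooth_surplus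
    (h.measurable_pathProb s) (h.pathProb_pos hs) (h.sum_pathProb hs))

lemma integrable_pathNext_zero_slice (h : Contamination M A β v μ F₀ G g C) (j : Fin (K + 1))
    (x : X) : Integrable (pathNext M β v g 0) (M.trans j x) :=
  ((h.value.integrable j x).sub (integrable_const _)).congr
    (ae_of_all _ fun w => (h.pathNext_zero x w).symm)

lemma integrable_pathNext_zero (h : Contamination M A β v μ F₀ G g C) :
    Integrable (pathNext M β v g 0) μ := by
  have : Nonempty X := μ.nonempty_of_neZero
  exact (h.regular.integrable_value.sub (integrable_const _)).congr
    (ae_of_all _ fun w => (h.pathNext_zero (Classical.arbitrary X) w).symm)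

/-- Along the path `H(γ₁)` is Lipschitz at the truth, uniformly in the state, and has the
derivative `surplusDir`. -/
lemma exists_pathNext_lipschitz (h : Contamination M A β v μ F₀ G g C) :
    ∃ L τ₀ : ℝ, 0 ≤ L ∧ 0 < τ₀ ∧ τ₀ ≤ 1 / 2 ∧
      (∀ᵐ w ∂μ, ∀ s ∈ Icc 0 τ₀, |pathNext M β v g s w - pathNext M β v g 0 w| ≤ s * L) ∧
      ∀ᵐ w ∂μ, |surplusDir M β v g w| ≤ L := by
  obtain ⟨η, C₁, τ₀, hη, hC₁, hτ₀, hτ₀', hτη, hdom⟩ := h.exists_surplusDominated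
  have hC := h.nonneg
  have hη0 : 0 ≤ η := le_trans (by positivity) hτη
  refine ⟨2 * C * C₁, τ₀, by positivity, hτ₀, hτ₀', ?_, ?_⟩
  · filter_upwards [hdom] with w hw s hs
    have hs' : s ∈ Icc (0 : ℝ) (1 / 2) := ⟨hs.1, hs.2.trans hτ₀'⟩
    unfold pathNext
    rw [add_sub_add_left_eq_sub, pathProb_zero]
    have := hw.abs_sub_le h.regular.smooth_surplus hη (h.law.pos w) (h.law.sum_one w)
      (h.sum_pathProb hs' w) (mul_nonneg hs.1 (by positivity))
      ((mul_le_mul_of_nonneg_right hs.2 (by positivity)).trans hτη) (h.abs_pathProb_sub_le hs' w)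
    rwa [mul_assoc] at this
  · filter_upwards [hdom] with w hw
    have h1 := hw.bound (c := C) (h.law.sum_one w) (fun j => by
      simpa using mul_nonneg hη0 (h.law.pos w j).le) (h.sum_probDir w) hC (fun j => by
      unfold probDir
      rw [abs_mul, abs_of_pos (h.law.pos w j), mul_comm]
      exact mul_le_mul_of_nonneg_right (h.abs_densityMean_sub_densityTotal_le j w)
        (h.law.pos w j).le)
    refine h1.trans ?_
    nlinarith [mul_nonneg hC hC₁]

lemma hasDerivAt_pathNext (h : Contamination M A β v μ F₀ G g C) {a : ℝ} (ha : a ∈ Icc (0 : ℝ) 1)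
    (w : X) : HasDerivWithinAt (fun τ => pathNext M β v g (a * τ) w)
      (a * surplusDir M β v g w) (Ici 0) 0 := by
  unfold pathNext
  refine HasDerivWithinAt.const_add _ ?_
  have h1 := hasFDerivAt_surplusRed h.regular.smooth_surplus
    (tail_mem_openSimplex (h.law.pos w) (h.law.sum_one w))
  have h2 : HasDerivAt (fun τ => Fin.tail (pathProb M β v g (a * τ) w))
      (a • Fin.tail (probDir M β v g w)) 0 :=
    hasDerivAt_pi.2 fun j => hasDerivAt_pathProb a w j.succ
  have h3 : pathProb M β v g (a * 0) w = M.trueProb β v w := by rw [mul_zero, pathProb_zero]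
  rw [← h3] at h1
  have h4 := (h1.comp_hasDerivAt (0 : ℝ) h2).hasDerivWithinAt (s := Ici 0)
  rw [map_smul, h3] at h4
  -- `surplus` agrees with its reduced form only at vectors summing to one, and the path is known to
  -- be such a vector for small nonnegative `τ`; hence a derivative from the right.
  refine h4.congr_of_eventuallyEq ?_ ?_
  · have : Icc (0 : ℝ) (1 / 2) ∈ 𝓝[≥] (0 : ℝ) := Icc_mem_nhdsGE (by norm_num)
    filter_upwards [this] with τ hτ
    have hs : a * τ ∈ Icc (0 : ℝ) (1 / 2) :=
      ⟨mul_nonneg ha.1 hτ.1, (mul_le_of_le_one_left hτ.1 ha.2).trans hτ.2⟩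
    exact (surplusRed_tail _ (h.sum_pathProb hs w)).symm
  · exact (surplusRed_tail _ (by rw [h3]; exact h.law.sum_one w)).symm

end Contamination

end DDC

/-! ### Means under a tilted law: Lipschitz bound and derivative. -/

namespace DDC

/-- The mean of `h` under the law with density proportional to `tilt g s`. -/
noncomputable def tiltedMean {α : Type*} [MeasurableSpace α] (ν : Measure α) (g : α → ℝ) (s : ℝ)
    (h : α → ℝ) : ℝ :=
  (∫ a, tilt g s a * h a ∂ν) / ∫ a, tilt g s a ∂ν

section TiltedMean

variable {α : Type*} [MeasurableSpace α] {ν ν' : Measure α} [IsProbabilityMeasure ν] {g : α → ℝ}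
  {C : ℝ}

lemma tiltedMean_zero (h : α → ℝ) : tiltedMean ν g 0 h = ∫ a, h a ∂ν := by
  simp [tiltedMean, tilt_zero]

lemma integral_tilt (hg : HasBoundedDensity ν ν' g C) (s : ℝ) :
    ∫ a, tilt g s a ∂ν = 1 + s * (∫ a, g a ∂ν - 1) := by
  have hi := hg.integrable_density
  have hi' : Integrable (fun a => s * (g a - 1)) ν := (hi.sub (integrable_const 1)).const_mul s
  simp only [tilt]
  rw [integral_add (integrable_const _) hi', integral_const_mul, integral_sub hi (integrable_const _)]
  simp

lemma integrable_tilt (hg : HasBoundedDensity ν ν' g C) (s : ℝ) : Integrable (tilt g s) ν :=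
  (integrable_const 1).add ((hg.integrable_density.sub (integrable_const 1)).const_mul s)

lemma half_le_integral_tilt (hg : HasBoundedDensity ν ν' g C) {s : ℝ}
    (hs : s ∈ Icc (0 : ℝ) (1 / 2)) : 1 / 2 ≤ ∫ a, tilt g s a ∂ν := by
  have := integral_mono (integrable_const (1 / 2 : ℝ)) (integrable_tilt hg s)
    fun a => hg.half_le_tilt hs a
  simpa using this

variable {h : ℝ → α → ℝ} {L τ₀ : ℝ}

lemma integrable_path (hm : ∀ t ∈ Icc 0 τ₀, AEStronglyMeasurable (h t) ν)
    (h0 : Integrable (h 0) ν) (hlip : ∀ᵐ a ∂ν, ∀ t ∈ Icc 0 τ₀, |h t a - h 0 a| ≤ t * L)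
    {t : ℝ} (ht : t ∈ Icc 0 τ₀) : Integrable (h t) ν :=
  integrable_of_lipschitz_at_zero hm h0 (integrable_const L) hlip ht

/-- Centring at the mean makes the contamination of the law act on `h 0 - m` only. Hence the bound
involves the mean absolute deviation, which is what the regularity condition controls uniformly, and
not the size of `h 0`. -/
lemma abs_tiltedMean_sub_le (hg : HasBoundedDensity ν ν' g C) (hC : 0 ≤ C)
    (hm : ∀ t ∈ Icc 0 τ₀, AEStronglyMeasurable (h t) ν)
    (h0 : Integrable (h 0) ν) (hL : 0 ≤ L)
    (hlip : ∀ᵐ a ∂ν, ∀ t ∈ Icc 0 τ₀, |h t a - h 0 a| ≤ t * L)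
    {s t : ℝ} (hs : s ∈ Icc (0 : ℝ) (1 / 2)) (ht : t ∈ Icc 0 τ₀) :
    |tiltedMean ν g s (h t) - ∫ a, h 0 a ∂ν| ≤
      2 * (1 + C) * (s * ∫ a, |h 0 a - ∫ a', h 0 a' ∂ν| ∂ν + t * L) := by
  set m := ∫ a, h 0 a ∂ν
  have hD := half_le_integral_tilt hg hs
  have hi := integrable_path hm h0 hlip ht
  have hc : Integrable (fun a => h 0 a - m) ν := h0.sub (integrable_const m)
  -- Write `tilt = 1 + s (g - 1)`: the part with weight `1` integrates `h 0 - m` to zero.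
  have e1 : ∫ a, tilt g s a * h t a ∂ν - m * ∫ a, tilt g s a ∂ν =
      ∫ a, (s * ((g a - 1) * (h 0 a - m)) + tilt g s a * (h t a - h 0 a)) ∂ν := by
    have i1 : Integrable (fun a => s * ((g a - 1) * (h 0 a - m)) + tilt g s a * (h t a - h 0 a)) ν :=
      ((hc.bdd_mul (c := 1 + C) (hg.measurable.sub_const 1).aestronglyMeasurable
        (ae_of_all _ hg.abs_sub_one_le)).const_mul s).add (integrable_tilt_mul hg hs (hi.sub h0))
    have hz : ∫ a, (h 0 a - m) ∂ν = 0 := by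
      rw [integral_sub h0 (integrable_const m)]; simp [m]
    rw [← integral_const_mul, ← integral_sub (integrable_tilt_mul hg hs hi)
      ((integrable_tilt hg s).const_mul m)]
    have hsum := integral_add i1 hc
    rw [hz, add_zero] at hsum
    rw [← hsum]
    refine integral_congr_ae (ae_of_all _ fun a => ?_)
    simp only [tilt]; ring
  have e2 : tiltedMean ν g s (h t) - m =
      (∫ a, (s * ((g a - 1) * (h 0 a - m)) + tilt g s a * (h t a - h 0 a)) ∂ν) /
        ∫ a, tilt g s a ∂ν := by
    rw [← e1, tiltedMean]
    have : (∫ a, tilt g s a ∂ν) ≠ 0 := by linarith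
    field_simp
  have e3 : |∫ a, (s * ((g a - 1) * (h 0 a - m)) + tilt g s a * (h t a - h 0 a)) ∂ν| ≤
      (1 + C) * (s * ∫ a, |h 0 a - m| ∂ν + t * L) := by
    have i2 : Integrable (fun a => s * |h 0 a - m|) ν := hc.abs.const_mul s
    calc _ ≤ ∫ a, (1 + C) * (s * |h 0 a - m| + t * L) ∂ν := by
          rw [← Real.norm_eq_abs]
          refine norm_integral_le_of_norm_le ((i2.add (integrable_const _)).const_mul _) ?_
          filter_upwards [hlip] with a ha
          have b1 := hg.abs_sub_one_le a
          have b2 := hg.tilt_le hs a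
          have b3 := hg.tilt_nonneg hs a
          calc _ ≤ |s * ((g a - 1) * (h 0 a - m))| + |tilt g s a * (h t a - h 0 a)| :=
                abs_add_le _ _
            _ = s * (|g a - 1| * |h 0 a - m|) + tilt g s a * |h t a - h 0 a| := by
                rw [abs_mul, abs_mul, abs_mul, abs_of_nonneg hs.1, abs_of_nonneg b3]
            _ ≤ s * ((1 + C) * |h 0 a - m|) + (1 + C) * (t * L) := by
                gcongr
                · exact hs.1
                · exact ha t ht
            _ = _ := by ring
      _ = _ := by
          rw [integral_const_mul, integral_add i2 (integrable_const _), integral_const_mul]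
          simp
  rw [e2, abs_div, abs_of_pos (show 0 < ∫ a, tilt g s a ∂ν by linarith),
    div_le_iff₀ (by linarith)]
  refine e3.trans ?_
  have hn : 0 ≤ (1 + C) * (s * ∫ a, |h 0 a - m| ∂ν + t * L) := by
    have : 0 ≤ ∫ a, |h 0 a - m| ∂ν := integral_nonneg fun a => abs_nonneg _
    have := hs.1; have := ht.1
    positivity
  nlinarith [mul_le_mul_of_nonneg_left hD hn]

/-- Quotient rule. The factors `c` and `b` switch the contamination of the law and of the integrand
on separately, and the two effects add. -/
lemma hasDerivWithinAt_tiltedMean (hg : HasBoundedDensity ν ν' g C) (hτ₀ : 0 < τ₀)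
    (hτ₀' : τ₀ ≤ 1 / 2) (hC : 0 ≤ C)
    (hm : ∀ t ∈ Icc 0 τ₀, AEStronglyMeasurable (h t) ν)
    (h0 : Integrable (h 0) ν) (hL : 0 ≤ L)
    (hlip : ∀ᵐ a ∂ν, ∀ t ∈ Icc 0 τ₀, |h t a - h 0 a| ≤ t * L)
    {c b : ℝ} (hc : c ∈ Icc (0 : ℝ) 1) (hb : b ∈ Icc (0 : ℝ) 1) {k : α → ℝ} (hk : Integrable k ν)
    (hderiv : ∀ᵐ a ∂ν, HasDerivWithinAt (fun τ => h (b * τ) a) (b * k a) (Ici 0) 0) :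
    HasDerivWithinAt (fun τ => tiltedMean ν g (c * τ) (h (b * τ)))
      (c * ∫ a, g a * (h 0 a - ∫ a', h 0 a' ∂ν) ∂ν + b * ∫ a, k a ∂ν) (Ici 0) 0 := by
  have hscale : ∀ {d τ : ℝ}, d ∈ Icc (0 : ℝ) 1 → τ ∈ Icc 0 τ₀ → d * τ ∈ Icc 0 τ₀ := fun hd hτ =>
    ⟨mul_nonneg hd.1 hτ.1, (mul_le_of_le_one_left hτ.1 hd.2).trans hτ.2⟩
  have hhalf : ∀ {τ : ℝ}, τ ∈ Icc 0 τ₀ → τ ∈ Icc (0 : ℝ) (1 / 2) := fun hτ =>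
    ⟨hτ.1, hτ.2.trans hτ₀'⟩
  have hgm : Integrable (fun a => (g a - 1) * h 0 a) ν :=
    h0.bdd_mul (c := 1 + C) (hg.measurable.sub_const 1).aestronglyMeasurable
      (ae_of_all _ hg.abs_sub_one_le)
  have hnum : HasDerivWithinAt (fun τ => ∫ a, tilt g (c * τ) a * h (b * τ) a ∂ν)
      (∫ a, (c * ((g a - 1) * h 0 a) + b * k a) ∂ν) (Ici 0) 0 := by
    refine hasDerivWithinAt_integral (τ₀ := τ₀) (f := fun τ a => tilt g (c * τ) a * h (b * τ) a)
      (bound := fun a => (1 + C) * (|h 0 a| + L)) hτ₀ ?_ ?_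
      ((h0.abs.add (integrable_const L)).const_mul _) ?_ ?_
    · intro τ hτ
      exact (hg.measurable_tilt _).aestronglyMeasurable.mul (hm _ (hscale hb hτ))
    · simpa [tilt_zero] using h0
    · filter_upwards [hlip] with a ha τ hτ
      have hcτ := hscale hc hτ
      have hbτ := hscale hb hτ
      have b1 := hg.abs_sub_one_le a
      have b2 := hg.tilt_le (hhalf hcτ) a
      have b3 := hg.tilt_nonneg (hhalf hcτ) a
      have b4 : b * τ * L ≤ τ * L :=
        mul_le_mul_of_nonneg_right (mul_le_of_le_one_left hτ.1 hb.2) hL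
      have b5 : c * τ ≤ τ := mul_le_of_le_one_left hτ.1 hc.2
      have e : tilt g (c * τ) a * h (b * τ) a - tilt g (c * 0) a * h (b * 0) a =
          c * τ * ((g a - 1) * h 0 a) + tilt g (c * τ) a * (h (b * τ) a - h 0 a) := by
        simp only [mul_zero, tilt]; ring
      rw [e]
      calc _ ≤ |c * τ * ((g a - 1) * h 0 a)| + |tilt g (c * τ) a * (h (b * τ) a - h 0 a)| :=
            abs_add_le _ _
        _ = c * τ * (|g a - 1| * |h 0 a|) + tilt g (c * τ) a * |h (b * τ) a - h 0 a| := by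
            rw [abs_mul, abs_mul (g a - 1), abs_mul (tilt g (c * τ) a), abs_of_nonneg hcτ.1,
              abs_of_nonneg b3]
        _ ≤ τ * ((1 + C) * |h 0 a|) + (1 + C) * (τ * L) := by
            gcongr
            · exact hτ.1
            · exact (ha _ hbτ).trans b4
        _ = _ := by ring
    · filter_upwards [hderiv] with a ha
      have h1 : HasDerivWithinAt (fun τ : ℝ => tilt g (c * τ) a) (c * (g a - 1)) (Ici 0) 0 := by
        have : HasDerivAt (fun τ : ℝ => tilt g (c * τ) a) (c * (g a - 1)) 0 := by
          simpa [tilt] using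
            (((hasDerivAt_id (0 : ℝ)).const_mul c).mul_const (g a - 1)).const_add 1
        exact this.hasDerivWithinAt
      refine (h1.mul ha).congr_deriv ?_
      simp [tilt_zero]; ring
  have hden : HasDerivWithinAt (fun τ => ∫ a, tilt g (c * τ) a ∂ν) (c * (∫ a, g a ∂ν - 1))
      (Ici 0) 0 := by
    simp_rw [integral_tilt hg]
    have : HasDerivAt (fun τ : ℝ => 1 + c * τ * (∫ a, g a ∂ν - 1)) (c * (∫ a, g a ∂ν - 1)) 0 := by
      simpa using (((hasDerivAt_id (0 : ℝ)).const_mul c).mul_const (∫ a, g a ∂ν - 1)).const_add 1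
    exact this.hasDerivWithinAt
  have hne : ∫ a, tilt g (c * 0) a ∂ν ≠ 0 := by simp [tilt_zero]
  refine (hnum.div hden hne).congr_deriv ?_
  have e1 : ∫ a, (c * ((g a - 1) * h 0 a) + b * k a) ∂ν =
      c * (∫ a, g a * h 0 a ∂ν - ∫ a, h 0 a ∂ν) + b * ∫ a, k a ∂ν := by
    rw [integral_add (hgm.const_mul c) (hk.const_mul b), integral_const_mul, integral_const_mul,
      ← integral_sub (hg.integrable_mul h0) h0]
    congr 3
    funext a; ring
  have e2 : ∫ a, g a * (h 0 a - ∫ a', h 0 a' ∂ν) ∂ν =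
      ∫ a, g a * h 0 a ∂ν - (∫ a, g a ∂ν) * ∫ a, h 0 a ∂ν := by
    simp_rw [mul_sub]
    rw [integral_sub (hg.integrable_mul h0) (hg.integrable_density.mul_const _), integral_mul_const]
  rw [e1, e2]
  simp [tilt_zero]
  ring

end TiltedMean

end DDC

namespace DDC

/-! ### Conditioning on a choice. -/

section CondChoice

variable {K : ℕ} {X : Type*} [MeasurableSpace X]

lemma measurableSet_choice (j : Fin (K + 1)) : MeasurableSet {z : Obs K X | z.1 = j} :=
  measurable_fst (measurableSet_singleton j)

lemma setIntegral_choice (F : Measure (Obs K X)) (j : Fin (K + 1)) (φ : Obs K X → ℝ) :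
    ∫ z in {z | z.1 = j}, φ z ∂F = ∫ z, ind z j * φ z ∂F := by
  rw [← integral_indicator (measurableSet_choice j)]
  refine integral_congr_ae (ae_of_all _ fun z => ?_)
  by_cases hz : z.1 = j
  · simp [ind_eq, hz]
  · simp [ind_eq, hz]

lemma measureReal_choice (F : Measure (Obs K X)) (j : Fin (K + 1)) :
    F.real {z | z.1 = j} = ∫ z, ind z j ∂F := by
  have := setIntegral_choice F j fun _ => 1
  simpa using this

lemma integral_cond_choice (F : Measure (Obs K X)) (j : Fin (K + 1)) (φ : Obs K X → ℝ) :
    ∫ z, φ z ∂(cond F {z | z.1 = j}) = (F.real {z | z.1 = j})⁻¹ * ∫ z, ind z j * φ z ∂F := by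
  rw [ProbabilityTheory.cond, integral_smul_measure, setIntegral_choice, ENNReal.toReal_inv, smul_eq_mul]
  rfl

/-- Conditioning on `y = j` again yields a law with a density with respect to `F₀`, so
`condMean_state` covers the conditional expectations given a choice as well. -/
lemma cond_choice_withDensity {F₀ : Measure (Obs K X)} {ρ : Obs K X → ℝ} (hρ : Measurable ρ)
    {F : Measure (Obs K X)} [IsFiniteMeasure F]
    (hF : F = F₀.withDensity fun z => ((ρ z).toNNReal : ℝ≥0∞)) (j : Fin (K + 1))
    (hpos : 0 < F.real {z | z.1 = j}) :
    cond F {z | z.1 = j} = F₀.withDensity fun z =>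
      (((F.real {z | z.1 = j})⁻¹ * (ind z j * ρ z)).toNNReal : ℝ≥0∞) := by
  have hne : F {z | z.1 = j} ≠ 0 := fun h0 => by
    rw [Measure.real, h0] at hpos; simp at hpos
  have hinv : (F {z | z.1 = j})⁻¹ = ENNReal.ofReal (F.real {z | z.1 = j})⁻¹ := by
    rw [ENNReal.ofReal_inv_of_pos hpos, ofReal_measureReal]
  have hr : F.restrict {z | z.1 = j} =
      F₀.withDensity ({z | z.1 = j}.indicator fun z => ((ρ z).toNNReal : ℝ≥0∞)) := by
    rw [withDensity_indicator (measurableSet_choice j), hF,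
      restrict_withDensity (measurableSet_choice j)]
  rw [ProbabilityTheory.cond, hinv, hr, ← withDensity_smul _
    (hρ.real_toNNReal.coe_nnreal_ennreal.indicator (measurableSet_choice j))]
  congr 1
  funext z
  rw [Pi.smul_apply, smul_eq_mul]
  by_cases hz : z.1 = j
  · rw [indicator_of_mem (show z ∈ {z : Obs K X | z.1 = j} from hz), ind_eq, if_pos hz, one_mul,
      Real.toNNReal_mul (inv_nonneg.2 hpos.le), ENNReal.coe_mul]
    rfl
  · rw [indicator_of_notMem (show z ∉ {z : Obs K X | z.1 = j} from hz), ind_eq, if_neg hz]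
    simp

end CondChoice

/-! ### First steps along the path, with a switch for each component. -/

/-- Which components of the first steps move along the path (`1`) or stay at the truth (`0`). -/
structure Selection (K : ℕ) where
  ccp : ℝ
  cont : Fin K → ℝ
  renew : ℝ

/-- Only `0` and `1` are needed, but the arguments use just this: scaling `τ` by a switch does not
leave an initial interval. -/
structure Selection.Valid {K : ℕ} (σ : Selection K) : Prop where
  ccp : σ.ccp ∈ Icc (0 : ℝ) 1
  cont : ∀ j, σ.cont j ∈ Icc (0 : ℝ) 1
  renew : σ.renew ∈ Icc (0 : ℝ) 1

section Path

variable {K r : ℕ} {X Θ : Type*} [MeasurableSpace X] (M : Model K X Θ) (β : Θ) (v : X → ℝ)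
  (g : Obs K X → ℝ) (F₀ : Measure (Obs K X))

/-- The conditional expectation given the non-renewal choice `j` under the law contaminated by
`s`, at the choice probabilities under the law contaminated by `t`. -/
noncomputable def pathCont (s t : ℝ) (j : Fin K) (x : X) : ℝ :=
  tiltedMean (M.trans j.succ x) (fun w => g (j.succ, x, w)) s (pathNext M β v g t)

/-- The expectation given the renewal choice under the law contaminated by `s`, at the choice
probabilities under the law contaminated by `t`. -/
noncomputable def pathRenew (s t : ℝ) : ℝ :=
  tiltedMean (cond F₀ {z | z.1 = 0}) g s fun z => pathNext M β v g t z.2.2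

/-- The first steps along the path, with components moving as `σ` says. -/
noncomputable def pathFirst (σ : Selection K) (τ : ℝ) : FirstStep K X Θ where
  ccp := pathProb M β v g (σ.ccp * τ)
  cont j _ _ x := pathCont M β v g (σ.cont j * τ) (σ.ccp * τ) j x
  renew _ _ := pathRenew M β v g F₀ (σ.renew * τ) (σ.ccp * τ)

/-- Effect on the conditional expectation given choice `j` of contaminating the law of `w`. -/
noncomputable def contDir (j : Fin K) (x : X) : ℝ :=
  ∫ w, g (j.succ, x, w) * (pathNext M β v g 0 w - ∫ w', pathNext M β v g 0 w' ∂(M.trans j.succ x))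
    ∂(M.trans j.succ x)

/-- Effect on the conditional expectation given choice `j` of contaminating `γ₁`. -/
noncomputable def contNextDir (j : Fin K) (x : X) : ℝ :=
  ∫ w, surplusDir M β v g w ∂(M.trans j.succ x)

/-- The counterpart of `contDir` for the renewal choice, a single number because this first step
does not condition on the state. -/
noncomputable def renewDir : ℝ :=
  ∫ z, g z * (pathNext M β v g 0 z.2.2 -
    ∫ z', pathNext M β v g 0 z'.2.2 ∂(cond F₀ {z | z.1 = 0})) ∂(cond F₀ {z | z.1 = 0})

noncomputable def renewNextDir : ℝ :=
  ∫ z, surplusDir M β v g z.2.2 ∂(cond F₀ {z | z.1 = 0})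

/-- The derivative of `ṽ` along the path. -/
noncomputable def valueDir (σ : Selection K) (x : X) (j : Fin K) : ℝ :=
  M.δ * (σ.cont j * contDir M β v g j x + σ.ccp * contNextDir M β v g j x -
    (σ.renew * renewDir M β v g F₀ + σ.ccp * renewNextDir M β v g F₀))

end Path

namespace Contamination

variable {K r : ℕ} {X Θ : Type*} [MeasurableSpace X] {M : Model K X Θ}
  {A : X → Matrix (Fin r) (Fin (K + 1)) ℝ} {β : Θ} {v : X → ℝ} {μ : Measure X}
  [IsProbabilityMeasure μ] {F₀ G : Measure (Obs K X)} [IsProbabilityMeasure F₀]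
  {g : Obs K X → ℝ} {C : ℝ}

lemma density_slice (h : Contamination M A β v μ F₀ G g C) (j : Fin (K + 1)) (x : X) :
    HasBoundedDensity (M.trans j x)
      ((M.trans j x).withDensity fun w => ((g (j, x, w)).toNNReal : ℝ≥0∞))
      (fun w => g (j, x, w)) C :=
  ⟨h.density.measurable.comp (by fun_prop), fun _ => h.density.nonneg _,
    fun _ => h.density.le _, rfl⟩

lemma density_renew (h : Contamination M A β v μ F₀ G g C) :
    HasBoundedDensity (cond F₀ {z | z.1 = 0})
      ((cond F₀ {z | z.1 = 0}).withDensity fun z => ((g z).toNNReal : ℝ≥0∞)) g C :=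
  ⟨h.density.measurable, h.density.nonneg, h.density.le, rfl⟩

lemma integral_ind (h : Contamination M A β v μ F₀ G g C) (j : Fin (K + 1)) :
    ∫ z, ind z j ∂F₀ = ∫ x, M.trueProb β v x j ∂μ := by
  have := h.law.integral_ind_mul (integrable_const (1 : ℝ)) j
  simpa using this

lemma integrable_trueProb (h : Contamination M A β v μ F₀ G g C) (j : Fin (K + 1)) :
    Integrable (fun x => M.trueProb β v x j) μ :=
  Integrable.of_bound (h.law.measurable_p j).aestronglyMeasurable 1 (ae_of_all _ fun x => by
    rw [Real.norm_of_nonneg (h.law.pos x j).le]; exact h.law.p_le_one x j)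

lemma measureReal_choice_pos (h : Contamination M A β v μ F₀ G g C) (j : Fin (K + 1)) :
    0 < F₀.real {z | z.1 = j} := by
  rw [measureReal_choice, h.integral_ind]
  rw [integral_pos_iff_support_of_nonneg (fun x => (h.law.pos x j).le) (h.integrable_trueProb j)]
  have : Function.support (fun x => M.trueProb β v x j) = univ :=
    eq_univ_of_forall fun x => (h.law.pos x j).ne'
  rw [this, measure_univ]
  exact one_pos

lemma isProbabilityMeasure_cond (h : Contamination M A β v μ F₀ G g C) (j : Fin (K + 1)) :
    IsProbabilityMeasure (cond F₀ {z | z.1 = j}) := by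
  refine cond_isProbabilityMeasure fun h0 => ?_
  have := h.measureReal_choice_pos j
  rw [Measure.real, h0] at this
  simp at this

lemma integrable_ind (j : Fin (K + 1)) : Integrable (fun z : Obs K X => ind z j) F₀ :=
  Integrable.of_bound (measurable_ind j).aestronglyMeasurable 1
    (ae_of_all _ fun z => abs_ind_le_one z j)

lemma measureReal_choice_mix_pos [IsFiniteMeasure G] (h : Contamination M A β v μ F₀ G g C)
    {s : ℝ} (hs : s ∈ Icc (0 : ℝ) (1 / 2)) (j : Fin (K + 1)) :
    0 < (mix F₀ G s).real {z | z.1 = j} := by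
  have h0 := h.measureReal_choice_pos j
  rw [measureReal_choice] at h0 ⊢
  rw [integral_mix h.density hs]
  have h1 := integral_mono ((integrable_ind (F₀ := F₀) j).const_mul (1 / 2))
    (integrable_tilt_mul h.density hs (integrable_ind j))
    fun z => mul_le_mul_of_nonneg_right (h.density.half_le_tilt hs z) (ind_nonneg z j)
  rw [integral_const_mul] at h1
  linarith

lemma pathCont_eq (h : Contamination M A β v μ F₀ G g C) (s t : ℝ) (j : Fin K) (x : X) :
    pathCont M β v g s t j x = (∫ w, tilt g s (j.succ, x, w) * pathNext M β v g t w
      ∂(M.trans j.succ x)) / tiltMean M g s j.succ x := by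
  rw [← h.integral_tilt_slice]; rfl

/-- `γ₁` is determined only up to `μ`-null sets; evaluating it at the next state is legitimate
because the next state has law `μ`. -/
lemma nextTerm_ae (h : Contamination M A β v μ F₀ G g C) {t : ℝ} {γ₁ : X → Fin (K + 1) → ℝ}
    (hγ : γ₁ =ᵐ[μ] pathProb M β v g t) :
    M.nextTerm β γ₁ =ᵐ[F₀] fun z => pathNext M β v g t z.2.2 := by
  filter_upwards [h.law.ae_next hγ] with z hz
  rw [Model.nextTerm, pathNext, hz]

lemma exists_pathNext_integrable (h : Contamination M A β v μ F₀ G g C) :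
    ∃ τ₀ : ℝ, 0 < τ₀ ∧ τ₀ ≤ 1 / 2 ∧ ∀ t ∈ Icc 0 τ₀, Integrable (pathNext M β v g t) μ := by
  obtain ⟨L, τ₀, -, hτ₀, hτ₀', hlip, -⟩ := h.exists_pathNext_lipschitz
  exact ⟨τ₀, hτ₀, hτ₀', fun t ht => integrable_path (h := fun t => pathNext M β v g t)
    (fun t ht => (h.measurable_pathNext ⟨ht.1, ht.2.trans hτ₀'⟩).aestronglyMeasurable)
    h.integrable_pathNext_zero hlip ht⟩

section Agreement

variable [IsFiniteMeasure G] {s t : ℝ}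

/-- Bayes' formula: the mass of choice `j` under the contaminated law is `p_j` times the mean
density of its slice, and the total over choices normalizes. -/
lemma firstStep_ccp_ae (h : Contamination M A β v μ F₀ G g C) (hs : s ∈ Icc (0 : ℝ) (1 / 2)) :
    (M.firstStep (mix F₀ G s)).ccp =ᵐ[μ] pathProb M β v g s := by
  have key : ∀ j, condMean (mix F₀ G s) (fun z => ind z j) (fun z => z.2.1) =ᵐ[μ]
      fun x => pathProb M β v g s x j := by
    intro j
    have hT : ∀ x, ∑ k, M.trueProb β v x k * ∫ w, tilt g s (k, x, w) ∂(M.trans k x) =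
        tiltTotal M β v g s x := fun x => by
      simp_rw [h.integral_tilt_slice]; exact h.sum_mul_tiltMean s x
    refine (h.law.condMean_state (h.density.measurable_tilt s) (h.density.tilt_nonneg hs)
      (h.density.tilt_le hs) (h.density.mix_eq hs) (fun x => ?_) (measurable_ind j)
      (integrable_ind j)).trans (ae_of_all _ fun x => ?_)
    · rw [hT]; linarith [h.half_le_tiltTotal hs x]
    · simp only
      rw [hT, Finset.sum_eq_single j, pathProb, ← h.integral_tilt_slice]
      · simp [ind_eq]
      · intro k _ hk
        simp [ind_eq, hk]
      · simp
  filter_upwards [ae_all_iff.2 key] with x hx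
  funext j
  exact hx j

/-- Only the slice `y = j` carries mass; the choice probability and the normalizing constant cancel
in the ratio, leaving a tilted mean under the kernel of `j`. -/
lemma firstStep_cont_ae (h : Contamination M A β v μ F₀ G g C) (hs : s ∈ Icc (0 : ℝ) (1 / 2))
    (ht : t ∈ Icc (0 : ℝ) (1 / 2)) (hti : Integrable (pathNext M β v g t) μ)
    {γ₁ : X → Fin (K + 1) → ℝ} (hγ : γ₁ =ᵐ[μ] pathProb M β v g t) (j : Fin K) :
    (M.firstStep (mix F₀ G s)).cont j β γ₁ =ᵐ[μ] pathCont M β v g s t j := by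
  have hpos := h.measureReal_choice_mix_pos hs j.succ
  set c := (mix F₀ G s).real {z | z.1 = j.succ} with hc
  have hnext : M.nextTerm β γ₁ =ᵐ[cond (mix F₀ G s) {z | z.1 = j.succ}]
      fun z => pathNext M β v g t z.2.2 :=
    cond_absolutelyContinuous (ae_mix_of_ae h.density hs (h.nextTerm_ae hγ))
  change condMean (cond (mix F₀ G s) {z | z.1 = j.succ}) (M.nextTerm β γ₁) (fun z => z.2.1) =ᵐ[μ] _
  rw [condMean_congr_fun hnext]
  have hnum : ∀ (φ : Obs K X → ℝ) x, ∑ k, M.trueProb β v x k *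
      ∫ w, c⁻¹ * (ind ((k, x, w) : Obs K X) j.succ * tilt g s (k, x, w)) * φ (k, x, w)
        ∂(M.trans k x) = M.trueProb β v x j.succ * (c⁻¹ *
          ∫ w, tilt g s (j.succ, x, w) * φ (j.succ, x, w) ∂(M.trans j.succ x)) := by
    intro φ x
    rw [Finset.sum_eq_single j.succ]
    · congr 1
      rw [← integral_const_mul]
      refine integral_congr_ae (ae_of_all _ fun w => ?_)
      simp [ind_eq, mul_assoc]
    · intro k _ hk
      simp [ind_eq, hk]
    · simp
  have hden : ∀ x, ∑ k, M.trueProb β v x k *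
      ∫ w, c⁻¹ * (ind ((k, x, w) : Obs K X) j.succ * tilt g s (k, x, w)) ∂(M.trans k x) =
        M.trueProb β v x j.succ * (c⁻¹ * tiltMean M g s j.succ x) := by
    intro x
    have := hnum (fun _ => 1) x
    simpa [h.integral_tilt_slice] using this
  have hρm : Measurable fun z : Obs K X => c⁻¹ * (ind z j.succ * tilt g s z) :=
    ((measurable_ind j.succ).mul (h.density.measurable_tilt s)).const_mul _
  refine (h.law.condMean_state (ρ := fun z => c⁻¹ * (ind z j.succ * tilt g s z))
    (φ := fun z => pathNext M β v g t z.2.2) hρm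
    (fun z => mul_nonneg (inv_nonneg.2 hpos.le) (mul_nonneg (ind_nonneg z _)
      (h.density.tilt_nonneg hs z))) (c := c⁻¹ * (1 * (1 + C)))
    (fun z => mul_le_mul_of_nonneg_left (mul_le_mul (ind_le_one z _) (h.density.tilt_le hs z)
      (h.density.tilt_nonneg hs z) zero_le_one) (inv_nonneg.2 hpos.le))
    (cond_choice_withDensity (h.density.measurable_tilt s) (h.density.mix_eq hs) j.succ hpos)
    (fun x => ?_) ((h.measurable_pathNext ht).comp (by fun_prop))
    (h.law.integrable_next hti)).trans (ae_of_all _ fun x => ?_)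
  · rw [hden]
    have h1 := h.law.pos x j.succ
    have h2 : 0 < tiltMean M g s j.succ x := by linarith [h.half_le_tiltMean hs j.succ x]
    positivity
  · simp only
    rw [hden, hnum fun z => pathNext M β v g t z.2.2, h.pathCont_eq]
    have h1 := (h.law.pos x j.succ).ne'
    have h2 : tiltMean M g s j.succ x ≠ 0 := by linarith [h.half_le_tiltMean hs j.succ x]
    have h3 := hpos.ne'
    field_simp

lemma firstStep_renew_eq (h : Contamination M A β v μ F₀ G g C) (hs : s ∈ Icc (0 : ℝ) (1 / 2))
    {γ₁ : X → Fin (K + 1) → ℝ} (hγ : γ₁ =ᵐ[μ] pathProb M β v g t) :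
    (M.firstStep (mix F₀ G s)).renew β γ₁ = pathRenew M β v g F₀ s t := by
  have h0 := (h.measureReal_choice_pos 0).ne'
  change ∫ z, M.nextTerm β γ₁ z ∂(cond (mix F₀ G s) {z | z.1 = 0}) = _
  rw [pathRenew, tiltedMean, integral_cond_choice, integral_cond_choice, integral_cond_choice,
    measureReal_choice (mix F₀ G s), integral_mix h.density hs, integral_mix h.density hs]
  have e1 : ∫ z, tilt g s z * (ind z 0 * M.nextTerm β γ₁ z) ∂F₀ =
      ∫ z, ind z 0 * (tilt g s z * pathNext M β v g t z.2.2) ∂F₀ := by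
    refine integral_congr_ae ?_
    filter_upwards [h.nextTerm_ae hγ] with z hz
    rw [hz]; ring
  have e2 : ∫ z, tilt g s z * ind z 0 ∂F₀ = ∫ z, ind z 0 * tilt g s z ∂F₀ := by
    simp_rw [mul_comm]
  rw [e1, e2]
  rw [mul_div_mul_left _ _ (inv_ne_zero h0), div_eq_inv_mul]

end Agreement

section Lipschitz

lemma pathCont_zero (j : Fin K) (x : X) :
    pathCont M β v g 0 0 j x = ∫ w, pathNext M β v g 0 w ∂(M.trans j.succ x) :=
  tiltedMean_zero _

lemma pathRenew_zero (h : Contamination M A β v μ F₀ G g C) :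
    pathRenew M β v g F₀ 0 0 = ∫ z, pathNext M β v g 0 z.2.2 ∂(cond F₀ {z | z.1 = 0}) := by
  have := h.isProbabilityMeasure_cond 0
  exact tiltedMean_zero _

/-- After the renewal choice the law of the next state is the same from every state, so averaging
over states changes nothing. -/
lemma integral_cond_renew (h : Contamination M A β v μ F₀ G g C) {f : X → ℝ} (hf : Integrable f μ)
    (x₀ : X) : ∫ z, f z.2.2 ∂(cond F₀ {z | z.1 = 0}) = ∫ w, f w ∂(M.trans 0 x₀) := by
  rw [integral_cond_choice, h.law.integral_ind_mul (h.law.integrable_next hf)]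
  simp_rw [M.renewal _ x₀]
  rw [integral_mul_const, measureReal_choice, h.integral_ind]
  have h0 := h.measureReal_choice_pos 0
  rw [measureReal_choice, h.integral_ind] at h0
  field_simp

/-- The constant of `pathNext_zero` is common to both continuation terms and drops out of their
difference. -/
lemma vTilde_pathFirst_zero (h : Contamination M A β v μ F₀ G g C) (σ : Selection K) (x : X) :
    M.vTilde β (pathFirst M β v g F₀ σ 0) x = M.valueDiff β v x := by
  funext j
  have h1 : ∀ j, ∫ w, pathNext M β v g 0 w ∂(M.trans j x) =
      ∫ w, v w ∂(M.trans j x) - M.δ * ∫ w, v w ∂(M.trans 0 x) := fun j => by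
    simp_rw [h.pathNext_zero x]
    rw [integral_sub (h.value.integrable j x) (integrable_const _)]
    simp
  unfold Model.vTilde Model.valueDiff Model.condValue
  simp only [pathFirst, mul_zero]
  rw [pathCont_zero, h.pathRenew_zero, h.integral_cond_renew h.integrable_pathNext_zero x, h1, h1]
  ring

lemma measurable_pathCont (h : Contamination M A β v μ F₀ G g C) (s : ℝ) {t : ℝ}
    (ht : t ∈ Icc (0 : ℝ) (1 / 2)) (j : Fin K) : Measurable (pathCont M β v g s t j) := by
  have h1 : Measurable fun z : Obs K X => pathNext M β v g t z.2.2 :=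
    (h.measurable_pathNext ht).comp (by fun_prop)
  exact (measurable_slice ((h.density.measurable_tilt s).mul h1) j.succ).div
    (measurable_slice (h.density.measurable_tilt s) j.succ)

lemma measurable_vTilde (h : Contamination M A β v μ F₀ G g C) {σ : Selection K} (hσ : σ.Valid)
    {τ : ℝ} (hτ : τ ∈ Icc (0 : ℝ) (1 / 2)) :
    Measurable (M.vTilde β (pathFirst M β v g F₀ σ τ)) :=
  measurable_pi_lambda _ fun j => ((M.measurable_u _ _).sub (M.measurable_u _ _)).add
    (((h.measurable_pathCont _ ⟨mul_nonneg hσ.ccp.1 hτ.1,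
      (mul_le_of_le_one_left hτ.1 hσ.ccp.2).trans hτ.2⟩ j).sub_const _).const_mul _)

/-- Along the path the conditional expectations and `ṽ` are Lipschitz at the truth, uniformly in
the state. -/
lemma exists_path_lipschitz (h : Contamination M A β v μ F₀ G g C) :
    ∃ L τ₀ : ℝ, 0 ≤ L ∧ 0 < τ₀ ∧ τ₀ ≤ 1 / 2 ∧
      (∀ᵐ x ∂μ, ∀ s ∈ Icc 0 τ₀, ∀ t ∈ Icc 0 τ₀, ∀ j,
        |pathCont M β v g s t j x - pathCont M β v g 0 0 j x| ≤ L * (s + t)) ∧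
      (∀ s ∈ Icc 0 τ₀, ∀ t ∈ Icc 0 τ₀,
        |pathRenew M β v g F₀ s t - pathRenew M β v g F₀ 0 0| ≤ L * (s + t)) := by
  obtain ⟨L, τ₀, hL, hτ₀, hτ₀', hlip, -⟩ := h.exists_pathNext_lipschitz
  obtain ⟨D, hD⟩ := h.regular.deviation
  have hC := h.nonneg
  have hprob := h.isProbabilityMeasure_cond 0
  have hmeas : ∀ t ∈ Icc 0 τ₀, Measurable (pathNext M β v g t) := fun t ht =>
    h.measurable_pathNext ⟨ht.1, ht.2.trans hτ₀'⟩
  have habs : Integrable (fun z : Obs K X => pathNext M β v g 0 z.2.2) (cond F₀ {z | z.1 = 0}) :=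
    ((h.law.integrable_next h.integrable_pathNext_zero).restrict).smul_measure
      (ENNReal.inv_ne_top.2 fun h0 => by
        have := h.measureReal_choice_pos 0
        rw [Measure.real, h0] at this
        simp at this)
  set R := ∫ z, |pathNext M β v g 0 z.2.2 -
    ∫ z', pathNext M β v g 0 z'.2.2 ∂(cond F₀ {z | z.1 = 0})| ∂(cond F₀ {z | z.1 = 0})
  have hR : 0 ≤ R := integral_nonneg fun _ => abs_nonneg _
  -- `D` bounds the deviations given a non-renewal choice uniformly in the state; `R` is the single
  -- deviation given the renewal choice and needs no hypothesis beyond integrability.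
  refine ⟨2 * (1 + C) * (|D| + R + L), τ₀, by positivity, hτ₀, hτ₀', ?_, ?_⟩
  · filter_upwards [h.law.ae_next_slice hlip, hD] with x hx hDx s hs t ht j
    have h1 := abs_tiltedMean_sub_le (h.density_slice j.succ x) hC
      (h := fun t => pathNext M β v g t) (fun t ht => (hmeas t ht).aestronglyMeasurable)
      (h.integrable_pathNext_zero_slice j.succ x) hL (hx j.succ) ⟨hs.1, hs.2.trans hτ₀'⟩ ht
    rw [pathCont_zero]
    refine h1.trans ?_
    -- `pathNext` at the truth differs from `v` by a constant, which does not affect deviations from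
    -- the mean.
    have h2 : ∫ w, |pathNext M β v g 0 w - ∫ w', pathNext M β v g 0 w' ∂(M.trans j.succ x)|
        ∂(M.trans j.succ x) ≤ D := by
      refine le_trans (le_of_eq ?_) (hDx j.succ)
      simp_rw [h.pathNext_zero x]
      rw [integral_sub (h.value.integrable j.succ x) (integrable_const _)]
      simp
    rw [mul_assoc (2 * (1 + C))]
    refine mul_le_mul_of_nonneg_left ?_ (by positivity)
    have h3 := mul_le_mul_of_nonneg_left (h2.trans (le_abs_self D)) hs.1
    nlinarith [mul_nonneg ht.1 (abs_nonneg D), mul_nonneg hs.1 hR, mul_nonneg ht.1 hR,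
      mul_nonneg hs.1 hL]
  · intro s hs t ht
    have h1 := abs_tiltedMean_sub_le h.density_renew hC
      (h := fun t (z : Obs K X) => pathNext M β v g t z.2.2)
      (fun t ht => ((hmeas t ht).comp (by fun_prop)).aestronglyMeasurable) habs hL
      (cond_absolutelyContinuous (h.law.ae_next hlip)) ⟨hs.1, hs.2.trans hτ₀'⟩ ht
    rw [h.pathRenew_zero]
    refine h1.trans ?_
    rw [mul_assoc (2 * (1 + C))]
    refine mul_le_mul_of_nonneg_left ?_ (by positivity)
    nlinarith [mul_nonneg ht.1 (abs_nonneg D), mul_nonneg hs.1 (abs_nonneg D), mul_nonneg ht.1 hR,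
      mul_nonneg hs.1 hL]

/-- The derivative holds for almost every state: those from which the kernels respect the Lipschitz
and derivative bounds on `H`. -/
lemma hasDerivWithinAt_path (h : Contamination M A β v μ F₀ G g C) {σ : Selection K}
    (hσ : σ.Valid) :
    (∀ᵐ x ∂μ, HasDerivWithinAt (fun τ => M.vTilde β (pathFirst M β v g F₀ σ τ) x)
      (valueDir M β v g F₀ σ x) (Ici 0) 0) := by
  obtain ⟨L, τ₀, hL, hτ₀, hτ₀', hlip, hdir⟩ := h.exists_pathNext_lipschitz
  have hC := h.nonneg
  have hprob := h.isProbabilityMeasure_cond 0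
  have hmeas : ∀ t ∈ Icc 0 τ₀, Measurable (pathNext M β v g t) := fun t ht =>
    h.measurable_pathNext ⟨ht.1, ht.2.trans hτ₀'⟩
  have hne : (F₀ {z | z.1 = 0})⁻¹ ≠ ∞ := ENNReal.inv_ne_top.2 fun h0 => by
    have := h.measureReal_choice_pos 0
    rw [Measure.real, h0] at this
    simp at this
  have habs : Integrable (fun z : Obs K X => pathNext M β v g 0 z.2.2) (cond F₀ {z | z.1 = 0}) :=
    ((h.law.integrable_next h.integrable_pathNext_zero).restrict).smul_measure hne
  have hren : HasDerivWithinAt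
      (fun τ => pathRenew M β v g F₀ (σ.renew * τ) (σ.ccp * τ))
      (σ.renew * renewDir M β v g F₀ + σ.ccp * renewNextDir M β v g F₀) (Ici 0) 0 :=
    hasDerivWithinAt_tiltedMean h.density_renew hτ₀ hτ₀' hC
      (h := fun t (z : Obs K X) => pathNext M β v g t z.2.2)
      (fun t ht => ((hmeas t ht).comp (by fun_prop)).aestronglyMeasurable) habs hL
      (cond_absolutelyContinuous (h.law.ae_next hlip)) hσ.renew hσ.ccp
      (k := fun z => surplusDir M β v g z.2.2)
      (Integrable.of_bound (h.measurable_surplusDir.comp (by fun_prop)).aestronglyMeasurable L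
        (cond_absolutelyContinuous (h.law.ae_next hdir)))
      (ae_of_all _ fun z => h.hasDerivAt_pathNext hσ.ccp z.2.2)
  filter_upwards [h.law.ae_next_slice hlip, h.law.ae_next_slice hdir] with x hx hdx
  refine hasDerivWithinAt_pi.2 fun j => ?_
  have hcont : HasDerivWithinAt
      (fun τ => pathCont M β v g (σ.cont j * τ) (σ.ccp * τ) j x)
      (σ.cont j * contDir M β v g j x + σ.ccp * contNextDir M β v g j x) (Ici 0) 0 :=
    hasDerivWithinAt_tiltedMean (h.density_slice j.succ x) hτ₀ hτ₀' hC
      (h := fun t => pathNext M β v g t)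
      (fun t ht => (hmeas t ht).aestronglyMeasurable)
      (h.integrable_pathNext_zero_slice j.succ x) hL (hx j.succ) (hσ.cont j) hσ.ccp
      (Integrable.of_bound h.measurable_surplusDir.aestronglyMeasurable L (hdx j.succ))
      (ae_of_all _ fun w => h.hasDerivAt_pathNext hσ.ccp w)
  exact ((hcont.sub hren).const_mul M.δ).const_add (M.u j.succ x β - M.u 0 x β)

end Lipschitz

end Contamination

end DDC

namespace DDC

/-! ### The derivative of the mean of the identifying moments. -/

section InstDeriv

variable {K r : ℕ} {X Θ : Type*} [MeasurableSpace X] {M : Model K X Θ}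
  {A : X → Matrix (Fin r) (Fin (K + 1)) ℝ}

lemma choiceProb_nonneg (v : Fin K → ℝ) (j : Fin (K + 1)) : 0 ≤ choiceProb M.errorLaw v j :=
  measureReal_nonneg

lemma choiceProb_le_one (v : Fin K → ℝ) (j : Fin (K + 1)) : choiceProb M.errorLaw v j ≤ 1 :=
  measureReal_le_one

lemma mulVec_fderiv_choiceProb (x : X) (v d : Fin K → ℝ) (i : Fin r) :
    (A x).mulVec (fderiv ℝ (choiceProb M.errorLaw) v d) i =
      ∑ k, d k * M.instDeriv A k x v i := by
  have h1 : fderiv ℝ (choiceProb M.errorLaw) v d =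
      ∑ k, d k • choiceProbDeriv M.errorLaw k v := by
    conv_lhs => rw [pi_eq_sum_univ' d]
    rw [map_sum]
    refine Finset.sum_congr rfl fun k _ => ?_
    rw [map_smul]
    rfl
  rw [h1, Matrix.mulVec_sum, Finset.sum_apply]
  refine Finset.sum_congr rfl fun k _ => ?_
  rw [Matrix.mulVec_smul, Pi.smul_apply, smul_eq_mul]
  rfl

lemma hasDerivWithinAt_mulVec_choiceProb (hP : ContDiff ℝ 1 (choiceProb M.errorLaw)) (x : X)
    {V : ℝ → Fin K → ℝ} {d : Fin K → ℝ} {S : Set ℝ} {τ : ℝ} (hV : HasDerivWithinAt V d S τ)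
    (i : Fin r) :
    HasDerivWithinAt (fun τ => (A x).mulVec (choiceProb M.errorLaw (V τ)) i)
      (∑ k, d k * M.instDeriv A k x (V τ) i) S τ := by
  have h1 := ((hP.differentiable one_ne_zero) (V τ)).hasFDerivAt.comp_hasDerivWithinAt τ hV
  rw [← mulVec_fderiv_choiceProb]
  have h2 := hasDerivWithinAt_pi.1 h1
  simp only [Matrix.mulVec, dotProduct]
  exact HasDerivWithinAt.fun_sum fun k _ => (h2 k).const_mul (A x i k)

/-- Mean value bound for `A P` when its partial derivatives are dominated. -/
lemma abs_mulVec_choiceProb_sub_le (hP : ContDiff ℝ 1 (choiceProb M.errorLaw)) (x : X)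
    {η b c : ℝ} {v₀ v : Fin K → ℝ} (hb : 0 ≤ b)
    (hdom : ∀ w : Fin K → ℝ, (∀ k, |w k - v₀ k| ≤ η) →
      ∀ j i, |M.instDeriv A j x w i| ≤ b * choiceProb M.errorLaw w j.succ)
    (hc : c ≤ η) (hv : ∀ k, |v k - v₀ k| ≤ c) (i : Fin r) :
    |(A x).mulVec (choiceProb M.errorLaw v) i - (A x).mulVec (choiceProb M.errorLaw v₀) i| ≤
      c * (K * b) := by
  let V : ℝ → Fin K → ℝ := fun θ => v₀ + θ • (v - v₀)
  have hV : ∀ θ ∈ Icc (0 : ℝ) 1, ∀ k, |V θ k - v₀ k| ≤ c := fun θ hθ k => by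
    have : V θ k - v₀ k = θ * (v k - v₀ k) := by simp [V]
    rw [this, abs_mul, abs_of_nonneg hθ.1]
    exact (mul_le_of_le_one_left (abs_nonneg _) hθ.2).trans (hv k)
  have hderiv : ∀ θ ∈ Icc (0 : ℝ) 1,
      HasDerivWithinAt (fun θ => (A x).mulVec (choiceProb M.errorLaw (V θ)) i)
        (∑ k, (v - v₀) k * M.instDeriv A k x (V θ) i) (Icc 0 1) θ := fun θ _ => by
    refine hasDerivWithinAt_mulVec_choiceProb hP x ?_ i
    have : HasDerivAt V (v - v₀) θ := by
      simpa [V] using ((hasDerivAt_id θ).smul_const (v - v₀)).const_add v₀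
    exact this.hasDerivWithinAt
  have hmvt := norm_image_sub_le_of_norm_deriv_le_segment_01' hderiv (C := c * (K * b))
    (fun θ hθ => by
      have hθ' : θ ∈ Icc (0 : ℝ) 1 := ⟨hθ.1, hθ.2.le⟩
      rw [Real.norm_eq_abs]
      calc |∑ k, (v - v₀) k * M.instDeriv A k x (V θ) i|
          ≤ ∑ k, |(v - v₀) k * M.instDeriv A k x (V θ) i| := Finset.abs_sum_le_sum_abs _ _
        _ ≤ ∑ _k : Fin K, c * b := by
            refine Finset.sum_le_sum fun k _ => ?_
            rw [abs_mul]
            refine mul_le_mul (hv k) ?_ (abs_nonneg _) ((abs_nonneg _).trans (hv k))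
            refine (hdom (V θ) (fun k => (hV θ hθ' k).trans hc) k i).trans ?_
            exact mul_le_of_le_one_right hb (choiceProb_le_one _ _)
        _ = c * (K * b) := by simp; ring)
  have e1 : V 1 = v := by simp [V]
  have e0 : V 0 = v₀ := by simp [V]
  rw [e1, e0] at hmvt
  exact hmvt

end InstDeriv

namespace Contamination

variable {K r : ℕ} {X Θ : Type*} [MeasurableSpace X] {M : Model K X Θ}
  {A : X → Matrix (Fin r) (Fin (K + 1)) ℝ} {β : Θ} {v : X → ℝ} {μ : Measure X}
  [IsProbabilityMeasure μ] {F₀ G : Measure (Obs K X)} [IsProbabilityMeasure F₀]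
  {g : Obs K X → ℝ} {C : ℝ}

lemma exists_vTilde_lipschitz (h : Contamination M A β v μ F₀ G g C) {σ : Selection K}
    (hσ : σ.Valid) :
    ∃ L τ₀ : ℝ, 0 ≤ L ∧ 0 < τ₀ ∧ τ₀ ≤ 1 / 2 ∧ ∀ᵐ x ∂μ, ∀ τ ∈ Icc 0 τ₀, ∀ k,
      |M.vTilde β (pathFirst M β v g F₀ σ τ) x k - M.valueDiff β v x k| ≤ τ * L := by
  obtain ⟨L, τ₀, hL, hτ₀, hτ₀', hcont, hren⟩ := h.exists_path_lipschitz
  -- Two differences, each moved by at most `L * (τ + τ)`.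
  refine ⟨4 * |M.δ| * L, τ₀, by positivity, hτ₀, hτ₀', ?_⟩
  filter_upwards [hcont] with x hx τ hτ k
  have hscale : ∀ {d : ℝ}, d ∈ Icc (0 : ℝ) 1 → d * τ ∈ Icc 0 τ₀ := fun hd =>
    ⟨mul_nonneg hd.1 hτ.1, (mul_le_of_le_one_left hτ.1 hd.2).trans hτ.2⟩
  have hle : ∀ {d : ℝ}, d ∈ Icc (0 : ℝ) 1 → d * τ ≤ τ := fun hd => mul_le_of_le_one_left hτ.1 hd.2
  rw [← h.vTilde_pathFirst_zero σ x]
  have e : M.vTilde β (pathFirst M β v g F₀ σ τ) x k - M.vTilde β (pathFirst M β v g F₀ σ 0) x k =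
      M.δ * ((pathCont M β v g (σ.cont k * τ) (σ.ccp * τ) k x - pathCont M β v g 0 0 k x) -
        (pathRenew M β v g F₀ (σ.renew * τ) (σ.ccp * τ) - pathRenew M β v g F₀ 0 0)) := by
    simp only [Model.vTilde, pathFirst, mul_zero]; ring
  have h1 := hx _ (hscale (hσ.cont k)) _ (hscale hσ.ccp) k
  have h2 := hren _ (hscale hσ.renew) _ (hscale hσ.ccp)
  have h3 : L * (σ.cont k * τ + σ.ccp * τ) ≤ L * (τ + τ) :=
    mul_le_mul_of_nonneg_left (add_le_add (hle (hσ.cont k)) (hle hσ.ccp)) hL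
  have h4 : L * (σ.renew * τ + σ.ccp * τ) ≤ L * (τ + τ) :=
    mul_le_mul_of_nonneg_left (add_le_add (hle hσ.renew) (hle hσ.ccp)) hL
  rw [e, abs_mul]
  have h5 := (abs_sub _ _).trans (add_le_add (h1.trans h3) (h2.trans h4))
  calc _ ≤ |M.δ| * (L * (τ + τ) + L * (τ + τ)) := mul_le_mul_of_nonneg_left h5 (abs_nonneg _)
    _ = _ := by ring

/-- The given envelope is only almost everywhere measurable and possibly negative; a measurable
version in absolute value repairs both. -/
lemma exists_envelope (h : Contamination M A β v μ F₀ G g C) :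
    ∃ η : ℝ, 0 < η ∧ ∃ b : X → ℝ, Measurable b ∧ Integrable b μ ∧ (∀ x, 0 ≤ b x) ∧ ∀ᵐ x ∂μ,
      ∀ w : Fin K → ℝ, (∀ k, |w k - M.valueDiff β v x k| ≤ η) →
        ∀ j i, |M.instDeriv A j x w i| ≤ b x * choiceProb M.errorLaw w j.succ := by
  obtain ⟨η, hη, b, hb, hdom⟩ := h.regular.dominated_deriv
  refine ⟨η, hη, fun x => |hb.1.mk b x|, ?_, (hb.congr hb.1.ae_eq_mk).abs,
    fun x => abs_nonneg _, ?_⟩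
  · exact continuous_abs.measurable.comp hb.1.stronglyMeasurable_mk.measurable
  · filter_upwards [hdom, hb.1.ae_eq_mk] with x hx hbx w hw j i
    rw [← hbx]
    exact (hx w hw j i).trans (mul_le_mul_of_nonneg_right (le_abs_self _) (choiceProb_nonneg _ _))

lemma measurable_instDeriv (h : Contamination M A β v μ F₀ G g C) {V : X → Fin K → ℝ}
    (hV : Measurable V) (j : Fin K) (i : Fin r) :
    Measurable fun x => M.instDeriv A j x (V x) i := by
  have h1 : Continuous fun v => choiceProbDeriv M.errorLaw j v :=
    (h.regular.smooth_prob.continuous_fderiv one_ne_zero).clm_apply continuous_const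
  simp only [Model.instDeriv, Matrix.mulVec, dotProduct]
  exact Finset.measurable_sum _ fun k _ => (h.regular.measurable_inst i k).mul
    ((measurable_pi_apply k).comp (h1.measurable.comp hV))

lemma measurable_mulVec (h : Contamination M A β v μ F₀ G g C) {d : Obs K X → Fin (K + 1) → ℝ}
    (hd : ∀ k, Measurable fun z => d z k) (i : Fin r) :
    Measurable fun z : Obs K X => (A z.2.1).mulVec (d z) i := by
  simp only [Matrix.mulVec, dotProduct]
  exact Finset.measurable_sum _ fun k _ => ((h.regular.measurable_inst i k).comp
    (by fun_prop)).mul (hd k)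

lemma measurable_choiceProb_comp (h : Contamination M A β v μ F₀ G g C) {V : X → Fin K → ℝ}
    (hV : Measurable V) (j : Fin (K + 1)) : Measurable fun x => choiceProb M.errorLaw (V x) j :=
  (measurable_pi_apply j).comp (h.regular.smooth_prob.continuous.measurable.comp hV)

lemma measurable_moment (h : Contamination M A β v μ F₀ G g C) {σ : Selection K} (hσ : σ.Valid)
    {τ : ℝ} (hτ : τ ∈ Icc (0 : ℝ) (1 / 2)) (i : Fin r) :
    Measurable fun z => M.moment A β (pathFirst M β v g F₀ σ τ) z i :=
  h.measurable_mulVec (d := fun z => ind z -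
    choiceProb M.errorLaw (M.vTilde β (pathFirst M β v g F₀ σ τ) z.2.1)) (fun k =>
    (measurable_ind k).sub ((h.measurable_choiceProb_comp (h.measurable_vTilde hσ hτ) k).comp
      (by fun_prop))) i

lemma integrable_moment_zero (h : Contamination M A β v μ F₀ G g C) {σ : Selection K}
    (hσ : σ.Valid) (i : Fin r) :
    Integrable (fun z => M.moment A β (pathFirst M β v g F₀ σ 0) z i) F₀ := by
  simp only [Model.moment, Matrix.mulVec, dotProduct]
  refine integrable_finsetSum _ fun k _ => ?_
  refine (h.law.integrable_state (h.regular.integrable_inst i k)).mul_bdd (c := 1) ?_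
    (ae_of_all _ fun z => ?_)
  · exact ((measurable_ind k).sub ((h.measurable_choiceProb_comp (h.measurable_vTilde hσ
      ⟨le_rfl, by norm_num⟩) k).comp (by fun_prop))).aestronglyMeasurable
  · have h1 := choiceProb_nonneg (M := M) (M.vTilde β (pathFirst M β v g F₀ σ 0) z.2.1) k
    have h2 := choiceProb_le_one (M := M) (M.vTilde β (pathFirst M β v g F₀ σ 0) z.2.1) k
    have h3 := ind_nonneg z k
    have h4 := ind_le_one z k
    rw [Real.norm_eq_abs, Pi.sub_apply, abs_le]
    constructor <;> linarith

/-- At the truth `P(ṽ)` is the vector of choice probabilities given the state, so `y - P(ṽ)` has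
conditional mean zero. -/
lemma integral_moment_zero (h : Contamination M A β v μ F₀ G g C) {σ : Selection K}
    (hσ : σ.Valid) (i : Fin r) :
    ∫ z, M.moment A β (pathFirst M β v g F₀ σ 0) z i ∂F₀ = 0 := by
  rw [h.law.integral_eq (h.integrable_moment_zero hσ i)]
  refine integral_eq_zero_of_ae (ae_of_all _ fun x => ?_)
  have e : ∀ (j : Fin (K + 1)) (w : X), M.moment A β (pathFirst M β v g F₀ σ 0) (j, x, w) i =
      A x i j - ∑ k, A x i k * M.trueProb β v x k := by
    intro j w
    simp only [Model.moment, Matrix.mulVec, dotProduct, h.vTilde_pathFirst_zero, Pi.sub_apply,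
      mul_sub, Finset.sum_sub_distrib]
    congr 1
    simp [ind, Pi.single_apply]
  simp only [e, integral_const, probReal_univ, one_smul, mul_sub, Finset.sum_sub_distrib,
    ← Finset.sum_mul, h.law.sum_one, one_mul, Pi.zero_apply]
  rw [sub_eq_zero]
  exact Finset.sum_congr rfl fun k _ => mul_comm _ _

/-- The derivative of the mean of the moment functions along the path. -/
lemma hasDerivWithinAt_moment (h : Contamination M A β v μ F₀ G g C) {σ : Selection K}
    (hσ : σ.Valid) (i : Fin r) :
    (∃ τ₀ : ℝ, 0 < τ₀ ∧ τ₀ ≤ 1 / 2 ∧ ∀ τ ∈ Icc 0 τ₀,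
      Integrable (fun z => M.moment A β (pathFirst M β v g F₀ σ τ) z i) F₀) ∧
    HasDerivWithinAt (fun τ => ∫ z, M.moment A β (pathFirst M β v g F₀ σ τ) z i ∂F₀)
      (∫ z, -∑ k, valueDir M β v g F₀ σ z.2.1 k *
        M.instDeriv A k z.2.1 (M.valueDiff β v z.2.1) i ∂F₀) (Ici 0) 0 := by
  obtain ⟨L, τ₁, hL, hτ₁, hτ₁', hlip⟩ := h.exists_vTilde_lipschitz hσ
  obtain ⟨η, hη, b, -, hb, hb0, hdom⟩ := h.exists_envelope
  -- Keeps `ṽ` within `η` of its true value, where the envelope is valid.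
  set τ₀ := min τ₁ (η / (L + 1)) with hτdef
  have hτ₀ : 0 < τ₀ := lt_min hτ₁ (by positivity)
  have hτL : ∀ τ ∈ Icc 0 τ₀, τ * L ≤ η := fun τ hτ => by
    calc τ * L ≤ η / (L + 1) * (L + 1) :=
          mul_le_mul (hτ.2.trans (min_le_right _ _)) (by linarith) hL (by positivity)
      _ = η := by field_simp
  have hsub : ∀ τ ∈ Icc 0 τ₀, τ ∈ Icc 0 τ₁ := fun τ hτ => ⟨hτ.1, hτ.2.trans (min_le_left _ _)⟩
  have hhalf : ∀ τ ∈ Icc 0 τ₀, τ ∈ Icc (0 : ℝ) (1 / 2) := fun τ hτ =>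
    ⟨hτ.1, (hsub τ hτ).2.trans hτ₁'⟩
  have hmeas : ∀ τ ∈ Icc 0 τ₀, AEStronglyMeasurable
      (fun z => M.moment A β (pathFirst M β v g F₀ σ τ) z i) F₀ := fun τ hτ =>
    (h.measurable_moment hσ (hhalf τ hτ) i).aestronglyMeasurable
  have e : ∀ τ z, M.moment A β (pathFirst M β v g F₀ σ τ) z i = (A z.2.1).mulVec (ind z) i -
      (A z.2.1).mulVec (choiceProb M.errorLaw (M.vTilde β (pathFirst M β v g F₀ σ τ) z.2.1)) i :=
    fun τ z => by rw [Model.moment, Matrix.mulVec_sub, Pi.sub_apply]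
  have hbound : ∀ᵐ z ∂F₀, ∀ τ ∈ Icc 0 τ₀, |M.moment A β (pathFirst M β v g F₀ σ τ) z i -
      M.moment A β (pathFirst M β v g F₀ σ 0) z i| ≤ τ * (L * (K * b z.2.1)) := by
    filter_upwards [h.law.ae_state hlip, h.law.ae_state hdom] with z hz hdz τ hτ
    rw [e, e, sub_sub_sub_cancel_left, abs_sub_comm, h.vTilde_pathFirst_zero, ← mul_assoc]
    exact abs_mulVec_choiceProb_sub_le h.regular.smooth_prob z.2.1 (hb0 _) hdz (hτL τ hτ)
      (hz τ (hsub τ hτ)) i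
  have hbi : Integrable (fun z : Obs K X => L * (K * b z.2.1)) F₀ :=
    ((h.law.integrable_state hb).const_mul _).const_mul _
  have h0 := h.integrable_moment_zero hσ i
  refine ⟨⟨τ₀, hτ₀, (min_le_left _ _).trans hτ₁', fun τ hτ =>
    integrable_of_lipschitz_at_zero (f := fun τ z => M.moment A β (pathFirst M β v g F₀ σ τ) z i)
      hmeas h0 hbi hbound hτ⟩, ?_⟩
  refine hasDerivWithinAt_integral
    (f := fun τ z => M.moment A β (pathFirst M β v g F₀ σ τ) z i) hτ₀ hmeas h0 hbi hbound ?_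
  filter_upwards [h.law.ae_state (h.hasDerivWithinAt_path hσ)] with z hz
  simp only [e]
  have := (hasDerivWithinAt_mulVec_choiceProb (A := A) h.regular.smooth_prob z.2.1 hz i).const_sub
    ((A z.2.1).mulVec (ind z) i)
  rwa [h.vTilde_pathFirst_zero] at this

end Contamination

end DDC

/-! ### Neutral paths, and the adjustment for non-renewal continuations. -/

namespace DDC

/-- All components of the first steps move. -/
def Selection.full {K : ℕ} : Selection K := ⟨1, fun _ => 1, 1⟩

lemma Selection.full_valid {K : ℕ} : (Selection.full : Selection K).Valid :=
  ⟨⟨zero_le_one, le_rfl⟩, fun _ => ⟨zero_le_one, le_rfl⟩, ⟨zero_le_one, le_rfl⟩⟩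

/-- A path of functions with mean zero under the contaminated laws, and with continuous mean in
the direction of contamination. -/
structure IsNeutral {Z : Type*} [MeasurableSpace Z] (F₀ : Measure Z) (g : Z → ℝ)
    (φ : ℝ → Z → ℝ) : Prop where
  integrable : ∀ᶠ τ in 𝓝[≥] (0 : ℝ), Integrable (φ τ) F₀
  mean_zero : ∀ᶠ τ in 𝓝[≥] (0 : ℝ), ∫ z, tilt g τ z * φ τ z ∂F₀ = 0
  tendsto : Tendsto (fun τ => ∫ z, (g z - 1) * φ τ z ∂F₀) (𝓝[>] 0)
    (𝓝 (∫ z, (g z - 1) * φ 0 z ∂F₀))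

lemma eventually_Icc {τ₀ : ℝ} (h : 0 < τ₀) : ∀ᶠ τ in 𝓝[≥] (0 : ℝ), τ ∈ Icc 0 τ₀ :=
  Icc_mem_nhdsGE h

lemma eventually_Icc_right {τ₀ : ℝ} (h : 0 < τ₀) : ∀ᶠ τ in 𝓝[>] (0 : ℝ), τ ∈ Icc 0 τ₀ :=
  nhdsWithin_mono _ Ioi_subset_Ici_self (eventually_Icc h)

namespace IsNeutral

variable {Z : Type*} [MeasurableSpace Z] {F₀ G : Measure Z} {g : Z → ℝ} {C : ℝ}
  {φ ψ : ℝ → Z → ℝ}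

lemma integrable_zero (h : IsNeutral F₀ g φ) : Integrable (φ 0) F₀ :=
  h.integrable.self_of_nhdsWithin (mem_Ici.2 le_rfl)

lemma integral_zero (h : IsNeutral F₀ g φ) : ∫ z, φ 0 z ∂F₀ = 0 := by
  simpa [tilt_zero] using h.mean_zero.self_of_nhdsWithin (mem_Ici.2 le_rfl)

lemma add (hg : HasBoundedDensity F₀ G g C) (h : IsNeutral F₀ g φ) (h' : IsNeutral F₀ g ψ) :
    IsNeutral F₀ g fun τ z => φ τ z + ψ τ z := by
  have hsub : ∀ {f : Z → ℝ}, Integrable f F₀ → Integrable (fun z => (g z - 1) * f z) F₀ :=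
    fun hf => hf.bdd_mul (c := 1 + C) (hg.measurable.sub_const 1).aestronglyMeasurable
      (ae_of_all _ hg.abs_sub_one_le)
  refine ⟨?_, ?_, ?_⟩
  · filter_upwards [h.integrable, h'.integrable] with τ h1 h2 using h1.add h2
  · filter_upwards [h.integrable, h'.integrable, h.mean_zero, h'.mean_zero,
      eventually_Icc (show (0 : ℝ) < 1 / 2 by norm_num)] with τ h1 h2 h3 h4 hτ
    simp_rw [mul_add]
    rw [integral_add (integrable_tilt_mul hg hτ h1) (integrable_tilt_mul hg hτ h2), h3, h4,
      add_zero]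
  · have e : ∀ {τ}, Integrable (φ τ) F₀ → Integrable (ψ τ) F₀ →
        ∫ z, (g z - 1) * (φ τ z + ψ τ z) ∂F₀ =
          ∫ z, (g z - 1) * φ τ z ∂F₀ + ∫ z, (g z - 1) * ψ τ z ∂F₀ := fun h1 h2 => by
      simp_rw [mul_add]
      rw [integral_add (hsub h1) (hsub h2)]
    rw [e h.integrable_zero h'.integrable_zero]
    refine (h.tendsto.add h'.tendsto).congr' ?_
    have hle : 𝓝[>] (0 : ℝ) ≤ 𝓝[≥] 0 := nhdsWithin_mono _ Ioi_subset_Ici_self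
    filter_upwards [hle h.integrable, hle h'.integrable] with τ h1 h2
    exact (e h1 h2).symm

lemma sum (hg : HasBoundedDensity F₀ G g C) {ι : Type*} (s : Finset ι) {φ : ι → ℝ → Z → ℝ}
    (h : ∀ i ∈ s, IsNeutral F₀ g (φ i)) : IsNeutral F₀ g fun τ z => ∑ i ∈ s, φ i τ z := by
  classical
  induction s using Finset.induction_on with
  | empty => exact ⟨by simp, by simp, by simp⟩
  | insert i s hi ih =>
    simp only [Finset.sum_insert hi]
    exact add hg (h i (Finset.mem_insert_self i s))
      (ih fun k hk => h k (Finset.mem_insert_of_mem hk))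

/-- The coefficient depends on `τ` alone, so it preserves mean zero for each `τ`; convergence at `0`
is all that is asked of it. -/
lemma const_mul (h : IsNeutral F₀ g φ) {c : ℝ → ℝ} (hc : Tendsto c (𝓝[>] 0) (𝓝 (c 0))) :
    IsNeutral F₀ g fun τ z => c τ * φ τ z := by
  have e : ∀ τ (l : Z → ℝ), ∫ z, l z * (c τ * φ τ z) ∂F₀ = c τ * ∫ z, l z * φ τ z ∂F₀ :=
    fun τ l => by
      rw [← integral_const_mul]
      congr 1; funext z; ring
  refine ⟨?_, ?_, ?_⟩
  · filter_upwards [h.integrable] with τ h1 using h1.const_mul _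
  · filter_upwards [h.mean_zero] with τ h1
    rw [e, h1, mul_zero]
  · simp_rw [e _ fun z => g z - 1]
    exact hc.mul h.tendsto

/-- The mean of a neutral path at the true law has derivative minus its mean in the direction of
contamination. -/
lemma hasDerivWithinAt (hg : HasBoundedDensity F₀ G g C) (h : IsNeutral F₀ g φ) :
    HasDerivWithinAt (fun τ => ∫ z, φ τ z ∂F₀) (-∫ z, g z * φ 0 z ∂F₀) (Ici 0) 0 := by
  have hset : (Ici (0 : ℝ)) \ {0} = Ioi 0 := by
    ext τ; simp [lt_iff_le_and_ne, eq_comm]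
  have e0 : ∫ z, (g z - 1) * φ 0 z ∂F₀ = ∫ z, g z * φ 0 z ∂F₀ := by
    simp_rw [sub_mul, one_mul]
    rw [integral_sub (hg.integrable_mul h.integrable_zero) h.integrable_zero, h.integral_zero,
      sub_zero]
  rw [hasDerivWithinAt_iff_tendsto_slope, hset, ← e0]
  refine h.tendsto.neg.congr' ?_
  have hle : 𝓝[>] (0 : ℝ) ≤ 𝓝[≥] 0 := nhdsWithin_mono _ Ioi_subset_Ici_self
  filter_upwards [hle h.integrable, hle h.mean_zero, self_mem_nhdsWithin] with τ h1 h2 hτ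
  have h3 : Integrable (fun z => (g z - 1) * φ τ z) F₀ :=
    h1.bdd_mul (c := 1 + C) (hg.measurable.sub_const 1).aestronglyMeasurable
      (ae_of_all _ hg.abs_sub_one_le)
  -- Expanding mean zero under the contaminated law with `tilt = 1 + τ (g - 1)` shows that the
  -- difference quotient of `∫ φ τ` equals `-∫ (g - 1) φ τ` exactly, so no differentiability of `φ`
  -- in `τ` is needed.
  have h4 : ∫ z, φ τ z ∂F₀ + τ * ∫ z, (g z - 1) * φ τ z ∂F₀ = 0 := by
    rw [← h2, ← integral_const_mul, ← integral_add h1 (h3.const_mul τ)]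
    congr 1; funext z; simp only [tilt]; ring
  rw [slope_def_field, h.integral_zero, sub_zero, sub_zero, eq_div_iff (ne_of_gt hτ)]
  linarith

/-- A dominated, pointwise convergent path with mean zero along the contaminated laws is
neutral. -/
lemma of_dominated (hg : HasBoundedDensity F₀ G g C) {τ₀ : ℝ} (hτ₀ : 0 < τ₀)
    (hm : ∀ τ ∈ Icc 0 τ₀, AEStronglyMeasurable (φ τ) F₀) {dom : Z → ℝ} (hdom : Integrable dom F₀)
    (hle : ∀ᵐ z ∂F₀, ∀ τ ∈ Icc 0 τ₀, |φ τ z| ≤ dom z)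
    (hlim : ∀ᵐ z ∂F₀, Tendsto (fun τ => φ τ z) (𝓝[>] 0) (𝓝 (φ 0 z)))
    (hz : ∀ τ ∈ Icc 0 τ₀, Integrable (φ τ) F₀ → ∫ z, tilt g τ z * φ τ z ∂F₀ = 0) :
    IsNeutral F₀ g φ := by
  have hint : ∀ τ ∈ Icc 0 τ₀, Integrable (φ τ) F₀ := fun τ hτ =>
    hdom.mono' (hm τ hτ) (by filter_upwards [hle] with z h1 using h1 τ hτ)
  refine ⟨?_, ?_, ?_⟩
  · filter_upwards [eventually_Icc hτ₀] with τ hτ using hint τ hτ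
  · filter_upwards [eventually_Icc hτ₀] with τ hτ using hz τ hτ (hint τ hτ)
  · refine tendsto_integral_filter_of_dominated_convergence (fun z => (1 + C) * dom z) ?_ ?_
      (hdom.const_mul _) ?_
    · filter_upwards [eventually_Icc_right hτ₀] with τ hτ
      exact (hg.measurable.sub_const 1).aestronglyMeasurable.mul (hm τ hτ)
    · filter_upwards [eventually_Icc_right hτ₀] with τ hτ
      filter_upwards [hle] with z h1
      rw [norm_mul]
      exact mul_le_mul (hg.abs_sub_one_le z) (h1 τ hτ) (norm_nonneg _)
        ((abs_nonneg _).trans (hg.abs_sub_one_le z))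
    · filter_upwards [hlim] with z h1 using h1.const_mul _

end IsNeutral

section Path

variable {K r : ℕ} {X Θ : Type*} [MeasurableSpace X] (M : Model K X Θ)
  (A : X → Matrix (Fin r) (Fin (K + 1)) ℝ) (β : Θ) (v : X → ℝ)
  (g : Obs K X → ℝ) (F₀ : Measure (Obs K X))

/-- `ṽ` along the path. -/
noncomputable def pathVal (τ : ℝ) : X → Fin K → ℝ :=
  M.vTilde β (pathFirst M β v g F₀ Selection.full τ)

/-- `A P_{ṽj} / P_j` along the path. -/
noncomputable def pathWeight (τ : ℝ) (j : Fin K) (i : Fin r) (x : X) : ℝ :=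
  M.instDeriv A j x (pathVal M β v g F₀ τ x) i / choiceProb M.errorLaw (pathVal M β v g F₀ τ x) j.succ

lemma weight_pathFirst (τ : ℝ) (j : Fin K) (i : Fin r) (z : Obs K X) :
    M.weight A β (pathFirst M β v g F₀ Selection.full τ) j z i =
      ind z j.succ * pathWeight M A β v g F₀ τ j i z.2.1 := by
  simp only [Model.weight, pathWeight, pathVal, Pi.smul_apply, smul_eq_mul]
  ring

lemma adjCont_pathFirst (τ : ℝ) (j : Fin K) (i : Fin r) (z : Obs K X) :
    M.adjCont A β (pathFirst M β v g F₀ Selection.full τ) j z i =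
      ind z j.succ * (-M.δ * pathWeight M A β v g F₀ τ j i z.2.1 *
        (pathNext M β v g τ z.2.2 - pathCont M β v g τ τ j z.2.1)) := by
  simp only [Model.adjCont, Pi.smul_apply, smul_eq_mul, weight_pathFirst]
  simp only [Model.nextTerm, pathFirst, Selection.full, one_mul, pathNext]
  ring

end Path

namespace Contamination

variable {K r : ℕ} {X Θ : Type*} [MeasurableSpace X] {M : Model K X Θ}
  {A : X → Matrix (Fin r) (Fin (K + 1)) ℝ} {β : Θ} {v : X → ℝ} {μ : Measure X}
  [IsProbabilityMeasure μ] {F₀ G : Measure (Obs K X)} [IsProbabilityMeasure F₀]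
  {g : Obs K X → ℝ} {C : ℝ}

lemma pathVal_zero (h : Contamination M A β v μ F₀ G g C) (x : X) :
    pathVal M β v g F₀ 0 x = M.valueDiff β v x := h.vTilde_pathFirst_zero _ x

lemma measurable_pathVal (h : Contamination M A β v μ F₀ G g C) {τ : ℝ}
    (hτ : τ ∈ Icc (0 : ℝ) (1 / 2)) : Measurable (pathVal M β v g F₀ τ) :=
  h.measurable_vTilde Selection.full_valid hτ

lemma measurable_pathWeight (h : Contamination M A β v μ F₀ G g C) {τ : ℝ}
    (hτ : τ ∈ Icc (0 : ℝ) (1 / 2)) (j : Fin K) (i : Fin r) :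
    Measurable (pathWeight M A β v g F₀ τ j i) :=
  (h.measurable_instDeriv (h.measurable_pathVal hτ) j i).div
    (h.measurable_choiceProb_comp (h.measurable_pathVal hτ) j.succ)

lemma exists_pathWeight_bound (h : Contamination M A β v μ F₀ G g C) :
    ∃ τ₀ : ℝ, 0 < τ₀ ∧ τ₀ ≤ 1 / 2 ∧ ∃ b : X → ℝ, Measurable b ∧ Integrable b μ ∧ (∀ x, 0 ≤ b x) ∧
      ∀ᵐ x ∂μ, ∀ τ ∈ Icc 0 τ₀, ∀ j i, |pathWeight M A β v g F₀ τ j i x| ≤ b x ∧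
        |M.instDeriv A j x (pathVal M β v g F₀ τ x) i| ≤ b x := by
  obtain ⟨L, τ₁, hL, hτ₁, hτ₁', hlip⟩ := h.exists_vTilde_lipschitz Selection.full_valid
  obtain ⟨η, hη, b, hbm, hb, hb0, hdom⟩ := h.exists_envelope
  refine ⟨min τ₁ (η / (L + 1)), lt_min hτ₁ (by positivity), (min_le_left _ _).trans hτ₁', b, hbm,
    hb, hb0, ?_⟩
  filter_upwards [hlip, hdom] with x hx hdx τ hτ j i
  have hτL : τ * L ≤ η := by
    calc τ * L ≤ η / (L + 1) * (L + 1) :=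
          mul_le_mul (hτ.2.trans (min_le_right _ _)) (by linarith) hL (by positivity)
      _ = η := by field_simp
  have h1 := hdx (pathVal M β v g F₀ τ x) (fun k =>
    (hx τ ⟨hτ.1, hτ.2.trans (min_le_left _ _)⟩ k).trans hτL) j i
  have hp := choiceProb_pos M.errorLaw (pathVal M β v g F₀ τ x) j.succ
  refine ⟨?_, h1.trans (mul_le_of_le_one_right (hb0 x) (choiceProb_le_one _ _))⟩
  rw [pathWeight, abs_div, abs_of_pos hp, div_le_iff₀ hp]
  exact h1

lemma tendsto_pathVal (h : Contamination M A β v μ F₀ G g C) :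
    ∀ᵐ x ∂μ, Tendsto (fun τ => pathVal M β v g F₀ τ x) (𝓝[>] 0) (𝓝 (pathVal M β v g F₀ 0 x)) := by
  filter_upwards [h.hasDerivWithinAt_path Selection.full_valid] with x hx
  exact (hx.continuousWithinAt.mono Ioi_subset_Ici_self).tendsto

lemma tendsto_instDeriv (h : Contamination M A β v μ F₀ G g C) (j : Fin K) (i : Fin r) :
    ∀ᵐ x ∂μ, Tendsto (fun τ => M.instDeriv A j x (pathVal M β v g F₀ τ x) i) (𝓝[>] 0)
      (𝓝 (M.instDeriv A j x (pathVal M β v g F₀ 0 x) i)) := by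
  filter_upwards [h.tendsto_pathVal] with x hx
  have h1 : Continuous fun v => choiceProbDeriv M.errorLaw j v :=
    (h.regular.smooth_prob.continuous_fderiv one_ne_zero).clm_apply continuous_const
  have h2 := (h1.tendsto _).comp hx
  simp only [Model.instDeriv, Matrix.mulVec, dotProduct]
  exact tendsto_finsetSum _ fun k _ => ((tendsto_pi_nhds.1 h2) k).const_mul _

lemma tendsto_pathWeight (h : Contamination M A β v μ F₀ G g C) (j : Fin K) (i : Fin r) :
    ∀ᵐ x ∂μ, Tendsto (fun τ => pathWeight M A β v g F₀ τ j i x) (𝓝[>] 0)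
      (𝓝 (pathWeight M A β v g F₀ 0 j i x)) := by
  filter_upwards [h.tendsto_pathVal, h.tendsto_instDeriv j i] with x hx hd
  have h1 := (h.regular.smooth_prob.continuous.tendsto _).comp hx
  exact hd.div ((tendsto_pi_nhds.1 h1) j.succ) (choiceProb_pos _ _ _).ne'

lemma tendsto_pathNext (h : Contamination M A β v μ F₀ G g C) (w : X) :
    Tendsto (fun τ => pathNext M β v g τ w) (𝓝[>] 0) (𝓝 (pathNext M β v g 0 w)) := by
  have h1 := (h.hasDerivAt_pathNext (a := 1) ⟨zero_le_one, le_rfl⟩ w).continuousWithinAt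
  simp only [one_mul] at h1
  exact (h1.mono Ioi_subset_Ici_self).tendsto

lemma tendsto_of_abs_sub_le {f : ℝ → ℝ} {L τ₀ : ℝ} (hτ₀ : 0 < τ₀)
    (hf : ∀ τ ∈ Icc 0 τ₀, |f τ - f 0| ≤ L * (τ + τ)) : Tendsto f (𝓝[>] 0) (𝓝 (f 0)) := by
  rw [tendsto_iff_norm_sub_tendsto_zero]
  have h1 : Tendsto (fun τ : ℝ => L * (τ + τ)) (𝓝[>] 0) (𝓝 0) := by
    have : Tendsto (fun τ : ℝ => L * (τ + τ)) (𝓝 0) (𝓝 (L * (0 + 0))) :=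
      (Continuous.tendsto (by fun_prop) 0)
    simp only [add_zero, mul_zero] at this
    exact this.mono_left nhdsWithin_le_nhds
  refine squeeze_zero' (Eventually.of_forall fun τ => norm_nonneg _) ?_ h1
  filter_upwards [eventually_Icc_right hτ₀] with τ hτ using hf τ hτ

lemma tendsto_pathCont (h : Contamination M A β v μ F₀ G g C) :
    ∀ᵐ x ∂μ, ∀ j, Tendsto (fun τ => pathCont M β v g τ τ j x) (𝓝[>] 0)
      (𝓝 (pathCont M β v g 0 0 j x)) := by
  obtain ⟨L, τ₀, -, hτ₀, -, hcont, -⟩ := h.exists_path_lipschitz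
  filter_upwards [hcont] with x hx j
  exact tendsto_of_abs_sub_le (f := fun τ => pathCont M β v g τ τ j x) hτ₀
    fun τ hτ => hx τ hτ τ hτ j

lemma tendsto_pathRenew (h : Contamination M A β v μ F₀ G g C) :
    Tendsto (fun τ => pathRenew M β v g F₀ τ τ) (𝓝[>] 0) (𝓝 (pathRenew M β v g F₀ 0 0)) := by
  obtain ⟨L, τ₀, -, hτ₀, -, -, hren⟩ := h.exists_path_lipschitz
  exact tendsto_of_abs_sub_le (f := fun τ => pathRenew M β v g F₀ τ τ) hτ₀
    fun τ hτ => hren τ hτ τ hτ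

lemma deviation_pathNext (h : Contamination M A β v μ F₀ G g C) :
    ∃ D : ℝ, ∀ᵐ x ∂μ, ∀ j : Fin K,
      ∫ w, |pathNext M β v g 0 w - pathCont M β v g 0 0 j x| ∂(M.trans j.succ x) ≤ D := by
  obtain ⟨D, hD⟩ := h.regular.deviation
  refine ⟨D, ?_⟩
  filter_upwards [hD] with x hDx j
  refine le_trans (le_of_eq ?_) (hDx j.succ)
  rw [pathCont_zero]
  simp_rw [h.pathNext_zero x]
  rw [integral_sub (h.value.integrable j.succ x) (integrable_const _)]
  simp

/-- The adjustment terms of the conditional expectations are neutral. -/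
lemma isNeutral_adjCont (h : Contamination M A β v μ F₀ G g C) (j : Fin K) (i : Fin r) :
    IsNeutral F₀ g fun τ z =>
      M.adjCont A β (pathFirst M β v g F₀ Selection.full τ) j z i := by
  obtain ⟨τ₁, hτ₁, hτ₁', b, hbm, hb, hb0, hbd⟩ := h.exists_pathWeight_bound
  obtain ⟨L, τ₂, hL, hτ₂, hτ₂', hcont, -⟩ := h.exists_path_lipschitz
  obtain ⟨N, τ₃, hN, hτ₃, hτ₃', hnext, -⟩ := h.exists_pathNext_lipschitz
  obtain ⟨τ₄, hτ₄, hτ₄', hni⟩ := h.exists_pathNext_integrable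
  obtain ⟨D, hD⟩ := h.deviation_pathNext
  set τ₀ := min (min τ₁ τ₂) (min τ₃ τ₄) with hτ₀def
  have hτ₀ : 0 < τ₀ := lt_min (lt_min hτ₁ hτ₂) (lt_min hτ₃ hτ₄)
  have m1 : ∀ {τ}, τ ∈ Icc 0 τ₀ → τ ∈ Icc 0 τ₁ := fun hτ =>
    ⟨hτ.1, hτ.2.trans ((min_le_left _ _).trans (min_le_left _ _))⟩
  have m2 : ∀ {τ}, τ ∈ Icc 0 τ₀ → τ ∈ Icc 0 τ₂ := fun hτ =>
    ⟨hτ.1, hτ.2.trans ((min_le_left _ _).trans (min_le_right _ _))⟩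
  have m3 : ∀ {τ}, τ ∈ Icc 0 τ₀ → τ ∈ Icc 0 τ₃ := fun hτ =>
    ⟨hτ.1, hτ.2.trans ((min_le_right _ _).trans (min_le_left _ _))⟩
  have m4 : ∀ {τ}, τ ∈ Icc 0 τ₀ → τ ∈ Icc 0 τ₄ := fun hτ =>
    ⟨hτ.1, hτ.2.trans ((min_le_right _ _).trans (min_le_right _ _))⟩
  have mh : ∀ {τ}, τ ∈ Icc 0 τ₀ → τ ∈ Icc (0 : ℝ) (1 / 2) := fun hτ =>
    ⟨hτ.1, (m1 hτ).2.trans hτ₁'⟩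
  have hx1 : Measurable fun z : Obs K X => z.2.1 := by fun_prop
  have hx2 : Measurable fun z : Obs K X => z.2.2 := by fun_prop
  have hmeas : ∀ τ ∈ Icc 0 τ₀, Measurable fun z : Obs K X => ind z j.succ *
      (-M.δ * pathWeight M A β v g F₀ τ j i z.2.1 *
        (pathNext M β v g τ z.2.2 - pathCont M β v g τ τ j z.2.1)) := fun τ hτ =>
    (measurable_ind _).mul ((((h.measurable_pathWeight (mh hτ) j i).comp hx1).const_mul _).mul
      (((h.measurable_pathNext (mh hτ)).comp hx2).sub
        ((h.measurable_pathCont τ (mh hτ) j).comp hx1)))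
  simp only [adjCont_pathFirst]
  -- In the dominating function, `N + 2 * L` bounds the drift of `pathNext` and of `pathCont` away
  -- from the truth, as `τ ≤ 1`.
  refine IsNeutral.of_dominated h.density hτ₀ (fun τ hτ => (hmeas τ hτ).aestronglyMeasurable)
    (dom := fun z => ind z j.succ * (|M.δ| * b z.2.1 *
      (|pathNext M β v g 0 z.2.2 - pathCont M β v g 0 0 j z.2.1| + (N + 2 * L)))) ?_ ?_ ?_ ?_
  -- Integrating out `w` first replaces the deviation by the uniform bound `D`; what remains is a
  -- multiple of `b`, so integrability of a product of `b` with `v` is never needed.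
  · refine h.law.integrable_of_le (B := fun x => |M.δ| * b x * (|D| + (N + 2 * L))) ?_
      ((hb.const_mul _).mul_const _) ?_
    · exact (measurable_ind _).mul (((hbm.comp hx1).const_mul _).mul
        ((continuous_abs.measurable.comp (((h.measurable_pathNext ⟨le_rfl, by norm_num⟩).comp
          hx2).sub ((h.measurable_pathCont 0 ⟨le_rfl, by norm_num⟩ j).comp hx1))).add_const _))
    · filter_upwards [hD] with x hx k
      have hi : Integrable (fun w => |pathNext M β v g 0 w - pathCont M β v g 0 0 j x| +
          (N + 2 * L)) (M.trans k x) :=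
        (((h.integrable_pathNext_zero_slice k x).sub (integrable_const _)).abs).add
          (integrable_const _)
      -- On the slice `y = k` the indicator of choice `j.succ` is the constant `Pi.single k 1
      -- j.succ`.
      refine ⟨(hi.const_mul (|M.δ| * b x)).const_mul ((Pi.single k 1 : Fin (K + 1) → ℝ) j.succ), ?_⟩
      by_cases hk : k = j.succ
      · subst hk
        have e : ∀ w, |ind ((j.succ, x, w) : Obs K X) j.succ * (|M.δ| * b x *
            (|pathNext M β v g 0 w - pathCont M β v g 0 0 j x| + (N + 2 * L)))| =
            |M.δ| * b x *
              (|pathNext M β v g 0 w - pathCont M β v g 0 0 j x| + (N + 2 * L)) := fun w => by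
          have := hb0 x
          rw [ind_eq, if_pos rfl, one_mul, abs_of_nonneg (by positivity)]
        simp only [e]
        have hi0 : Integrable (fun w => |pathNext M β v g 0 w - pathCont M β v g 0 0 j x|)
            (M.trans j.succ x) :=
          ((h.integrable_pathNext_zero_slice j.succ x).sub (integrable_const _)).abs
        rw [integral_const_mul, integral_add hi0 (integrable_const _)]
        have hb' := hb0 x
        have hp0 := (h.law.pos x j.succ).le
        have hp1 := h.law.p_le_one x j.succ
        have hI : 0 ≤ ∫ w, |pathNext M β v g 0 w - pathCont M β v g 0 0 j x|
            ∂(M.trans j.succ x) := integral_nonneg fun w => abs_nonneg _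
        simp only [integral_const, probReal_univ, one_smul]
        refine (mul_le_of_le_one_left (by positivity) hp1).trans ?_
        refine mul_le_mul_of_nonneg_left ?_ (by positivity)
        linarith [hx j, le_abs_self D]
      · have e : ∀ w, ind ((k, x, w) : Obs K X) j.succ = 0 := fun w => by
          rw [ind_eq, if_neg hk]
        have := hb0 x
        simp only [e, zero_mul, abs_zero, integral_zero, mul_zero]
        positivity
  · filter_upwards [h.law.ae_state hbd, h.law.ae_state hcont, h.law.ae_next hnext]
      with z hz1 hz2 hz3 τ hτ
    have hW := (hz1 τ (m1 hτ) j i).1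
    have hc := hz2 τ (m2 hτ) τ (m2 hτ) j
    have hn := hz3 τ (m3 hτ)
    have hτ1 : τ ≤ 1 := (mh hτ).2.trans (by norm_num)
    rw [abs_mul, abs_of_nonneg (ind_nonneg z _)]
    refine mul_le_mul_of_nonneg_left ?_ (ind_nonneg z _)
    rw [abs_mul, abs_mul, abs_neg]
    have h1 : |pathNext M β v g τ z.2.2 - pathCont M β v g τ τ j z.2.1| ≤
        |pathNext M β v g 0 z.2.2 - pathCont M β v g 0 0 j z.2.1| + (N + 2 * L) := by
      have e : pathNext M β v g τ z.2.2 - pathCont M β v g τ τ j z.2.1 =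
          (pathNext M β v g 0 z.2.2 - pathCont M β v g 0 0 j z.2.1) +
            ((pathNext M β v g τ z.2.2 - pathNext M β v g 0 z.2.2) -
              (pathCont M β v g τ τ j z.2.1 - pathCont M β v g 0 0 j z.2.1)) := by ring
      rw [e]
      refine (abs_add_le _ _).trans (add_le_add le_rfl ((abs_sub _ _).trans (add_le_add ?_ ?_)))
      · exact hn.trans (mul_le_of_le_one_left hN hτ1)
      · refine hc.trans ?_
        nlinarith
    have := hb0 z.2.1
    gcongr
  · filter_upwards [h.law.ae_state (h.tendsto_pathWeight j i), h.law.ae_state h.tendsto_pathCont]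
      with z hz1 hz2
    exact ((hz1.const_mul _).mul ((h.tendsto_pathNext z.2.2).sub (hz2 j))).const_mul _
  · intro τ hτ hint
    have e : ∀ z : Obs K X, tilt g τ z * (ind z j.succ *
        (-M.δ * pathWeight M A β v g F₀ τ j i z.2.1 *
          (pathNext M β v g τ z.2.2 - pathCont M β v g τ τ j z.2.1))) =
        ind z j.succ * (-M.δ * pathWeight M A β v g F₀ τ j i z.2.1 * (tilt g τ z *
          (pathNext M β v g τ z.2.2 - pathCont M β v g τ τ j z.2.1))) := fun z => by ring
    have hint' := integrable_tilt_mul h.density (mh hτ) hint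
    simp only [e] at hint' ⊢
    rw [h.law.integral_ind_mul_of_integrable j.succ hint']
    refine integral_eq_zero_of_ae ?_
    filter_upwards [h.law.integrable_slice (h.law.integrable_next (hni τ (m4 hτ)))] with x hx
    have hx' := hx j.succ
    have ht := h.half_le_tiltMean (mh hτ) j.succ x
    -- `pathCont` is the mean of `pathNext` under the contaminated kernel, so the residual has mean
    -- zero on almost every slice.
    have hz : ∫ w, tilt g τ (j.succ, x, w) * (pathNext M β v g τ w - pathCont M β v g τ τ j x)
        ∂(M.trans j.succ x) = 0 := by
      simp_rw [mul_sub]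
      have i1 : Integrable (fun w => tilt g τ (j.succ, x, w) * pathNext M β v g τ w)
        (M.trans j.succ x) := integrable_tilt_mul (h.density_slice j.succ x) (mh hτ) hx'
      have i2 : Integrable (fun w => tilt g τ (j.succ, x, w) * pathCont M β v g τ τ j x)
        (M.trans j.succ x) := (integrable_tilt (h.density_slice j.succ x) τ).mul_const _
      rw [integral_sub i1 i2, integral_mul_const, h.integral_tilt_slice, h.pathCont_eq,
        mul_div_cancel₀ _ (by linarith), sub_self]
    simp only [integral_const_mul, hz, mul_zero, Pi.zero_apply]

/-- The mean of the adjustment term of the `j`-th conditional expectation in the direction of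
contamination. -/
lemma integral_adjCont (h : Contamination M A β v μ F₀ G g C) (j : Fin K) (i : Fin r) :
    ∫ z, g z * M.adjCont A β (pathFirst M β v g F₀ Selection.full 0) j z i ∂F₀ =
      -M.δ * ∫ x, M.instDeriv A j x (M.valueDiff β v x) i * contDir M β v g j x ∂μ := by
  have hint := h.density.integrable_mul (h.isNeutral_adjCont j i).integrable_zero
  have e : ∀ z : Obs K X, g z * M.adjCont A β (pathFirst M β v g F₀ Selection.full 0) j z i =
      ind z j.succ * (-M.δ * pathWeight M A β v g F₀ 0 j i z.2.1 * (g z *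
        (pathNext M β v g 0 z.2.2 - pathCont M β v g 0 0 j z.2.1))) := fun z => by
    rw [adjCont_pathFirst]; ring
  simp only [e] at hint ⊢
  rw [h.law.integral_ind_mul_of_integrable j.succ hint, ← integral_const_mul]
  refine integral_congr_ae (ae_of_all _ fun x => ?_)
  simp only
  rw [integral_const_mul, pathCont_zero, pathWeight, h.pathVal_zero, contDir]
  -- At the truth `P_j(ṽ)` is the choice probability `p_j(x)`, so the inverse weighting in
  -- `pathWeight` cancels it.
  have := (h.law.pos x j.succ).ne'
  unfold Model.trueProb at this ⊢
  field_simp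

end Contamination

end DDC

/-! ### The additional unknowns, and the adjustment for the renewal expectation. -/

namespace DDC

section Mix

variable {Z : Type*} [MeasurableSpace Z] {F₀ G : Measure Z} {g : Z → ℝ} {C τ₀ : ℝ}

lemma tendsto_tilt (z : Z) : Tendsto (fun τ => tilt g τ z) (𝓝[>] 0) (𝓝 (tilt g 0 z)) := by
  have : Continuous fun τ => tilt g τ z := by unfold tilt; fun_prop
  exact (this.tendsto 0).mono_left nhdsWithin_le_nhds

lemma tendsto_integral_tilt_mul (hg : HasBoundedDensity F₀ G g C) (hτ₀ : 0 < τ₀)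
    (hτ₀' : τ₀ ≤ 1 / 2) {φ : ℝ → Z → ℝ} (hm : ∀ τ ∈ Icc 0 τ₀, AEStronglyMeasurable (φ τ) F₀)
    {dom : Z → ℝ} (hdom : Integrable dom F₀) (hle : ∀ᵐ z ∂F₀, ∀ τ ∈ Icc 0 τ₀, |φ τ z| ≤ dom z)
    (hlim : ∀ᵐ z ∂F₀, Tendsto (fun τ => φ τ z) (𝓝[>] 0) (𝓝 (φ 0 z))) :
    Tendsto (fun τ => ∫ z, tilt g τ z * φ τ z ∂F₀) (𝓝[>] 0)
      (𝓝 (∫ z, tilt g 0 z * φ 0 z ∂F₀)) := by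
  refine tendsto_integral_filter_of_dominated_convergence (fun z => (1 + C) * dom z) ?_ ?_
    (hdom.const_mul _) ?_
  · filter_upwards [eventually_Icc_right hτ₀] with τ hτ
    exact (hg.measurable_tilt τ).aestronglyMeasurable.mul (hm τ hτ)
  · filter_upwards [eventually_Icc_right hτ₀] with τ hτ
    have hτ' : τ ∈ Icc (0 : ℝ) (1 / 2) := ⟨hτ.1, hτ.2.trans hτ₀'⟩
    filter_upwards [hle] with z h1
    have h2 := hg.tilt_nonneg hτ' z
    rw [norm_mul, Real.norm_of_nonneg h2]
    exact mul_le_mul (hg.tilt_le hτ' z) (h1 τ hτ) (norm_nonneg _)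
      (h2.trans (hg.tilt_le hτ' z))
  · filter_upwards [hlim] with z h1 using (tendsto_tilt z).mul h1

lemma tendsto_integral_mix (hg : HasBoundedDensity F₀ G g C) (hτ₀ : 0 < τ₀)
    (hτ₀' : τ₀ ≤ 1 / 2) {φ : ℝ → Z → ℝ} (hm : ∀ τ ∈ Icc 0 τ₀, AEStronglyMeasurable (φ τ) F₀)
    {dom : Z → ℝ} (hdom : Integrable dom F₀) (hle : ∀ᵐ z ∂F₀, ∀ τ ∈ Icc 0 τ₀, |φ τ z| ≤ dom z)
    (hlim : ∀ᵐ z ∂F₀, Tendsto (fun τ => φ τ z) (𝓝[>] 0) (𝓝 (φ 0 z))) :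
    Tendsto (fun τ => ∫ z, φ τ z ∂(mix F₀ G τ)) (𝓝[>] 0) (𝓝 (∫ z, φ 0 z ∂(mix F₀ G 0))) := by
  rw [integral_mix hg ⟨le_rfl, by norm_num⟩]
  refine (tendsto_integral_tilt_mul hg hτ₀ hτ₀' hm hdom hle hlim).congr' ?_
  filter_upwards [eventually_Icc_right hτ₀] with τ hτ
  rw [integral_mix hg ⟨hτ.1, hτ.2.trans hτ₀'⟩]

end Mix

lemma integral_abs_condMean_le {Z S : Type*} [MeasurableSpace Z] [MeasurableSpace S]
    {F : Measure Z} [IsFiniteMeasure F] {f : Z → ℝ} {h : Z → S} (hh : Measurable h)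
    (hf : Integrable f F) : ∫ z, |condMean F f h (h z)| ∂F ≤ ∫ z, |f z| ∂F := by
  refine le_trans (le_of_eq (integral_congr_ae ?_)) (integral_abs_condExp_le
    (m := MeasurableSpace.comap h inferInstance) f)
  filter_upwards [condExp_ae_eq_condMean hh hf] with z hz
  rw [hz]

section Path

variable {K r : ℕ} {X Θ : Type*} [MeasurableSpace X] (M : Model K X Θ)
  (A : X → Matrix (Fin r) (Fin (K + 1)) ℝ) (β : Θ) (v : X → ℝ)
  (g : Obs K X → ℝ) (F₀ G : Measure (Obs K X)) [IsFiniteMeasure F₀] [IsFiniteMeasure G]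

/-- The additional unknowns along the path. -/
noncomputable def pathNuisance (τ : ℝ) : Nuisance K r X where
  revRenew x := condMean (mix F₀ G τ) (fun z => ind z 0) (fun z => z.2.2) x
  rev j x i := condMean (mix F₀ G τ)
    (fun z => M.weight A β (pathFirst M β v g F₀ Selection.full τ) j z i) (fun z => z.2.2) x
  probRenew := (mix F₀ G τ).real {z | z.1 = 0}
  mean j i := ∫ z, M.instDeriv A j z.2.1 (pathVal M β v g F₀ τ z.2.1) i ∂(mix F₀ G τ)

/-- First-order effect on `H` of moving the choice probabilities towards a choice. -/
noncomputable def pathScore (τ : ℝ) (x : X) (k : Fin (K + 1)) : ℝ :=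
  surplusDeriv M.errorLaw (pathProb M β v g τ x) (Pi.single k 1 - pathProb M β v g τ x)

/-- Mean effect on `H` given the state, in the direction of contamination. -/
noncomputable def pathScoreDir (τ : ℝ) (x : X) : ℝ :=
  ∑ k, M.trueProb β v x k * (densityMean M g k x - 1) * pathScore M β v g τ x k

/-- Separates a coefficient depending on `τ` only from a residual given the renewal choice, so that
`IsNeutral.const_mul` applies. -/
lemma adjRenew_path (τ : ℝ) (i : Fin r) (z : Obs K X) :
    M.adjRenew β (pathFirst M β v g F₀ Selection.full τ) (pathNuisance M A β v g F₀ G τ) z i =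
      (M.δ * ((mix F₀ G τ).real {z | z.1 = 0})⁻¹ *
        ∑ j, (pathNuisance M A β v g F₀ G τ).mean j i) *
      (ind z 0 * (pathNext M β v g τ z.2.2 - pathRenew M β v g F₀ τ τ)) := by
  simp only [Model.adjRenew, Pi.smul_apply, smul_eq_mul, Finset.sum_apply, Model.nextTerm,
    pathFirst, Selection.full, one_mul, pathNext, pathNuisance]
  ring

/-- Splits `φ₁` into products of the score with one reverse conditional mean each, with coefficients
depending on `τ` only. -/
lemma adjCcp_path (τ : ℝ) (i : Fin r) (z : Obs K X) :
    M.adjCcp β (pathFirst M β v g F₀ Selection.full τ) (pathNuisance M A β v g F₀ G τ) z i =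
      ∑ j, (-M.δ * (pathScore M β v g τ z.2.1 z.1 *
          (pathNuisance M A β v g F₀ G τ).rev j z.2.1 i) +
        (M.δ * ((mix F₀ G τ).real {z | z.1 = 0})⁻¹ * (pathNuisance M A β v g F₀ G τ).mean j i) *
          (pathScore M β v g τ z.2.1 z.1 * (pathNuisance M A β v g F₀ G τ).revRenew z.2.1)) := by
  simp only [Model.adjCcp, Pi.smul_apply, smul_eq_mul, Finset.sum_apply, Pi.sub_apply]
  rw [Finset.mul_sum]
  refine Finset.sum_congr rfl fun j _ => ?_
  simp only [pathFirst, Selection.full, one_mul, pathScore, ind]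
  simp only [pathNuisance]
  ring

end Path

namespace Contamination

variable {K r : ℕ} {X Θ : Type*} [MeasurableSpace X] {M : Model K X Θ}
  {A : X → Matrix (Fin r) (Fin (K + 1)) ℝ} {β : Θ} {v : X → ℝ} {μ : Measure X}
  [IsProbabilityMeasure μ] {F₀ G : Measure (Obs K X)} [IsProbabilityMeasure F₀]
  [IsFiniteMeasure G] {g : Obs K X → ℝ} {C : ℝ}

lemma tendsto_probRenew (h : Contamination M A β v μ F₀ G g C) :
    Tendsto (fun τ => (mix F₀ G τ).real {z | z.1 = 0}) (𝓝[>] 0)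
      (𝓝 ((mix F₀ G 0).real {z | z.1 = 0})) := by
  simp_rw [measureReal_choice]
  exact tendsto_integral_mix h.density (τ₀ := 1 / 2) (by norm_num) le_rfl
    (φ := fun _ z => ind z 0) (dom := fun _ => 1)
    (fun _ _ => (measurable_ind 0).aestronglyMeasurable) (integrable_const _)
    (ae_of_all _ fun z _ _ => abs_ind_le_one z 0) (ae_of_all _ fun z => tendsto_const_nhds)

lemma tendsto_mean (h : Contamination M A β v μ F₀ G g C) (j : Fin K) (i : Fin r) :
    Tendsto (fun τ => (pathNuisance M A β v g F₀ G τ).mean j i) (𝓝[>] 0)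
      (𝓝 ((pathNuisance M A β v g F₀ G 0).mean j i)) := by
  obtain ⟨τ₀, hτ₀, hτ₀', b, -, hb, -, hbd⟩ := h.exists_pathWeight_bound
  refine tendsto_integral_mix h.density hτ₀ hτ₀'
    (φ := fun τ z => M.instDeriv A j z.2.1 (pathVal M β v g F₀ τ z.2.1) i)
    (fun τ hτ => ((h.measurable_instDeriv (h.measurable_pathVal ⟨hτ.1, hτ.2.trans hτ₀'⟩) j
      i).comp (by fun_prop)).aestronglyMeasurable) (h.law.integrable_state hb) ?_
    (h.law.ae_state (h.tendsto_instDeriv j i))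
  filter_upwards [h.law.ae_state hbd] with z hz τ hτ using (hz τ hτ j i).2

lemma mean_zero (h : Contamination M A β v μ F₀ G g C) (j : Fin K) (i : Fin r) :
    (pathNuisance M A β v g F₀ G 0).mean j i =
      ∫ x, M.instDeriv A j x (M.valueDiff β v x) i ∂μ := by
  simp only [pathNuisance, mix_zero]
  rw [h.law.integral_state (f := fun x => M.instDeriv A j x (pathVal M β v g F₀ 0 x) i)
    (h.measurable_instDeriv (h.measurable_pathVal ⟨le_rfl, by norm_num⟩) j i).aestronglyMeasurable]
  simp_rw [h.pathVal_zero]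

section Renewal

lemma isNeutral_renew (h : Contamination M A β v μ F₀ G g C) :
    IsNeutral F₀ g fun τ z =>
      ind z 0 * (pathNext M β v g τ z.2.2 - pathRenew M β v g F₀ τ τ) := by
  obtain ⟨L, τ₂, hL, hτ₂, hτ₂', -, hren⟩ := h.exists_path_lipschitz
  obtain ⟨N, τ₃, hN, hτ₃, hτ₃', hnext, -⟩ := h.exists_pathNext_lipschitz
  obtain ⟨τ₄, hτ₄, hτ₄', hni⟩ := h.exists_pathNext_integrable
  set τ₀ := min τ₂ (min τ₃ τ₄)
  have hτ₀ : 0 < τ₀ := lt_min hτ₂ (lt_min hτ₃ hτ₄)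
  have m2 : ∀ {τ}, τ ∈ Icc 0 τ₀ → τ ∈ Icc 0 τ₂ := fun hτ => ⟨hτ.1, hτ.2.trans (min_le_left _ _)⟩
  have m3 : ∀ {τ}, τ ∈ Icc 0 τ₀ → τ ∈ Icc 0 τ₃ := fun hτ =>
    ⟨hτ.1, hτ.2.trans ((min_le_right _ _).trans (min_le_left _ _))⟩
  have m4 : ∀ {τ}, τ ∈ Icc 0 τ₀ → τ ∈ Icc 0 τ₄ := fun hτ =>
    ⟨hτ.1, hτ.2.trans ((min_le_right _ _).trans (min_le_right _ _))⟩
  have mh : ∀ {τ}, τ ∈ Icc 0 τ₀ → τ ∈ Icc (0 : ℝ) (1 / 2) := fun hτ =>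
    ⟨hτ.1, (m2 hτ).2.trans hτ₂'⟩
  have hx2 : Measurable fun z : Obs K X => z.2.2 := by fun_prop
  refine IsNeutral.of_dominated h.density hτ₀ (fun τ hτ => ((measurable_ind 0).mul
    (((h.measurable_pathNext (mh hτ)).comp hx2).sub_const _)).aestronglyMeasurable)
    (dom := fun z => |pathNext M β v g 0 z.2.2| + (|pathRenew M β v g F₀ 0 0| + (N + 2 * L)))
    ((h.law.integrable_next h.integrable_pathNext_zero).abs.add (integrable_const _)) ?_ ?_ ?_
  · filter_upwards [h.law.ae_next hnext] with z hz τ hτ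
    have hn := hz τ (m3 hτ)
    have hr := hren τ (m2 hτ) τ (m2 hτ)
    have hτ1 : τ ≤ 1 := (mh hτ).2.trans (by norm_num)
    rw [abs_mul, abs_of_nonneg (ind_nonneg z _)]
    refine (mul_le_of_le_one_left (abs_nonneg _) (ind_le_one z _)).trans ?_
    have e : pathNext M β v g τ z.2.2 - pathRenew M β v g F₀ τ τ =
        (pathNext M β v g 0 z.2.2 - pathRenew M β v g F₀ 0 0) +
          ((pathNext M β v g τ z.2.2 - pathNext M β v g 0 z.2.2) -
            (pathRenew M β v g F₀ τ τ - pathRenew M β v g F₀ 0 0)) := by ring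
    rw [e, ← add_assoc]
    refine (abs_add_le _ _).trans (add_le_add (abs_sub _ _)
      ((abs_sub _ _).trans (add_le_add ?_ ?_)))
    · exact hn.trans (mul_le_of_le_one_left hN hτ1)
    · refine hr.trans ?_
      nlinarith
  · exact ae_of_all _ fun z => ((h.tendsto_pathNext z.2.2).sub h.tendsto_pathRenew).const_mul _
  · intro τ hτ _
    have hpos := h.measureReal_choice_mix_pos (mh hτ) 0
    have h0 := h.measureReal_choice_pos 0
    have i1 : Integrable (fun z : Obs K X => ind z 0 * pathNext M β v g τ z.2.2) F₀ :=
      (h.law.integrable_next (hni τ (m4 hτ))).bdd_mul (c := 1)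
        (measurable_ind 0).aestronglyMeasurable (ae_of_all _ fun z => abs_ind_le_one z 0)
    have i2 : Integrable (fun z : Obs K X => ind z 0 * pathRenew M β v g F₀ τ τ) F₀ :=
      (integrable_ind 0).mul_const _
    simp_rw [mul_sub]
    rw [integral_sub (integrable_tilt_mul h.density (mh hτ) i1)
      (integrable_tilt_mul h.density (mh hτ) i2)]
    simp_rw [← mul_assoc]
    rw [integral_mul_const, ← integral_mix h.density (mh hτ), ← measureReal_choice]
    -- `pathRenew` is the mean of `pathNext` on `y = 0` under the contaminated law, so the residual
    -- integrates to zero there.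
    have e : pathRenew M β v g F₀ τ τ = (∫ z, tilt g τ z * ind z 0 * pathNext M β v g τ z.2.2 ∂F₀) /
        (mix F₀ G τ).real {z | z.1 = 0} := by
      rw [pathRenew, tiltedMean, integral_cond_choice, integral_cond_choice,
        measureReal_choice (mix F₀ G τ), integral_mix h.density (mh hτ),
        mul_div_mul_left _ _ (inv_ne_zero h0.ne')]
      simp only [mul_comm, mul_assoc]
    rw [e, mul_div_cancel₀ _ hpos.ne', sub_self]

lemma isNeutral_adjRenew (h : Contamination M A β v μ F₀ G g C) (i : Fin r) :
    IsNeutral F₀ g fun τ z =>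
      M.adjRenew β (pathFirst M β v g F₀ Selection.full τ) (pathNuisance M A β v g F₀ G τ) z i := by
  simp only [adjRenew_path]
  refine h.isNeutral_renew.const_mul (c := fun τ => M.δ * ((mix F₀ G τ).real {z | z.1 = 0})⁻¹ *
    ∑ j, (pathNuisance M A β v g F₀ G τ).mean j i) ?_
  refine ((h.tendsto_probRenew.inv₀ ?_).const_mul _).mul
    (tendsto_finsetSum _ fun j _ => h.tendsto_mean j i)
  exact (h.measureReal_choice_mix_pos ⟨le_rfl, by norm_num⟩ 0).ne'

/-- The factor `π₁⁻¹` turns the integral over `y = 0` into the conditional expectation defining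
`renewDir`. -/
lemma integral_adjRenew (h : Contamination M A β v μ F₀ G g C) (i : Fin r) :
    ∫ z, g z * M.adjRenew β (pathFirst M β v g F₀ Selection.full 0)
      (pathNuisance M A β v g F₀ G 0) z i ∂F₀ =
      M.δ * ∑ j, (∫ x, M.instDeriv A j x (M.valueDiff β v x) i ∂μ) * renewDir M β v g F₀ := by
  have e : ∀ z : Obs K X, ∀ c : ℝ, g z * (c * (ind z 0 * (pathNext M β v g 0 z.2.2 -
      pathRenew M β v g F₀ 0 0))) = c * (ind z 0 * (g z * (pathNext M β v g 0 z.2.2 -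
        pathRenew M β v g F₀ 0 0))) := fun z c => by ring
  simp_rw [adjRenew_path, e]
  rw [integral_const_mul, ← Finset.sum_mul, renewDir, integral_cond_choice, ← h.pathRenew_zero]
  simp_rw [h.mean_zero, mix_zero]
  ring

end Renewal

end Contamination

end DDC

/-! ### Reverse conditional means, and the adjustment for the choice probabilities. -/

namespace DDC

/-- The reverse conditional expectation given the next state, under the contaminated law. -/
noncomputable def reverseMean {K : ℕ} {X : Type*} [MeasurableSpace X]
    (F₀ G : Measure (Obs K X)) [IsFiniteMeasure F₀] [IsFiniteMeasure G]
    (T : ℝ → Obs K X → ℝ) (τ : ℝ) : X → ℝ :=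
  condMean (mix F₀ G τ) (T τ) fun z => z.2.2

namespace Contamination

variable {K r : ℕ} {X Θ : Type*} [MeasurableSpace X] {M : Model K X Θ}
  {A : X → Matrix (Fin r) (Fin (K + 1)) ℝ} {β : Θ} {v : X → ℝ} {μ : Measure X}
  [IsProbabilityMeasure μ] {F₀ G : Measure (Obs K X)} [IsProbabilityMeasure F₀]
  [IsFiniteMeasure G] {g : Obs K X → ℝ} {C : ℝ}

lemma measurable_pathScore (h : Contamination M A β v μ F₀ G g C) (τ : ℝ) (k : Fin (K + 1)) :
    Measurable fun x => pathScore M β v g τ x k :=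
  measurable_surplusDeriv_comp (h.measurable_pathProb τ)
    (measurable_const.sub (h.measurable_pathProb τ))

lemma measurable_pathScoreDir (h : Contamination M A β v μ F₀ G g C) (τ : ℝ) :
    Measurable (pathScoreDir M β v g τ) :=
  Finset.measurable_sum _ fun k _ => ((h.law.measurable_p k).mul
    ((h.measurable_densityMean k).sub_const 1)).mul (h.measurable_pathScore τ k)

lemma measurable_score (h : Contamination M A β v μ F₀ G g C) (τ : ℝ) :
    Measurable fun z : Obs K X => pathScore M β v g τ z.2.1 z.1 := by
  have e : (fun z : Obs K X => pathScore M β v g τ z.2.1 z.1) =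
      fun z => ∑ k, ind z k * pathScore M β v g τ z.2.1 k := by
    funext z
    simp [ind, Pi.single_apply]
  rw [e]
  exact Finset.measurable_sum _ fun k _ =>
    (measurable_ind k).mul ((h.measurable_pathScore τ k).comp (by fun_prop))

/-- With `q` the path probabilities, `p_k (e_k - q)` is a bounded relative change of `p`: its `k`-th
coordinate is at most `p_k`, and for `j ≠ k` its size is at most `q_j ≤ (1 + C) p_j`. Without the
factor `p_k` the domination hypothesis gives no bound uniform in the state. -/
lemma exists_pathScore_bound (h : Contamination M A β v μ F₀ G g C) :
    ∃ B τ₀ : ℝ, 0 ≤ B ∧ 0 < τ₀ ∧ τ₀ ≤ 1 / 2 ∧ ∀ᵐ x ∂μ, ∀ τ ∈ Icc 0 τ₀, ∀ k,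
      M.trueProb β v x k * |pathScore M β v g τ x k| ≤ B := by
  obtain ⟨η, C₁, τ₀, -, hC₁, hτ₀, hτ₀', hτη, hdom⟩ := h.exists_surplusDominated
  have hC := h.nonneg
  refine ⟨(1 + C) * C₁, τ₀, by positivity, hτ₀, hτ₀', ?_⟩
  filter_upwards [hdom] with x hx τ hτ k
  have hτ' : τ ∈ Icc (0 : ℝ) (1 / 2) := ⟨hτ.1, hτ.2.trans hτ₀'⟩
  have hp := h.law.pos x
  have hq := h.pathProb_pos hτ' x
  have hqs := h.sum_pathProb hτ' x
  have hq1 : ∀ j, pathProb M β v g τ x j ≤ 1 := fun j => by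
    rw [← hqs]
    exact Finset.single_le_sum (f := pathProb M β v g τ x) (fun k _ => (hq k).le)
      (Finset.mem_univ j)
  have e : M.trueProb β v x k * |pathScore M β v g τ x k| = |surplusDeriv M.errorLaw
      (pathProb M β v g τ x) (M.trueProb β v x k • (Pi.single k 1 - pathProb M β v g τ x))| := by
    rw [surplusDeriv_smul, abs_mul, abs_of_pos (hp k), pathScore]
  rw [e]
  refine hx.bound hqs (fun j => (h.abs_pathProb_sub_le hτ' x j).trans
    (mul_le_mul_of_nonneg_right ?_ (hp j).le)) ?_ (by positivity) fun j => ?_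
  · exact (mul_le_mul_of_nonneg_right hτ.2 (by positivity)).trans hτη
  · simp [← Finset.mul_sum, hqs]
  · rw [Pi.smul_apply, smul_eq_mul, abs_mul, abs_of_pos (hp k), Pi.sub_apply]
    by_cases hjk : j = k
    · subst hjk
      rw [Pi.single_eq_same, abs_of_nonneg (by linarith [hq1 j]), mul_comm]
      refine mul_le_mul_of_nonneg_right ?_ (hp j).le
      linarith [hq j]
    · rw [Pi.single_eq_of_ne hjk, zero_sub, abs_neg, abs_of_pos (hq j)]
      exact (mul_le_of_le_one_left (hq j).le (h.law.p_le_one x k)).trans (h.pathProb_le hτ' x j)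

lemma tendsto_pathScore (h : Contamination M A β v μ F₀ G g C) (x : X) (k : Fin (K + 1)) :
    Tendsto (fun τ => pathScore M β v g τ x k) (𝓝[>] 0) (𝓝 (pathScore M β v g 0 x k)) := by
  have h1 : ContinuousAt (fun τ => pathProb M β v g τ x) 0 := by
    simpa using continuousAt_pathProb (M := M) (β := β) (v := v) (g := g) 1 x
  have h2 : ContinuousAt (fun τ => Fin.tail (pathProb M β v g τ x)) 0 :=
    continuousAt_pi.2 fun j => (continuousAt_pi.1 h1) j.succ
  have h3 : ContinuousAt (fun τ => Fin.tail (Pi.single k 1 - pathProb M β v g τ x)) 0 :=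
    continuousAt_pi.2 fun j => continuousAt_const.sub ((continuousAt_pi.1 h1) j.succ)
  have h4 : ContinuousAt (fun τ => fderiv ℝ (surplusRed M.errorLaw)
      (Fin.tail (pathProb M β v g τ x))) 0 := by
    refine ContinuousAt.comp (g := fderiv ℝ (surplusRed M.errorLaw)) ?_ h2
    refine continuousAt_fderiv_surplusRed h.regular.smooth_surplus ?_
    rw [pathProb_zero]
    exact tail_mem_openSimplex (h.law.pos x) (h.law.sum_one x)
  exact (h4.clm_apply h3).tendsto.mono_left nhdsWithin_le_nhds

lemma tendsto_pathScoreDir (h : Contamination M A β v μ F₀ G g C) (x : X) :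
    Tendsto (fun τ => pathScoreDir M β v g τ x) (𝓝[>] 0) (𝓝 (pathScoreDir M β v g 0 x)) :=
  tendsto_finsetSum _ fun k _ => (h.tendsto_pathScore x k).const_mul _

/-- The weights are proportional to the path probabilities `q`, and `∑ q_k (e_k - q) = 0`. This is
the conditional mean zero of the score given the state under the contaminated law. -/
lemma sum_mul_pathScore (h : Contamination M A β v μ F₀ G g C) {τ : ℝ}
    (hτ : τ ∈ Icc (0 : ℝ) (1 / 2)) (x : X) :
    ∑ k, M.trueProb β v x k * tiltMean M g τ k x * pathScore M β v g τ x k = 0 := by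
  have hT : tiltTotal M β v g τ x ≠ 0 := by linarith [h.half_le_tiltTotal hτ x]
  have e : ∀ k, M.trueProb β v x k * tiltMean M g τ k x * pathScore M β v g τ x k =
      tiltTotal M β v g τ x * surplusDeriv M.errorLaw (pathProb M β v g τ x)
        (pathProb M β v g τ x k • (Pi.single k 1 - pathProb M β v g τ x)) := fun k => by
    rw [surplusDeriv_smul, ← mul_assoc]
    congr 1
    rw [pathProb]
    field_simp
  have hs : ∑ k, pathProb M β v g τ x k • (Pi.single k (1 : ℝ) - pathProb M β v g τ x) = 0 := by
    funext j
    simp [mul_sub, Finset.sum_sub_distrib, ← Finset.sum_mul, h.sum_pathProb hτ x, Pi.single_apply]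
  simp_rw [e]
  rw [← Finset.mul_sum, ← surplusDeriv_sum, hs, surplusDeriv_zero, mul_zero]

/-- By linearity the directions `p_k (densityMean_k - 1) (e_k - p)` may be summed first, and their
sum is `probDir`. -/
lemma pathScoreDir_zero (h : Contamination M A β v μ F₀ G g C) (x : X) :
    pathScoreDir M β v g 0 x = surplusDir M β v g x := by
  have e : ∀ k, M.trueProb β v x k * (densityMean M g k x - 1) * pathScore M β v g 0 x k =
      surplusDeriv M.errorLaw (M.trueProb β v x) ((M.trueProb β v x k *
        (densityMean M g k x - 1)) • (Pi.single k 1 - M.trueProb β v x)) := fun k => by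
    rw [surplusDeriv_smul, pathScore, pathProb_zero]
  unfold pathScoreDir surplusDir
  simp_rw [e]
  rw [← surplusDeriv_sum]
  congr 1
  funext j
  simp only [Finset.sum_apply, Pi.smul_apply, Pi.sub_apply, smul_eq_mul, mul_sub,
    Finset.sum_sub_distrib, ← Finset.sum_mul, Pi.single_apply, mul_ite, mul_one, mul_zero,
    Finset.sum_ite_eq, Finset.mem_univ, if_true, h.law.sum_one, probDir, densityTotal, sub_mul,
    one_mul]
  ring

section Score

variable {τ B : ℝ} {Λ : X → ℝ}

lemma abs_pathScoreDir_le (h : Contamination M A β v μ F₀ G g C) {x : X}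
    (hx : ∀ k, M.trueProb β v x k * |pathScore M β v g τ x k| ≤ B) :
    |pathScoreDir M β v g τ x| ≤ (K + 1) * ((1 + C) * B) := by
  have hC := h.nonneg
  calc |pathScoreDir M β v g τ x| ≤ ∑ k, |M.trueProb β v x k * (densityMean M g k x - 1) *
        pathScore M β v g τ x k| := Finset.abs_sum_le_sum_abs _ _
    _ ≤ ∑ _k : Fin (K + 1), (1 + C) * B := by
        refine Finset.sum_le_sum fun k _ => ?_
        have hp := (h.law.pos x k).le
        rw [abs_mul, abs_mul, abs_of_nonneg hp, mul_right_comm, mul_comm]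
        exact mul_le_mul (h.abs_densityMean_sub_one_le k x) (hx k)
          (mul_nonneg hp (abs_nonneg _)) (by positivity)
    _ = _ := by simp

lemma integrable_score_mul (h : Contamination M A β v μ F₀ G g C) (hΛm : Measurable Λ)
    (hΛ : Integrable Λ μ)
    (hB : ∀ᵐ x ∂μ, ∀ k, M.trueProb β v x k * |pathScore M β v g τ x k| ≤ B) :
    Integrable (fun z : Obs K X => pathScore M β v g τ z.2.1 z.1 * Λ z.2.1) F₀ := by
  refine h.law.integrable_of_le ((h.measurable_score τ).mul (hΛm.comp (by fun_prop)))
    (hΛ.abs.const_mul B) ?_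
  filter_upwards [hB] with x hx k
  refine ⟨integrable_const _, ?_⟩
  simp only [integral_const, probReal_univ, one_smul]
  rw [abs_mul, ← mul_assoc]
  exact mul_le_mul_of_nonneg_right (hx k) (abs_nonneg _)

lemma integral_mul_score_mul (h : Contamination M A β v μ F₀ G g C) (hΛm : Measurable Λ)
    (hΛ : Integrable Λ μ)
    (hB : ∀ᵐ x ∂μ, ∀ k, M.trueProb β v x k * |pathScore M β v g τ x k| ≤ B)
    {l : Obs K X → ℝ} (hl : Measurable l) {c : ℝ} (hlc : ∀ z, ‖l z‖ ≤ c) :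
    ∫ z, l z * (pathScore M β v g τ z.2.1 z.1 * Λ z.2.1) ∂F₀ =
      ∫ x, (∑ k, M.trueProb β v x k * (∫ w, l (k, x, w) ∂(M.trans k x)) *
        pathScore M β v g τ x k) * Λ x ∂μ := by
  rw [h.law.integral_eq ((h.integrable_score_mul hΛm hΛ hB).bdd_mul hl.aestronglyMeasurable
    (ae_of_all _ hlc))]
  refine integral_congr_ae (ae_of_all _ fun x => ?_)
  simp only
  rw [Finset.sum_mul]
  refine Finset.sum_congr rfl fun k _ => ?_
  rw [integral_mul_const]
  ring

lemma integral_tilt_mul_score_mul (h : Contamination M A β v μ F₀ G g C)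
    (hτ : τ ∈ Icc (0 : ℝ) (1 / 2)) (hΛm : Measurable Λ) (hΛ : Integrable Λ μ)
    (hB : ∀ᵐ x ∂μ, ∀ k, M.trueProb β v x k * |pathScore M β v g τ x k| ≤ B) :
    ∫ z, tilt g τ z * (pathScore M β v g τ z.2.1 z.1 * Λ z.2.1) ∂F₀ = 0 := by
  rw [h.integral_mul_score_mul hΛm hΛ hB (h.density.measurable_tilt τ) (c := 1 + C) fun z => by
    rw [Real.norm_of_nonneg (h.density.tilt_nonneg hτ z)]; exact h.density.tilt_le hτ z]
  simp_rw [h.integral_tilt_slice, h.sum_mul_pathScore hτ]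
  simp

/-- Integrating out choice and next state leaves a function of the state alone. Because both states
have law `μ`, it can then be evaluated at the next state, where a reverse mean is a conditional
expectation. -/
lemma integral_sub_one_mul_score_mul (h : Contamination M A β v μ F₀ G g C)
    (hΛm : Measurable Λ) (hΛ : Integrable Λ μ)
    (hB : ∀ᵐ x ∂μ, ∀ k, M.trueProb β v x k * |pathScore M β v g τ x k| ≤ B) :
    ∫ z, (g z - 1) * (pathScore M β v g τ z.2.1 z.1 * Λ z.2.1) ∂F₀ =
      ∫ x, pathScoreDir M β v g τ x * Λ x ∂μ := by
  rw [h.integral_mul_score_mul hΛm hΛ hB (h.density.measurable.sub_const 1) h.density.abs_sub_one_le]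
  have e : ∀ k x, ∫ w, (g (k, x, w) - 1) ∂(M.trans k x) = densityMean M g k x - 1 := fun k x => by
    rw [integral_sub (h.integrable_density_slice k x) (integrable_const _)]
    simp [densityMean]
  simp_rw [e]
  rfl

end Score

section Reverse

variable {T : ℝ → Obs K X → ℝ} {τ₀ : ℝ} {dom : Obs K X → ℝ}

lemma integrable_reverseMean (h : Contamination M A β v μ F₀ G g C) {τ : ℝ}
    (hτ : τ ∈ Icc (0 : ℝ) (1 / 2)) (hT : Integrable (T τ) F₀) :
    Integrable (reverseMean F₀ G T τ) μ :=
  h.law.integrable_of_next (measurable_condMean _ _ _) (integrable_of_mix h.density hτ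
    (integrable_condMean (by fun_prop) (integrable_mix h.density hτ hT)))

/-- The tower property under the contaminated law, written with its density: the reverse mean is a
conditional expectation for that law, not for `F₀`. -/
lemma integral_tilt_mul_reverseMean (h : Contamination M A β v μ F₀ G g C) {τ : ℝ}
    (hτ : τ ∈ Icc (0 : ℝ) (1 / 2)) (hT : Integrable (T τ) F₀) {l : X → ℝ} (hl : Measurable l)
    {c : ℝ} (hc : ∀ᵐ x ∂μ, |l x| ≤ c) :
    ∫ z, tilt g τ z * (l z.2.2 * reverseMean F₀ G T τ z.2.2) ∂F₀ =
      ∫ z, tilt g τ z * (l z.2.2 * T τ z) ∂F₀ := by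
  rw [← integral_mix h.density hτ, ← integral_mix h.density hτ]
  exact integral_mul_condMean (h := fun z : Obs K X => z.2.2) (by fun_prop)
    (integrable_mix h.density hτ hT) hl (ae_mix_of_ae h.density hτ (h.law.ae_next hc))

/-- Conditional expectation contracts `L¹` of the contaminated law; passing to and from `F₀` costs
the factors `2` and `1 + C`. -/
lemma integral_abs_reverseMean_le (h : Contamination M A β v μ F₀ G g C) {τ : ℝ}
    (hτ : τ ∈ Icc (0 : ℝ) (1 / 2)) (hT : Integrable (T τ) F₀) :
    ∫ z, |reverseMean F₀ G T τ z.2.2| ∂F₀ ≤ 2 * (1 + C) * ∫ z, |T τ z| ∂F₀ := by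
  have hR := (h.law.integrable_next (h.integrable_reverseMean hτ hT)).abs
  have h1 := integral_abs_condMean_le (h := fun z : Obs K X => z.2.2) (by fun_prop)
    (integrable_mix h.density hτ hT)
  rw [integral_mix h.density hτ, integral_mix h.density hτ] at h1
  have h2 := integral_mono (hR.const_mul (1 / 2)) (integrable_tilt_mul h.density hτ hR)
    fun z => mul_le_mul_of_nonneg_right (h.density.half_le_tilt hτ z) (abs_nonneg _)
  have h3 := integral_mono (integrable_tilt_mul h.density hτ hT.abs) (hT.abs.const_mul (1 + C))
    fun z => mul_le_mul_of_nonneg_right (h.density.tilt_le hτ z) (abs_nonneg _)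
  rw [integral_const_mul] at h2 h3
  have h4 : ∫ z, tilt g τ z * |reverseMean F₀ G T τ z.2.2| ∂F₀ ≤ ∫ z, tilt g τ z * |T τ z| ∂F₀ := h1
  linarith

/-- The mean of a reverse conditional expectation against a convergent bounded path of functions
of the next state converges. -/
lemma tendsto_integral_reverseMean (h : Contamination M A β v μ F₀ G g C) (hτ₀ : 0 < τ₀)
    (hτ₀' : τ₀ ≤ 1 / 2) (hm : ∀ τ ∈ Icc 0 τ₀, Measurable (T τ)) (hdom : Integrable dom F₀)
    (hle : ∀ᵐ z ∂F₀, ∀ τ ∈ Icc 0 τ₀, |T τ z| ≤ dom z)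
    (hlim : ∀ᵐ z ∂F₀, Tendsto (fun τ => T τ z) (𝓝[>] 0) (𝓝 (T 0 z)))
    {l : ℝ → X → ℝ} (hl : ∀ τ ∈ Icc 0 τ₀, Measurable (l τ)) {c : ℝ} (hc0 : 0 ≤ c)
    (hc : ∀ᵐ x ∂μ, ∀ τ ∈ Icc 0 τ₀, |l τ x| ≤ c)
    (hllim : ∀ x, Tendsto (fun τ => l τ x) (𝓝[>] 0) (𝓝 (l 0 x))) :
    Tendsto (fun τ => ∫ x, l τ x * reverseMean F₀ G T τ x ∂μ) (𝓝[>] 0)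
      (𝓝 (∫ z, l 0 z.2.2 * T 0 z ∂F₀)) := by
  have mh : ∀ {τ}, τ ∈ Icc 0 τ₀ → τ ∈ Icc (0 : ℝ) (1 / 2) := fun hτ => ⟨hτ.1, hτ.2.trans hτ₀'⟩
  have hC := h.nonneg
  have hx2 : Measurable fun z : Obs K X => z.2.2 := by fun_prop
  have hTi : ∀ τ ∈ Icc 0 τ₀, Integrable (T τ) F₀ := fun τ hτ =>
    hdom.mono' (hm τ hτ).aestronglyMeasurable (by filter_upwards [hle] with z hz using hz τ hτ)
  have hcτ : ∀ τ ∈ Icc 0 τ₀, ∀ᵐ x ∂μ, |l τ x| ≤ c := fun τ hτ => by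
    filter_upwards [hc] with x hx using hx τ hτ
  have hRi : ∀ τ ∈ Icc 0 τ₀, Integrable (fun z : Obs K X => reverseMean F₀ G T τ z.2.2) F₀ :=
    fun τ hτ => h.law.integrable_next (h.integrable_reverseMean (mh hτ) (hTi τ hτ))
  have hlR : ∀ τ ∈ Icc 0 τ₀,
      Integrable (fun z : Obs K X => l τ z.2.2 * reverseMean F₀ G T τ z.2.2) F₀ := fun τ hτ =>
    (hRi τ hτ).bdd_mul ((hl τ hτ).comp hx2).aestronglyMeasurable (h.law.ae_next (hcτ τ hτ))
  -- Under the contaminated law the reverse mean can be replaced by `T`, which converges pointwise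
  -- and dominated.
  have h1 := tendsto_integral_tilt_mul h.density hτ₀ hτ₀' (φ := fun τ z => l τ z.2.2 * T τ z)
    (fun τ hτ => (((hl τ hτ).comp hx2).mul (hm τ hτ)).aestronglyMeasurable)
    (hdom.const_mul c)
    (by
      filter_upwards [hle, h.law.ae_next hc] with z hz hz' τ hτ
      rw [abs_mul]
      exact mul_le_mul (hz' τ hτ) (hz τ hτ) (abs_nonneg _) hc0)
    (by filter_upwards [hlim] with z hz using (hllim z.2.2).mul hz)
  -- Going back from the contaminated law to `F₀` costs `τ` times a quantity bounded in `L¹`, so no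
  -- pointwise convergence of the reverse means is needed.
  have h2 : Tendsto (fun τ : ℝ => τ * ∫ z, (g z - 1) *
      (l τ z.2.2 * reverseMean F₀ G T τ z.2.2) ∂F₀) (𝓝[>] 0) (𝓝 0) := by
    have hlin : Tendsto (fun τ : ℝ => τ * ((1 + C) * (c * (2 * (1 + C) * ∫ z, dom z ∂F₀))))
        (𝓝[>] 0) (𝓝 0) := by
      have : Tendsto (fun τ : ℝ => τ * ((1 + C) * (c * (2 * (1 + C) * ∫ z, dom z ∂F₀))))
          (𝓝 0) (𝓝 (0 * ((1 + C) * (c * (2 * (1 + C) * ∫ z, dom z ∂F₀))))) :=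
        (continuous_id.mul continuous_const).tendsto 0
      rw [zero_mul] at this
      exact this.mono_left nhdsWithin_le_nhds
    refine squeeze_zero_norm' ?_ hlin
    filter_upwards [eventually_Icc_right hτ₀] with τ hτ
    rw [norm_mul, Real.norm_of_nonneg hτ.1]
    refine mul_le_mul_of_nonneg_left ?_ hτ.1
    have h3 : ∫ z, |T τ z| ∂F₀ ≤ ∫ z, dom z ∂F₀ := integral_mono_ae (hTi τ hτ).abs hdom
      (by filter_upwards [hle] with z hz using hz τ hτ)
    calc ‖∫ z, (g z - 1) * (l τ z.2.2 * reverseMean F₀ G T τ z.2.2) ∂F₀‖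
        ≤ ∫ z, (1 + C) * (c * |reverseMean F₀ G T τ z.2.2|) ∂F₀ := by
          refine norm_integral_le_of_norm_le (((hRi τ hτ).abs.const_mul c).const_mul (1 + C)) ?_
          filter_upwards [h.law.ae_next (hcτ τ hτ)] with z hz
          rw [norm_mul, norm_mul]
          exact mul_le_mul (h.density.abs_sub_one_le z)
            (mul_le_mul_of_nonneg_right hz (abs_nonneg _)) (by positivity) (by positivity)
      _ = (1 + C) * (c * ∫ z, |reverseMean F₀ G T τ z.2.2| ∂F₀) := by
          rw [integral_const_mul, integral_const_mul]
      _ ≤ (1 + C) * (c * (2 * (1 + C) * ∫ z, dom z ∂F₀)) := by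
          have h4 := h.integral_abs_reverseMean_le (mh hτ) (hTi τ hτ)
          have h5 := mul_le_mul_of_nonneg_left h3 (show 0 ≤ 2 * (1 + C) by positivity)
          gcongr
          exact h4.trans h5
  have h3 := h1.sub h2
  simp only [tilt_zero, one_mul, sub_zero] at h3
  refine h3.congr' ?_
  filter_upwards [eventually_Icc_right hτ₀] with τ hτ
  rw [← h.integral_tilt_mul_reverseMean (mh hτ) (hTi τ hτ) (hl τ hτ) (hcτ τ hτ),
    ← h.law.integral_next (f := fun x => l τ x * reverseMean F₀ G T τ x)
      ((hl τ hτ).mul (measurable_condMean _ _ _)).aestronglyMeasurable, ← integral_const_mul,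
    ← integral_sub (integrable_tilt_mul h.density (mh hτ) (hlR τ hτ))
      (((hlR τ hτ).bdd_mul (h.density.measurable.sub_const 1).aestronglyMeasurable
        (ae_of_all _ h.density.abs_sub_one_le)).const_mul τ)]
  refine integral_congr_ae (ae_of_all _ fun z => ?_)
  simp only [tilt]
  ring

/-- The score of the choice probabilities times a reverse conditional expectation is neutral. -/
lemma isNeutral_score_reverseMean (h : Contamination M A β v μ F₀ G g C) (hτ₀ : 0 < τ₀)
    (hm : ∀ τ ∈ Icc 0 τ₀, Measurable (T τ)) (hdom : Integrable dom F₀)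
    (hle : ∀ᵐ z ∂F₀, ∀ τ ∈ Icc 0 τ₀, |T τ z| ≤ dom z)
    (hlim : ∀ᵐ z ∂F₀, Tendsto (fun τ => T τ z) (𝓝[>] 0) (𝓝 (T 0 z))) :
    IsNeutral F₀ g (fun τ z => pathScore M β v g τ z.2.1 z.1 * reverseMean F₀ G T τ z.2.1) ∧
    ∫ z, g z * (pathScore M β v g 0 z.2.1 z.1 * reverseMean F₀ G T 0 z.2.1) ∂F₀ =
      ∫ z, surplusDir M β v g z.2.2 * T 0 z ∂F₀ := by
  obtain ⟨B, τ₁, hB, hτ₁, hτ₁', hbd⟩ := h.exists_pathScore_bound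
  set τ₂ := min τ₀ τ₁
  have hτ₂ : 0 < τ₂ := lt_min hτ₀ hτ₁
  have m0 : ∀ {τ}, τ ∈ Icc 0 τ₂ → τ ∈ Icc 0 τ₀ := fun hτ => ⟨hτ.1, hτ.2.trans (min_le_left _ _)⟩
  have m1 : ∀ {τ}, τ ∈ Icc 0 τ₂ → τ ∈ Icc 0 τ₁ := fun hτ => ⟨hτ.1, hτ.2.trans (min_le_right _ _)⟩
  have mh : ∀ {τ}, τ ∈ Icc 0 τ₂ → τ ∈ Icc (0 : ℝ) (1 / 2) := fun hτ =>
    ⟨hτ.1, (m1 hτ).2.trans hτ₁'⟩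
  have hC := h.nonneg
  have hTi : ∀ τ ∈ Icc 0 τ₂, Integrable (T τ) F₀ := fun τ hτ =>
    hdom.mono' (hm τ (m0 hτ)).aestronglyMeasurable
      (by filter_upwards [hle] with z hz using hz τ (m0 hτ))
  have hbd' : ∀ τ ∈ Icc 0 τ₂, ∀ᵐ x ∂μ, ∀ k,
      M.trueProb β v x k * |pathScore M β v g τ x k| ≤ B := fun τ hτ => by
    filter_upwards [hbd] with x hx using hx τ (m1 hτ)
  have hR := fun τ hτ => h.integrable_reverseMean (mh hτ) (hTi τ hτ)
  have hRm : ∀ τ, Measurable (reverseMean F₀ G T τ) := fun τ => measurable_condMean _ _ _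
  have z2 : (0 : ℝ) ∈ Icc 0 τ₂ := ⟨le_rfl, hτ₂.le⟩
  have hdir : ∀ᵐ x ∂μ, ∀ τ ∈ Icc 0 τ₂, |pathScoreDir M β v g τ x| ≤ (K + 1) * ((1 + C) * B) := by
    filter_upwards [hbd] with x hx τ hτ using h.abs_pathScoreDir_le (hx τ (m1 hτ))
  -- Move the function of the state to the next state by stationarity, then undo the conditioning on
  -- it.
  have hzero : ∫ z, (g z - 1) * (pathScore M β v g 0 z.2.1 z.1 * reverseMean F₀ G T 0 z.2.1) ∂F₀ =
      ∫ z, pathScoreDir M β v g 0 z.2.2 * T 0 z ∂F₀ := by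
    rw [h.integral_sub_one_mul_score_mul (hRm 0) (hR 0 z2) (hbd' 0 z2),
      ← h.law.integral_next (f := fun x => pathScoreDir M β v g 0 x * reverseMean F₀ G T 0 x)
        ((h.measurable_pathScoreDir 0).mul (hRm 0)).aestronglyMeasurable]
    have := h.integral_tilt_mul_reverseMean (mh z2) (hTi 0 z2) (h.measurable_pathScoreDir 0)
      (c := (K + 1) * ((1 + C) * B)) (by filter_upwards [hdir] with x hx using hx 0 z2)
    simpa only [tilt_zero, one_mul] using this
  have hneu : IsNeutral F₀ g
      (fun τ z => pathScore M β v g τ z.2.1 z.1 * reverseMean F₀ G T τ z.2.1) := by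
    refine ⟨?_, ?_, ?_⟩
    · filter_upwards [eventually_Icc hτ₂] with τ hτ
      exact h.integrable_score_mul (hRm τ) (hR τ hτ) (hbd' τ hτ)
    · filter_upwards [eventually_Icc hτ₂] with τ hτ
      exact h.integral_tilt_mul_score_mul (mh hτ) (hRm τ) (hR τ hτ) (hbd' τ hτ)
    · rw [hzero]
      refine (h.tendsto_integral_reverseMean hτ₂ ((min_le_right _ _).trans hτ₁')
        (fun τ hτ => hm τ (m0 hτ)) hdom
        (by filter_upwards [hle] with z hz τ hτ using hz τ (m0 hτ)) hlim
        (l := fun τ => pathScoreDir M β v g τ) (fun τ _ => h.measurable_pathScoreDir τ)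
        (by positivity) hdir h.tendsto_pathScoreDir).congr' ?_
      filter_upwards [eventually_Icc_right hτ₂] with τ hτ
      exact (h.integral_sub_one_mul_score_mul (hRm τ) (hR τ hτ) (hbd' τ hτ)).symm
  refine ⟨hneu, ?_⟩
  have e : ∫ z, (g z - 1) * (pathScore M β v g 0 z.2.1 z.1 * reverseMean F₀ G T 0 z.2.1) ∂F₀ =
      ∫ z, g z * (pathScore M β v g 0 z.2.1 z.1 * reverseMean F₀ G T 0 z.2.1) ∂F₀ := by
    simp_rw [sub_mul, one_mul]
    rw [integral_sub (h.density.integrable_mul hneu.integrable_zero) hneu.integrable_zero,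
      hneu.integral_zero, sub_zero]
  rw [← e, hzero]
  simp_rw [h.pathScoreDir_zero]

end Reverse

section Ccp

/-- For the integral, the weight `y_j / P_j` restricts to choice `j` and cancels its probability, so
the mean of `surplusDir` at the next state becomes its mean under the kernel of `j`. -/
lemma adjCcp_components (h : Contamination M A β v μ F₀ G g C) (j : Fin K) (i : Fin r) :
    (IsNeutral F₀ g fun τ z => pathScore M β v g τ z.2.1 z.1 *
      (pathNuisance M A β v g F₀ G τ).rev j z.2.1 i) ∧
    ∫ z, g z * (pathScore M β v g 0 z.2.1 z.1 *
      (pathNuisance M A β v g F₀ G 0).rev j z.2.1 i) ∂F₀ =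
      ∫ x, M.instDeriv A j x (M.valueDiff β v x) i * contNextDir M β v g j x ∂μ := by
  obtain ⟨τ₀, hτ₀, hτ₀', b, -, hb, hb0, hbd⟩ := h.exists_pathWeight_bound
  have hx1 : Measurable fun z : Obs K X => z.2.1 := by fun_prop
  have hm : ∀ τ ∈ Icc 0 τ₀, Measurable fun z =>
      M.weight A β (pathFirst M β v g F₀ Selection.full τ) j z i := fun τ hτ => by
    simp only [weight_pathFirst]
    exact (measurable_ind _).mul
      ((h.measurable_pathWeight ⟨hτ.1, hτ.2.trans hτ₀'⟩ j i).comp hx1)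
  have hle : ∀ᵐ z ∂F₀, ∀ τ ∈ Icc 0 τ₀,
      |M.weight A β (pathFirst M β v g F₀ Selection.full τ) j z i| ≤ b z.2.1 := by
    filter_upwards [h.law.ae_state hbd] with z hz τ hτ
    rw [weight_pathFirst, abs_mul, abs_of_nonneg (ind_nonneg z _)]
    exact (mul_le_of_le_one_left (abs_nonneg _) (ind_le_one z _)).trans (hz τ hτ j i).1
  have hlim : ∀ᵐ z ∂F₀, Tendsto
      (fun τ => M.weight A β (pathFirst M β v g F₀ Selection.full τ) j z i) (𝓝[>] 0)
      (𝓝 (M.weight A β (pathFirst M β v g F₀ Selection.full 0) j z i)) := by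
    simp only [weight_pathFirst]
    filter_upwards [h.law.ae_state (h.tendsto_pathWeight j i)] with z hz using hz.const_mul _
  have h1 := h.isNeutral_score_reverseMean
    (T := fun τ z => M.weight A β (pathFirst M β v g F₀ Selection.full τ) j z i) hτ₀ hm
    (h.law.integrable_state hb) hle hlim
  refine ⟨h1.1, h1.2.trans ?_⟩
  obtain ⟨L, τ₁, -, -, -, -, hL⟩ := h.exists_pathNext_lipschitz
  have hTi : Integrable (fun z => M.weight A β (pathFirst M β v g F₀ Selection.full 0) j z i) F₀ :=
    (h.law.integrable_state hb).mono' (hm 0 ⟨le_rfl, hτ₀.le⟩).aestronglyMeasurable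
      (by filter_upwards [hle] with z hz using hz 0 ⟨le_rfl, hτ₀.le⟩)
  have hint : Integrable (fun z : Obs K X => surplusDir M β v g z.2.2 *
      M.weight A β (pathFirst M β v g F₀ Selection.full 0) j z i) F₀ :=
    hTi.bdd_mul (h.measurable_surplusDir.comp (by fun_prop)).aestronglyMeasurable
      (h.law.ae_next hL)
  have e : ∀ z : Obs K X, surplusDir M β v g z.2.2 *
      M.weight A β (pathFirst M β v g F₀ Selection.full 0) j z i = ind z j.succ *
        (pathWeight M A β v g F₀ 0 j i z.2.1 * surplusDir M β v g z.2.2) := fun z => by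
    rw [weight_pathFirst]; ring
  simp only [e] at hint ⊢
  rw [h.law.integral_ind_mul_of_integrable j.succ hint]
  refine integral_congr_ae (ae_of_all _ fun x => ?_)
  simp only
  rw [integral_const_mul, pathWeight, h.pathVal_zero, contNextDir]
  have := (h.law.pos x j.succ).ne'
  unfold Model.trueProb at this ⊢
  field_simp

/-- The same argument with `T` the constant path `y₀`; the probability of the renewal choice appears
because `renewNextDir` is a conditional mean. -/
lemma adjCcp_components_renew (h : Contamination M A β v μ F₀ G g C) :
    (IsNeutral F₀ g fun τ z => pathScore M β v g τ z.2.1 z.1 *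
      (pathNuisance M A β v g F₀ G τ).revRenew z.2.1) ∧
    ∫ z, g z * (pathScore M β v g 0 z.2.1 z.1 *
      (pathNuisance M A β v g F₀ G 0).revRenew z.2.1) ∂F₀ =
      F₀.real {z | z.1 = 0} * renewNextDir M β v g F₀ := by
  have h1 := h.isNeutral_score_reverseMean (T := fun _ z => ind z 0) (τ₀ := 1) one_pos
    (fun _ _ => measurable_ind 0) (integrable_const 1)
    (ae_of_all _ fun z _ _ => abs_ind_le_one z 0) (ae_of_all _ fun z => tendsto_const_nhds)
  refine ⟨h1.1, h1.2.trans ?_⟩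
  rw [renewNextDir, integral_cond_choice, mul_inv_cancel_left₀ (h.measureReal_choice_pos 0).ne']
  simp only [mul_comm]

lemma isNeutral_adjCcp (h : Contamination M A β v μ F₀ G g C) (i : Fin r) :
    IsNeutral F₀ g fun τ z => M.adjCcp β (pathFirst M β v g F₀ Selection.full τ)
      (pathNuisance M A β v g F₀ G τ) z i := by
  simp only [adjCcp_path]
  refine IsNeutral.sum h.density _ fun j _ => IsNeutral.add h.density
    ((h.adjCcp_components j i).1.const_mul (c := fun _ => -M.δ) tendsto_const_nhds)
    (h.adjCcp_components_renew.1.const_mul (c := fun τ =>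
      M.δ * ((mix F₀ G τ).real {z | z.1 = 0})⁻¹ * (pathNuisance M A β v g F₀ G τ).mean j i) ?_)
  exact ((h.tendsto_probRenew.inv₀ (h.measureReal_choice_mix_pos ⟨le_rfl, by norm_num⟩ 0).ne'
    ).const_mul _).mul (h.tendsto_mean j i)

lemma integral_adjCcp (h : Contamination M A β v μ F₀ G g C) (i : Fin r) :
    ∫ z, g z * M.adjCcp β (pathFirst M β v g F₀ Selection.full 0)
      (pathNuisance M A β v g F₀ G 0) z i ∂F₀ =
      ∑ j, (-M.δ * (∫ x, M.instDeriv A j x (M.valueDiff β v x) i * contNextDir M β v g j x ∂μ) +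
        M.δ * (∫ x, M.instDeriv A j x (M.valueDiff β v x) i ∂μ) * renewNextDir M β v g F₀) := by
  have h0 := (h.measureReal_choice_pos 0).ne'
  have hr := h.adjCcp_components_renew
  have i1 := fun j => h.density.integrable_mul (h.adjCcp_components j i).1.integrable_zero
  have i2 := h.density.integrable_mul hr.1.integrable_zero
  set κ : Fin K → ℝ := fun j => M.δ * ((mix F₀ G 0).real {z | z.1 = 0})⁻¹ *
    (pathNuisance M A β v g F₀ G 0).mean j i with hκ
  have e : ∀ z, g z * M.adjCcp β (pathFirst M β v g F₀ Selection.full 0)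
      (pathNuisance M A β v g F₀ G 0) z i =
      ∑ j, (-M.δ * (g z * (pathScore M β v g 0 z.2.1 z.1 *
          (pathNuisance M A β v g F₀ G 0).rev j z.2.1 i)) +
        κ j * (g z * (pathScore M β v g 0 z.2.1 z.1 *
          (pathNuisance M A β v g F₀ G 0).revRenew z.2.1))) := fun z => by
    rw [adjCcp_path, Finset.mul_sum]
    refine Finset.sum_congr rfl fun j _ => ?_
    rw [hκ]; ring
  simp_rw [e]
  rw [integral_finsetSum _ fun j _ => ((i1 j).const_mul _).fun_add (i2.const_mul _)]
  refine Finset.sum_congr rfl fun j _ => ?_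
  rw [integral_add ((i1 j).const_mul _) (i2.const_mul _), integral_const_mul, integral_const_mul,
    (h.adjCcp_components j i).2, hr.2, hκ]
  simp only [h.mean_zero, mix_zero]
  field_simp

end Ccp

end Contamination

end DDC

/-! ### Identifying the explicit path with the first steps under contamination. -/

namespace DDC

/-- Two first steps that define the same value of every moment function, up to null sets. -/
structure FirstStep.Agree {K : ℕ} {X Θ : Type*} [MeasurableSpace X] (β : Θ) (μ : Measure X)
    (γ γ' : FirstStep K X Θ) : Prop where
  ccp : γ.ccp =ᵐ[μ] γ'.ccp
  cont : ∀ j, γ.cont j β γ.ccp =ᵐ[μ] γ'.cont j β γ'.ccp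
  renew : γ.renew β γ.ccp = γ'.renew β γ'.ccp

section Selected

variable {K r : ℕ} {X Θ : Type*} [MeasurableSpace X] (M : Model K X Θ)

/-- The first steps with components under the laws contaminated as `σ` says. -/
noncomputable def selectedFirst (F₀ G : Measure (Obs K X)) [IsFiniteMeasure F₀]
    [IsFiniteMeasure G] (σ : Selection K) (τ : ℝ) : FirstStep K X Θ where
  ccp := (M.firstStep (mix F₀ G (σ.ccp * τ))).ccp
  cont j := (M.firstStep (mix F₀ G (σ.cont j * τ))).cont j
  renew := (M.firstStep (mix F₀ G (σ.renew * τ))).renew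

lemma firstStep_congr {F F' : Measure (Obs K X)} [IsFiniteMeasure F] [IsFiniteMeasure F']
    (hF : F = F') : M.firstStep F = M.firstStep F' := by
  subst hF; rfl

lemma nuisance_congr {F F' : Measure (Obs K X)} [IsFiniteMeasure F] [IsFiniteMeasure F']
    (A : X → Matrix (Fin r) (Fin (K + 1)) ℝ) (β : Θ) (hF : F = F') :
    M.nuisance A β F = M.nuisance A β F' := by
  subst hF; rfl

variable (F₀ G : Measure (Obs K X)) [IsFiniteMeasure F₀] [IsFiniteMeasure G] (τ : ℝ)

lemma firstStep_mix_zero : M.firstStep (mix F₀ G 0) = M.firstStep F₀ :=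
  firstStep_congr M (mix_zero F₀ G)

lemma selectedFirst_full :
    selectedFirst M F₀ G Selection.full τ = M.firstStep (mix F₀ G τ) := by
  simp [selectedFirst, Selection.full]

lemma selectedFirst_ccp : selectedFirst M F₀ G ⟨1, 0, 0⟩ τ =
    { M.firstStep F₀ with ccp := (M.firstStep (mix F₀ G τ)).ccp } := by
  simp [selectedFirst, firstStep_mix_zero]

lemma selectedFirst_cont (j : Fin K) : selectedFirst M F₀ G ⟨0, Pi.single j 1, 0⟩ τ =
    { M.firstStep F₀ with
      cont := Function.update (M.firstStep F₀).cont j ((M.firstStep (mix F₀ G τ)).cont j) } := by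
  simp only [selectedFirst, zero_mul, firstStep_mix_zero]
  congr 1
  funext k
  by_cases hk : k = j
  · subst hk; simp
  · simp [hk, firstStep_mix_zero]

lemma selectedFirst_renew : selectedFirst M F₀ G ⟨0, 0, 1⟩ τ =
    { M.firstStep F₀ with renew := (M.firstStep (mix F₀ G τ)).renew } := by
  simp [selectedFirst, firstStep_mix_zero]

end Selected

namespace FirstStep.Agree

variable {K r : ℕ} {X Θ : Type*} [MeasurableSpace X] {M : Model K X Θ}
  {A : X → Matrix (Fin r) (Fin (K + 1)) ℝ} {β : Θ} {μ : Measure X} [IsProbabilityMeasure μ]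
  {p : X → Fin (K + 1) → ℝ} {F₀ : Measure (Obs K X)} [IsProbabilityMeasure F₀] {γ γ' : FirstStep K X Θ}

lemma vTilde (h : Agree β μ γ γ') : M.vTilde β γ =ᵐ[μ] M.vTilde β γ' := by
  filter_upwards [ae_all_iff.2 h.cont] with x hx
  funext j
  simp only [Model.vTilde, hx j, h.renew]

lemma moment (hF : StationaryLaw μ p M.trans F₀) (h : Agree β μ γ γ') :
    M.moment A β γ =ᵐ[F₀] M.moment A β γ' := by
  filter_upwards [hF.ae_state (h.vTilde (M := M))] with z hz
  simp only [Model.moment, hz]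

lemma weight (hF : StationaryLaw μ p M.trans F₀) (h : Agree β μ γ γ') (j : Fin K) :
    M.weight A β γ j =ᵐ[F₀] M.weight A β γ' j := by
  filter_upwards [hF.ae_state (h.vTilde (M := M))] with z hz
  simp only [Model.weight, hz]

lemma nextTerm (hF : StationaryLaw μ p M.trans F₀) (h : Agree β μ γ γ') :
    M.nextTerm β γ.ccp =ᵐ[F₀] M.nextTerm β γ'.ccp := by
  filter_upwards [hF.ae_next h.ccp] with z hz
  simp only [Model.nextTerm, hz]

lemma adjCcp (hF : StationaryLaw μ p M.trans F₀) (h : Agree β μ γ γ') (l : Nuisance K r X) :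
    M.adjCcp β γ l =ᵐ[F₀] M.adjCcp β γ' l := by
  filter_upwards [hF.ae_state h.ccp] with z hz
  simp only [Model.adjCcp, hz]

lemma adjCont (hF : StationaryLaw μ p M.trans F₀) (h : Agree β μ γ γ') (j : Fin K) :
    M.adjCont A β γ j =ᵐ[F₀] M.adjCont A β γ' j := by
  filter_upwards [hF.ae_state (h.cont j), h.weight (A := A) hF j, h.nextTerm hF]
    with z h1 h2 h3
  simp only [Model.adjCont, h1, h2, h3]

lemma adjRenew (hF : StationaryLaw μ p M.trans F₀) (h : Agree β μ γ γ') (l : Nuisance K r X) :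
    M.adjRenew β γ l =ᵐ[F₀] M.adjRenew β γ' l := by
  filter_upwards [h.nextTerm hF] with z hz
  simp only [Model.adjRenew, hz, h.renew]

lemma adj (hF : StationaryLaw μ p M.trans F₀) (h : Agree β μ γ γ') (l : Nuisance K r X) :
    M.adj A β γ l =ᵐ[F₀] M.adj A β γ' l := by
  filter_upwards [h.adjCcp hF l, ae_all_iff.2 (h.adjCont (A := A) hF), h.adjRenew hF l]
    with z h1 h2 h3
  simp only [Model.adj, h1, h2, h3]

end FirstStep.Agree

namespace Contamination

variable {K r : ℕ} {X Θ : Type*} [MeasurableSpace X] {M : Model K X Θ}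
  {A : X → Matrix (Fin r) (Fin (K + 1)) ℝ} {β : Θ} {v : X → ℝ} {μ : Measure X}
  [IsProbabilityMeasure μ] {F₀ G : Measure (Obs K X)} [IsProbabilityMeasure F₀]
  [IsFiniteMeasure G] {g : Obs K X → ℝ} {C : ℝ}

/-- Conditional expectations are fixed only up to null sets, so the explicit formulas describe the
first steps almost everywhere. The switches scale `τ` separately, so a continuation may be formed
under one law at choice probabilities from another. -/
lemma exists_agree (h : Contamination M A β v μ F₀ G g C) {σ : Selection K} (hσ : σ.Valid) :
    ∃ τ₀ : ℝ, 0 < τ₀ ∧ τ₀ ≤ 1 / 2 ∧ ∀ τ ∈ Icc 0 τ₀,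
      FirstStep.Agree β μ (selectedFirst M F₀ G σ τ) (pathFirst M β v g F₀ σ τ) := by
  obtain ⟨τ₀, hτ₀, hτ₀', hni⟩ := h.exists_pathNext_integrable
  refine ⟨τ₀, hτ₀, hτ₀', fun τ hτ => ?_⟩
  have hscale : ∀ {d : ℝ}, d ∈ Icc (0 : ℝ) 1 → d * τ ∈ Icc 0 τ₀ := fun hd =>
    ⟨mul_nonneg hd.1 hτ.1, (mul_le_of_le_one_left hτ.1 hd.2).trans hτ.2⟩
  have hhalf : ∀ {d : ℝ}, d ∈ Icc (0 : ℝ) 1 → d * τ ∈ Icc (0 : ℝ) (1 / 2) := fun hd =>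
    ⟨(hscale hd).1, (hscale hd).2.trans hτ₀'⟩
  have hccp := h.firstStep_ccp_ae (hhalf hσ.ccp)
  exact ⟨hccp, fun j => h.firstStep_cont_ae (hhalf (hσ.cont j)) (hhalf hσ.ccp)
    (hni _ (hscale hσ.ccp)) hccp j, h.firstStep_renew_eq (hhalf hσ.renew) hccp⟩

lemma exists_agree_full (h : Contamination M A β v μ F₀ G g C) :
    ∃ τ₀ : ℝ, 0 < τ₀ ∧ τ₀ ≤ 1 / 2 ∧ ∀ τ ∈ Icc 0 τ₀,
      FirstStep.Agree β μ (M.firstStep (mix F₀ G τ)) (pathFirst M β v g F₀ Selection.full τ) ∧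
      M.nuisance A β (mix F₀ G τ) = pathNuisance M A β v g F₀ G τ ∧
      M.FirstStepsExist A β (mix F₀ G τ) := by
  obtain ⟨τ₁, hτ₁, hτ₁', hagree⟩ := h.exists_agree Selection.full_valid
  obtain ⟨τ₂, hτ₂, hτ₂', b, -, hb, hb0, hbd⟩ := h.exists_pathWeight_bound
  obtain ⟨τ₃, hτ₃, -, hni⟩ := h.exists_pathNext_integrable
  refine ⟨min τ₁ (min τ₂ τ₃), lt_min hτ₁ (lt_min hτ₂ hτ₃), (min_le_left _ _).trans hτ₁',
    fun τ hτ => ?_⟩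
  have m1 : τ ∈ Icc 0 τ₁ := ⟨hτ.1, hτ.2.trans (min_le_left _ _)⟩
  have m2 : τ ∈ Icc 0 τ₂ := ⟨hτ.1, hτ.2.trans ((min_le_right _ _).trans (min_le_left _ _))⟩
  have m3 : τ ∈ Icc 0 τ₃ := ⟨hτ.1, hτ.2.trans ((min_le_right _ _).trans (min_le_right _ _))⟩
  have mh : τ ∈ Icc (0 : ℝ) (1 / 2) := ⟨hτ.1, m1.2.trans hτ₁'⟩
  have hag := hagree τ m1
  rw [selectedFirst_full] at hag
  have hx1 : Measurable fun z : Obs K X => z.2.1 := by fun_prop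
  have hval : ∀ᵐ z ∂F₀, M.vTilde β (M.firstStep (mix F₀ G τ)) z.2.1 =
      pathVal M β v g F₀ τ z.2.1 := h.law.ae_state hag.vTilde
  have hderiv : ∀ j i, Integrable (fun z => M.instDeriv A j z.2.1
      (M.vTilde β (M.firstStep (mix F₀ G τ)) z.2.1) i) (mix F₀ G τ) := fun j i => by
    refine integrable_mix h.density mh (((h.law.integrable_state hb).mono'
      ((h.measurable_instDeriv (h.measurable_pathVal mh) j i).comp hx1).aestronglyMeasurable
      ?_).congr ?_)
    · filter_upwards [h.law.ae_state hbd] with z hz using (hz τ m2 j i).2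
    · filter_upwards [hval] with z hz
      rw [hz]; rfl
  refine ⟨hag, ?_, ⟨fun j => h.measureReal_choice_mix_pos mh j, ?_, fun j => ?_, fun j =>
    Integrable.of_eval (hderiv j)⟩⟩
  · have hrev : (M.nuisance A β (mix F₀ G τ)).rev = (pathNuisance M A β v g F₀ G τ).rev := by
      funext j x i
      -- The weights agree only almost everywhere, but their conditional means then agree as
      -- functions, so the two records of additional unknowns are equal outright.
      refine congrFun (condMean_congr_fun (ae_mix_of_ae h.density mh ?_) _) x
      filter_upwards [hag.weight (A := A) h.law j] with z hz
      rw [hz]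
    have hmean : (M.nuisance A β (mix F₀ G τ)).mean = (pathNuisance M A β v g F₀ G τ).mean := by
      funext j i
      refine (eval_integral (hderiv j) i).trans (integral_congr_ae
        (ae_mix_of_ae h.density mh ?_))
      filter_upwards [hval] with z hz
      rw [hz]
    rw [← show Nuisance.mk (M.nuisance A β (mix F₀ G τ)).revRenew
      (M.nuisance A β (mix F₀ G τ)).rev (M.nuisance A β (mix F₀ G τ)).probRenew
      (M.nuisance A β (mix F₀ G τ)).mean = M.nuisance A β (mix F₀ G τ) from rfl, hrev, hmean]
    rfl
  · refine integrable_mix h.density mh ((h.law.integrable_next (hni τ m3)).congr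
      (Filter.EventuallyEq.symm (h.nextTerm_ae ?_)))
    have := hag.ccp
    simpa [pathFirst, Selection.full] using this
  · refine Integrable.of_eval fun i => integrable_mix h.density mh
      (((h.law.integrable_state hb).mono' (f := fun z =>
        M.weight A β (pathFirst M β v g F₀ Selection.full τ) j z i) ?_ ?_).congr ?_)
    · simp only [weight_pathFirst]
      exact ((measurable_ind _).mul
        ((h.measurable_pathWeight mh j i).comp hx1)).aestronglyMeasurable
    · filter_upwards [h.law.ae_state hbd] with z hz
      rw [weight_pathFirst, norm_mul, Real.norm_of_nonneg (ind_nonneg z _)]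
      exact (mul_le_of_le_one_left (norm_nonneg _) (ind_le_one z _)).trans (hz τ m2 j i).1
    · filter_upwards [hag.weight (A := A) h.law j] with z hz
      rw [hz]

/-! ### Matching derivatives of the moments with means of the adjustments. -/

section Directions

lemma integrable_instDeriv (h : Contamination M A β v μ F₀ G g C) (j : Fin K) (i : Fin r) :
    Integrable (fun x => M.instDeriv A j x (M.valueDiff β v x) i) μ := by
  obtain ⟨τ₀, hτ₀, -, b, -, hb, -, hbd⟩ := h.exists_pathWeight_bound
  simp_rw [← h.pathVal_zero]
  refine hb.mono' (h.measurable_instDeriv (h.measurable_pathVal ⟨le_rfl, by norm_num⟩) j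
    i).aestronglyMeasurable ?_
  filter_upwards [hbd] with x hx using (hx 0 ⟨le_rfl, hτ₀.le⟩ j i).2

lemma integrable_instDeriv_mul_contDir (h : Contamination M A β v μ F₀ G g C) (j : Fin K)
    (i : Fin r) :
    Integrable (fun x => M.instDeriv A j x (M.valueDiff β v x) i * contDir M β v g j x) μ := by
  obtain ⟨D, hD⟩ := h.deviation_pathNext
  have hm : Measurable (contDir M β v g j) := by
    unfold contDir
    simp_rw [← pathCont_zero (M := M) (β := β) (v := v) (g := g)]
    have h0 : (0 : ℝ) ∈ Icc (0 : ℝ) (1 / 2) := ⟨le_rfl, by norm_num⟩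
    exact measurable_slice (φ := fun z : Obs K X => g z * (pathNext M β v g 0 z.2.2 -
      pathCont M β v g 0 0 j z.2.1)) (h.density.measurable.mul
        (((h.measurable_pathNext h0).comp (by fun_prop)).sub
          ((h.measurable_pathCont 0 h0 j).comp (by fun_prop)))) j.succ
  refine (h.integrable_instDeriv j i).mul_bdd (c := C * D) hm.aestronglyMeasurable ?_
  filter_upwards [hD] with x hx
  have hi := (((h.integrable_pathNext_zero_slice j.succ x).sub
    (integrable_const (pathCont M β v g 0 0 j x))).abs).const_mul C
  refine (norm_integral_le_of_norm_le hi (ae_of_all _ fun w => ?_)).trans ?_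
  · rw [norm_mul, Real.norm_of_nonneg (h.density.nonneg _), pathCont_zero]
    exact mul_le_mul_of_nonneg_right (h.density.le _) (abs_nonneg _)
  · rw [integral_const_mul]
    exact mul_le_mul_of_nonneg_left (hx j) h.nonneg

lemma integrable_instDeriv_mul_contNextDir (h : Contamination M A β v μ F₀ G g C) (j : Fin K)
    (i : Fin r) :
    Integrable (fun x => M.instDeriv A j x (M.valueDiff β v x) i * contNextDir M β v g j x) μ := by
  obtain ⟨L, -, -, -, -, -, hL⟩ := h.exists_pathNext_lipschitz
  have hm : Measurable (contNextDir M β v g j) :=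
    measurable_slice (φ := fun z : Obs K X => surplusDir M β v g z.2.2)
      (h.measurable_surplusDir.comp (by fun_prop)) j.succ
  refine (h.integrable_instDeriv j i).mul_bdd (c := L) hm.aestronglyMeasurable ?_
  filter_upwards [h.law.ae_next_slice hL] with x hx
  refine (norm_integral_le_of_norm_le (integrable_const L) (hx j.succ)).trans ?_
  simp

/-- The derivative is linear in the switches. Its three kinds of terms are matched with the three
kinds of adjustment terms one at a time. -/
lemma integral_valueDir (h : Contamination M A β v μ F₀ G g C) (σ : Selection K) (i : Fin r) :
    ∫ z, -∑ k, valueDir M β v g F₀ σ z.2.1 k *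
      M.instDeriv A k z.2.1 (M.valueDiff β v z.2.1) i ∂F₀ =
      -∑ k, M.δ * (
        σ.cont k * ∫ x, M.instDeriv A k x (M.valueDiff β v x) i * contDir M β v g k x ∂μ +
        σ.ccp * ∫ x, M.instDeriv A k x (M.valueDiff β v x) i * contNextDir M β v g k x ∂μ -
        (σ.renew * renewDir M β v g F₀ + σ.ccp * renewNextDir M β v g F₀) *
          ∫ x, M.instDeriv A k x (M.valueDiff β v x) i ∂μ) := by
  have i1 := fun k => ((h.integrable_instDeriv_mul_contDir k i).const_mul (σ.cont k))
  have i2 := fun k => ((h.integrable_instDeriv_mul_contNextDir k i).const_mul σ.ccp)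
  have i3 := fun k => (h.integrable_instDeriv k i).const_mul
    (σ.renew * renewDir M β v g F₀ + σ.ccp * renewNextDir M β v g F₀)
  have e : ∀ x k, valueDir M β v g F₀ σ x k * M.instDeriv A k x (M.valueDiff β v x) i =
      M.δ * (σ.cont k * (M.instDeriv A k x (M.valueDiff β v x) i * contDir M β v g k x) +
        σ.ccp * (M.instDeriv A k x (M.valueDiff β v x) i * contNextDir M β v g k x) -
        (σ.renew * renewDir M β v g F₀ + σ.ccp * renewNextDir M β v g F₀) *
          M.instDeriv A k x (M.valueDiff β v x) i) := fun x k => by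
    rw [valueDir]; ring
  have hi : ∀ k, Integrable (fun x => valueDir M β v g F₀ σ x k *
      M.instDeriv A k x (M.valueDiff β v x) i) μ := fun k => by
    simp_rw [e]
    exact (((i1 k).fun_add (i2 k)).sub (i3 k)).const_mul _
  rw [integral_neg, h.law.integral_state (f := fun x => ∑ k, valueDir M β v g F₀ σ x k *
    M.instDeriv A k x (M.valueDiff β v x) i) (integrable_finsetSum _ fun k _ => hi k).1,
    integral_finsetSum _ fun k _ => hi k]
  congr 1
  refine Finset.sum_congr rfl fun k _ => ?_
  simp_rw [e]
  rw [integral_const_mul, integral_sub ((i1 k).fun_add (i2 k)) (i3 k),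
    integral_add (i1 k) (i2 k), integral_const_mul, integral_const_mul, integral_const_mul]

end Directions

section Adjustment

lemma isNeutral_adj (h : Contamination M A β v μ F₀ G g C) (i : Fin r) :
    IsNeutral F₀ g fun τ z => M.adj A β (pathFirst M β v g F₀ Selection.full τ)
      (pathNuisance M A β v g F₀ G τ) z i := by
  simp only [Model.adj, Pi.add_apply, Finset.sum_apply]
  exact IsNeutral.add h.density (IsNeutral.add h.density (h.isNeutral_adjCcp i)
    (IsNeutral.sum h.density _ fun j _ => h.isNeutral_adjCont j i)) (h.isNeutral_adjRenew i)

lemma integral_adjCcp_eq (h : Contamination M A β v μ F₀ G g C) (i : Fin r) :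
    ∫ z, g z * M.adjCcp β (pathFirst M β v g F₀ Selection.full 0)
      (pathNuisance M A β v g F₀ G 0) z i ∂F₀ =
    ∫ z, -∑ k, valueDir M β v g F₀ ⟨1, 0, 0⟩ z.2.1 k *
      M.instDeriv A k z.2.1 (M.valueDiff β v z.2.1) i ∂F₀ := by
  rw [h.integral_adjCcp, h.integral_valueDir, ← Finset.sum_neg_distrib]
  refine Finset.sum_congr rfl fun k _ => ?_
  simp only [Pi.zero_apply]
  ring

lemma integral_adjCont_eq (h : Contamination M A β v μ F₀ G g C) (j : Fin K) (i : Fin r) :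
    ∫ z, g z * M.adjCont A β (pathFirst M β v g F₀ Selection.full 0) j z i ∂F₀ =
    ∫ z, -∑ k, valueDir M β v g F₀ ⟨0, Pi.single j 1, 0⟩ z.2.1 k *
      M.instDeriv A k z.2.1 (M.valueDiff β v z.2.1) i ∂F₀ := by
  rw [h.integral_adjCont, h.integral_valueDir, Finset.sum_eq_single j]
  · simp
  · intro k _ hk
    simp [hk]
  · simp

lemma integral_adjRenew_eq (h : Contamination M A β v μ F₀ G g C) (i : Fin r) :
    ∫ z, g z * M.adjRenew β (pathFirst M β v g F₀ Selection.full 0)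
      (pathNuisance M A β v g F₀ G 0) z i ∂F₀ =
    ∫ z, -∑ k, valueDir M β v g F₀ ⟨0, 0, 1⟩ z.2.1 k *
      M.instDeriv A k z.2.1 (M.valueDiff β v z.2.1) i ∂F₀ := by
  rw [h.integral_adjRenew, h.integral_valueDir, ← Finset.sum_neg_distrib, Finset.mul_sum]
  refine Finset.sum_congr rfl fun k _ => ?_
  simp only [Pi.zero_apply]
  ring

/-- Additivity: with all switches on, the derivative is the sum of the derivatives for the single
components. -/
lemma integral_adj_eq (h : Contamination M A β v μ F₀ G g C) (i : Fin r) :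
    ∫ z, g z * M.adj A β (pathFirst M β v g F₀ Selection.full 0)
      (pathNuisance M A β v g F₀ G 0) z i ∂F₀ =
    ∫ z, -∑ k, valueDir M β v g F₀ Selection.full z.2.1 k *
      M.instDeriv A k z.2.1 (M.valueDiff β v z.2.1) i ∂F₀ := by
  have i1 := h.density.integrable_mul (h.isNeutral_adjCcp i).integrable_zero
  have i2 := fun j => h.density.integrable_mul (h.isNeutral_adjCont j i).integrable_zero
  have i3 := h.density.integrable_mul (h.isNeutral_adjRenew i).integrable_zero
  have i4 := integrable_finsetSum Finset.univ fun j _ => i2 j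
  simp only [Model.adj, Pi.add_apply, Finset.sum_apply, mul_add, Finset.mul_sum]
  rw [integral_add (i1.fun_add i4) i3, integral_add i1 i4, integral_finsetSum _ fun j _ => i2 j,
    h.integral_adjCcp, h.integral_adjRenew, h.integral_valueDir]
  simp_rw [h.integral_adjCont]
  rw [Finset.mul_sum, ← Finset.sum_add_distrib, ← Finset.sum_add_distrib,
    ← Finset.sum_neg_distrib]
  refine Finset.sum_congr rfl fun k _ => ?_
  simp only [Selection.full]
  ring

lemma agree_zero (h : Contamination M A β v μ F₀ G g C) :
    FirstStep.Agree β μ (M.firstStep F₀) (pathFirst M β v g F₀ Selection.full 0) ∧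
      M.nuisance A β F₀ = pathNuisance M A β v g F₀ G 0 := by
  obtain ⟨τ₀, hτ₀, -, hag⟩ := h.exists_agree_full
  have h0 := hag 0 ⟨le_rfl, hτ₀.le⟩
  rw [firstStep_mix_zero] at h0
  exact ⟨h0.1, (nuisance_congr M A β (mix_zero F₀ G).symm).trans h0.2.1⟩

/-- The derivative of the mean of the moment functions when selected components vary. -/
lemma hasDerivWithinAt_selected (h : Contamination M A β v μ F₀ G g C) {σ : Selection K}
    (hσ : σ.Valid) {φ : Obs K X → Fin r → ℝ} (hφ : ∀ i, Integrable (fun z => φ z i) F₀)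
    (hR : ∀ i, ∫ z, g z * φ z i ∂F₀ = ∫ z, -∑ k, valueDir M β v g F₀ σ z.2.1 k *
      M.instDeriv A k z.2.1 (M.valueDiff β v z.2.1) i ∂F₀) :
    (∀ᶠ τ in 𝓝[≥] (0 : ℝ), Integrable (M.moment A β (selectedFirst M F₀ G σ τ)) F₀) ∧
    HasDerivWithinAt (fun τ => ∫ z, M.moment A β (selectedFirst M F₀ G σ τ) z ∂F₀)
      (∫ z, φ z ∂G) (Ici 0) 0 := by
  obtain ⟨τ₁, hτ₁, -, hag⟩ := h.exists_agree hσ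
  have hint : ∀ᶠ τ in 𝓝[≥] (0 : ℝ), ∀ i,
      Integrable (fun z => M.moment A β (selectedFirst M F₀ G σ τ) z i) F₀ ∧
      ∫ z, M.moment A β (selectedFirst M F₀ G σ τ) z i ∂F₀ =
        ∫ z, M.moment A β (pathFirst M β v g F₀ σ τ) z i ∂F₀ := by
    refine eventually_all.2 fun i => ?_
    obtain ⟨⟨τ₂, hτ₂, -, hi⟩, -⟩ := h.hasDerivWithinAt_moment hσ i
    filter_upwards [eventually_Icc hτ₁, eventually_Icc hτ₂] with τ h1 h2
    have e : (fun z => M.moment A β (pathFirst M β v g F₀ σ τ) z i) =ᵐ[F₀]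
        fun z => M.moment A β (selectedFirst M F₀ G σ τ) z i := by
      filter_upwards [(hag τ h1).moment (A := A) h.law] with z hz
      rw [hz]
    exact ⟨(hi τ h2).congr e, (integral_congr_ae e).symm⟩
  refine ⟨?_, hasDerivWithinAt_pi.2 fun i => ?_⟩
  · filter_upwards [hint] with τ h1 using Integrable.of_eval fun i => (h1 i).1
  · have hd := (h.hasDerivWithinAt_moment hσ i).2
    rw [← hR i, ← h.density.integral_eq, ← eval_integral (f := φ) fun i =>
      h.density.integrable (hφ i)] at hd
    have e : (fun τ => (∫ z, M.moment A β (selectedFirst M F₀ G σ τ) z ∂F₀) i) =ᶠ[𝓝[≥] 0]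
        fun τ => ∫ z, M.moment A β (pathFirst M β v g F₀ σ τ) z i ∂F₀ := by
      filter_upwards [hint] with τ h1
      rw [eval_integral fun i => (h1 i).1]
      exact (h1 i).2
    exact hd.congr_of_eventuallyEq e (e.self_of_nhdsWithin (mem_Ici.2 le_rfl))

/-- Adding the adjustment term makes the derivative of the mean vanish. -/
lemma hasDerivWithinAt_adjustedMoment (h : Contamination M A β v μ F₀ G g C) :
    (∀ᶠ τ in 𝓝[≥] (0 : ℝ), M.FirstStepsExist A β (mix F₀ G τ) ∧
      Integrable (M.adjustedMoment A β (M.firstStep (mix F₀ G τ)) (M.nuisance A β (mix F₀ G τ)))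
        F₀) ∧
    HasDerivWithinAt (fun τ => ∫ z, M.adjustedMoment A β (M.firstStep (mix F₀ G τ))
      (M.nuisance A β (mix F₀ G τ)) z ∂F₀) 0 (Ici 0) 0 := by
  obtain ⟨τ₁, hτ₁, -, hag⟩ := h.exists_agree_full
  have hint : ∀ᶠ τ in 𝓝[≥] (0 : ℝ), ∀ i,
      Integrable (fun z => M.adjustedMoment A β (M.firstStep (mix F₀ G τ))
        (M.nuisance A β (mix F₀ G τ)) z i) F₀ ∧
      ∫ z, M.adjustedMoment A β (M.firstStep (mix F₀ G τ)) (M.nuisance A β (mix F₀ G τ)) z i ∂F₀ =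
        ∫ z, M.moment A β (pathFirst M β v g F₀ Selection.full τ) z i ∂F₀ +
        ∫ z, M.adj A β (pathFirst M β v g F₀ Selection.full τ)
          (pathNuisance M A β v g F₀ G τ) z i ∂F₀ := by
    refine eventually_all.2 fun i => ?_
    obtain ⟨⟨τ₂, hτ₂, -, hi⟩, -⟩ := h.hasDerivWithinAt_moment Selection.full_valid i
    filter_upwards [eventually_Icc hτ₁, eventually_Icc hτ₂, (h.isNeutral_adj i).integrable]
      with τ h1 h2 h3
    obtain ⟨h4, h5, -⟩ := hag τ h1
    have e : (fun z => M.moment A β (pathFirst M β v g F₀ Selection.full τ) z i +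
        M.adj A β (pathFirst M β v g F₀ Selection.full τ) (pathNuisance M A β v g F₀ G τ) z i)
        =ᵐ[F₀] fun z => M.adjustedMoment A β (M.firstStep (mix F₀ G τ))
          (M.nuisance A β (mix F₀ G τ)) z i := by
      filter_upwards [h4.moment (A := A) h.law,
        h4.adj (A := A) h.law (pathNuisance M A β v g F₀ G τ)] with z hz hz'
      rw [h5, Model.adjustedMoment, Pi.add_apply, hz, hz']
    exact ⟨((hi τ h2).add h3).congr e,
      (integral_congr_ae e).symm.trans (integral_add (hi τ h2) h3)⟩
  refine ⟨?_, hasDerivWithinAt_pi.2 fun i => ?_⟩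
  · filter_upwards [hint, eventually_Icc hτ₁] with τ h1 h2
    exact ⟨(hag τ h2).2.2, Integrable.of_eval fun i => (h1 i).1⟩
  -- The mean of `m` has the derivative that `integral_adj_eq` identifies with the mean of the
  -- adjustment under `G`; neutrality gives the mean of the adjustment minus that derivative, so
  -- they cancel.
  · have hd := ((h.hasDerivWithinAt_moment Selection.full_valid i).2).add
      ((h.isNeutral_adj i).hasDerivWithinAt h.density)
    rw [h.integral_adj_eq, add_neg_cancel] at hd
    have e : (fun τ => (∫ z, M.adjustedMoment A β (M.firstStep (mix F₀ G τ))
        (M.nuisance A β (mix F₀ G τ)) z ∂F₀) i) =ᶠ[𝓝[≥] 0]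
        fun τ => ∫ z, M.moment A β (pathFirst M β v g F₀ Selection.full τ) z i ∂F₀ +
          ∫ z, M.adj A β (pathFirst M β v g F₀ Selection.full τ)
            (pathNuisance M A β v g F₀ G τ) z i ∂F₀ := by
      filter_upwards [hint] with τ h1
      rw [eval_integral fun i => (h1 i).1]
      exact (h1 i).2
    exact hd.congr_of_eventuallyEq e (e.self_of_nhdsWithin (mem_Ici.2 le_rfl))

end Adjustment

end Contamination

/-! ### Influence adjustments and local robustness. -/

section Main

variable {K r : ℕ} {X Θ : Type*} [MeasurableSpace X] {M : Model K X Θ}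
  {A : X → Matrix (Fin r) (Fin (K + 1)) ℝ} {β : Θ} {v : X → ℝ} {μ : Measure X}
  [IsProbabilityMeasure μ] {F₀ : Measure (Obs K X)} [IsProbabilityMeasure F₀]

/-- The trivial contamination by `F₀` itself, from which facts at the truth alone are read off. -/
lemma hasBoundedDensity_one {Z : Type*} [MeasurableSpace Z] (F : Measure Z) :
    HasBoundedDensity F F (fun _ => 1) 1 :=
  ⟨measurable_const, fun _ => zero_le_one, fun _ => le_rfl, by simp⟩

/-- A function that agrees with a neutral path at the truth and represents the derivative of the
mean of the moment functions is the influence adjustment. -/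
lemma isAdjustment_of_isNeutral (hv : M.IsValueFunction β v) (hreg : M.Regular A β v μ)
    (hF : StationaryLaw μ (M.trueProb β v) M.trans F₀) {σ : Selection K} (hσ : σ.Valid)
    {sub : FirstStep K X Θ → FirstStep K X Θ}
    (hsub : ∀ (G : Measure (Obs K X)) [IsFiniteMeasure G] (τ : ℝ),
      selectedFirst M F₀ G σ τ = sub (M.firstStep (mix F₀ G τ)))
    {φ : Obs K X → Fin r → ℝ} {ψ : (Obs K X → ℝ) → (G : Measure (Obs K X)) → [IsFiniteMeasure G] →
      ℝ → Obs K X → Fin r → ℝ}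
    (hφ : ∀ (G : Measure (Obs K X)) [IsFiniteMeasure G] (g : Obs K X → ℝ) (C : ℝ),
      Contamination M A β v μ F₀ G g C → φ =ᵐ[F₀] ψ g G 0 ∧
      (∀ i, IsNeutral F₀ g fun τ z => ψ g G τ z i) ∧
      ∀ i, ∫ z, g z * ψ g G 0 z i ∂F₀ = ∫ z, -∑ k, valueDir M β v g F₀ σ z.2.1 k *
        M.instDeriv A k z.2.1 (M.valueDiff β v z.2.1) i ∂F₀) :
    M.IsAdjustment A β F₀ sub φ := by
  have key : ∀ (G : Measure (Obs K X)) [IsFiniteMeasure G] (g : Obs K X → ℝ) (C : ℝ),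
      Contamination M A β v μ F₀ G g C → ∀ i, Integrable (fun z => φ z i) F₀ ∧
        ∫ z, φ z i ∂F₀ = 0 ∧ ∫ z, g z * φ z i ∂F₀ = ∫ z, -∑ k, valueDir M β v g F₀ σ z.2.1 k *
          M.instDeriv A k z.2.1 (M.valueDiff β v z.2.1) i ∂F₀ := by
    intro G _ g C h i
    obtain ⟨h1, h2, h3⟩ := hφ G g C h
    have e : (fun z => φ z i) =ᵐ[F₀] fun z => ψ g G 0 z i := by
      filter_upwards [h1] with z hz
      rw [hz]
    refine ⟨(h2 i).integrable_zero.congr e.symm, (integral_congr_ae e).trans (h2 i).integral_zero,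
      (integral_congr_ae ?_).trans (h3 i)⟩
    filter_upwards [e] with z hz
    rw [hz]
  -- Integrability and mean zero of `φ` do not involve a direction, so the trivial one suffices.
  have h0 := key F₀ _ _ ⟨hv, hreg, hF, hasBoundedDensity_one F₀⟩
  refine ⟨Integrable.of_eval fun i => (h0 i).1, ?_, fun G _ hG => ?_⟩
  · funext i
    rw [eval_integral fun i => (h0 i).1]
    exact (h0 i).2.1
  · obtain ⟨g, C, hg⟩ := hG.exists_density
    have h : Contamination M A β v μ F₀ G g C := ⟨hv, hreg, hF, hg⟩
    have h1 := h.hasDerivWithinAt_selected hσ (fun i => (h0 i).1) fun i => (key G g C h i).2.2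
    simp_rw [hsub] at h1
    exact ⟨Integrable.of_eval fun i => hg.integrable (h0 i).1, h1⟩

lemma isLocallyRobust_adjustedMoment (hv : M.IsValueFunction β v) (hreg : M.Regular A β v μ)
    (hF : StationaryLaw μ (M.trueProb β v) M.trans F₀) :
    M.IsLocallyRobust A β F₀ (M.adjustedMoment A β) := by
  have h : Contamination M A β v μ F₀ F₀ (fun _ => 1) 1 :=
    ⟨hv, hreg, hF, hasBoundedDensity_one F₀⟩
  obtain ⟨hag, hnu⟩ := h.agree_zero
  have i1 := h.integrable_moment_zero Selection.full_valid
  have i2 := fun i => (h.isNeutral_adj i).integrable_zero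
  have e : ∀ i, (fun z => M.moment A β (pathFirst M β v (fun _ => 1) F₀ Selection.full 0) z i +
      M.adj A β (pathFirst M β v (fun _ => 1) F₀ Selection.full 0)
        (pathNuisance M A β v (fun _ => 1) F₀ F₀ 0) z i) =ᵐ[F₀]
      fun z => M.adjustedMoment A β (M.firstStep F₀) (M.nuisance A β F₀) z i := fun i => by
    filter_upwards [hag.moment (A := A) hF,
      hag.adj (A := A) hF (pathNuisance M A β v (fun _ => 1) F₀ F₀ 0)] with z hz hz'
    rw [hnu, Model.adjustedMoment, Pi.add_apply, hz, hz']
  have hi := fun i => ((i1 i).add (i2 i)).congr (e i)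
  refine ⟨Integrable.of_eval hi, ?_, fun G _ hG => ?_⟩
  · funext i
    rw [eval_integral hi, ← integral_congr_ae (e i), integral_add (i1 i) (i2 i),
      h.integral_moment_zero Selection.full_valid, (h.isNeutral_adj i).integral_zero, add_zero]
    rfl
  · obtain ⟨g, C, hg⟩ := hG.exists_density
    exact Contamination.hasDerivWithinAt_adjustedMoment ⟨hv, hreg, hF, hg⟩

end Main

end DDC

theorem theorem2 {K r : ℕ} {X Θ Ω : Type*} [MeasurableSpace X] [MeasurableSpace Ω]
    (M : DDC.Model K X Θ) (β₀ : Θ) (v : X → ℝ) (hv : M.IsValueFunction β₀ v)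
    (Pr : Measure Ω) [IsProbabilityMeasure Pr]
    (x : ℕ → Ω → X) (ε : ℕ → Ω → Fin (K + 1) → ℝ) (y : ℕ → Ω → Fin (K + 1))
    (hgen : M.Generates β₀ v Pr x ε y)
    (hstat : ∀ s t, Pr.map (x s) = Pr.map (x t))
    (A : X → Matrix (Fin r) (Fin (K + 1)) ℝ)
    (hreg : M.Regular A β₀ v (Pr.map (x 0)))
    (t : ℕ) (F₀ : Measure (DDC.Obs K X)) [IsProbabilityMeasure F₀]
    (hF₀ : F₀ = Pr.map (fun ω => (y t ω, x t ω, x (t + 1) ω))) :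
    M.IsLocallyRobust A β₀ F₀ (M.adjustedMoment A β₀) ∧
    M.IsAdjustment A β₀ F₀ (fun γ => γ)
      (M.adj A β₀ (M.firstStep F₀) (M.nuisance A β₀ F₀)) ∧
    M.IsAdjustment A β₀ F₀ (fun γ => { M.firstStep F₀ with ccp := γ.ccp })
      (M.adjCcp β₀ (M.firstStep F₀) (M.nuisance A β₀ F₀)) ∧
    (∀ j : Fin K, M.IsAdjustment A β₀ F₀
      (fun γ => { M.firstStep F₀ with
        cont := Function.update (M.firstStep F₀).cont j (γ.cont j) })
      (M.adjCont A β₀ (M.firstStep F₀) j)) ∧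
    M.IsAdjustment A β₀ F₀ (fun γ => { M.firstStep F₀ with renew := γ.renew })
      (M.adjRenew β₀ (M.firstStep F₀) (M.nuisance A β₀ F₀)) := by
  have hprob : IsProbabilityMeasure (Pr.map (x 0)) :=
    Measure.isProbabilityMeasure_map (hgen.measurable_state 0).aemeasurable
  have hF := hgen.stationaryLaw hv hreg.smooth_prob.continuous hstat t
  rw [← hF₀] at hF
  refine ⟨DDC.isLocallyRobust_adjustedMoment hv hreg hF, ?_, ?_, fun j => ?_, ?_⟩
  -- The four adjustment claims differ only in the switches and in the neutral path that represents
  -- the term. That path always has all components moving, even when only one moves in the moment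
  -- functions.
  · refine DDC.isAdjustment_of_isNeutral hv hreg hF DDC.Selection.full_valid
      (fun G _ τ => DDC.selectedFirst_full M F₀ G τ) (ψ := fun g G _ τ => M.adj A β₀
        (DDC.pathFirst M β₀ v g F₀ DDC.Selection.full τ)
        (DDC.pathNuisance M A β₀ v g F₀ G τ)) fun G _ g C h =>
      ⟨?_, h.isNeutral_adj, h.integral_adj_eq⟩
    rw [h.agree_zero.2]
    exact h.agree_zero.1.adj hF _
  · refine DDC.isAdjustment_of_isNeutral hv hreg hF (σ := ⟨1, 0, 0⟩)
      ⟨by simp, by simp, by simp⟩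
      (fun G _ τ => DDC.selectedFirst_ccp M F₀ G τ) (ψ := fun g G _ τ => M.adjCcp β₀
        (DDC.pathFirst M β₀ v g F₀ DDC.Selection.full τ)
        (DDC.pathNuisance M A β₀ v g F₀ G τ)) fun G _ g C h =>
      ⟨?_, h.isNeutral_adjCcp, h.integral_adjCcp_eq⟩
    rw [h.agree_zero.2]
    exact h.agree_zero.1.adjCcp hF _
  · refine DDC.isAdjustment_of_isNeutral hv hreg hF (σ := ⟨0, Pi.single j 1, 0⟩)
      ⟨by simp, fun k => ?_, by simp⟩
      (fun G _ τ => DDC.selectedFirst_cont M F₀ G τ j) (ψ := fun g G _ τ => M.adjCont A β₀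
        (DDC.pathFirst M β₀ v g F₀ DDC.Selection.full τ) j) fun G _ g C h =>
      ⟨h.agree_zero.1.adjCont hF j, h.isNeutral_adjCont j, h.integral_adjCont_eq j⟩
    by_cases hk : k = j
    · subst hk; simp
    · simp [hk]
  · refine DDC.isAdjustment_of_isNeutral hv hreg hF (σ := ⟨0, 0, 1⟩)
      ⟨by simp, by simp, by simp⟩
      (fun G _ τ => DDC.selectedFirst_renew M F₀ G τ) (ψ := fun g G _ τ => M.adjRenew β₀
        (DDC.pathFirst M β₀ v g F₀ DDC.Selection.full τ)
        (DDC.pathNuisance M A β₀ v g F₀ G τ)) fun G _ g C h =>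
      ⟨?_, h.isNeutral_adjRenew, h.integral_adjRenew_eq⟩
    rw [h.agree_zero.2]
    exact h.agree_zero.1.adjRenew hF _
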